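/- Let $n\ge 1$ items $i\in\mathcal I=\{1,\dots,n\}$ be given with profits $p_i\in\mathbb Z$, weights $w_i\in\mathbb Z_{>0}$ and colors $\kappa_i\in\mathcal C=\{1,\dots,m\}$, together with a capacity $b\in\mathbb Z_{>0}$. (1) For a color $\tilde c\in\mathcal C$ let $g_i=1$ if $\kappa_i=\tilde c$ and $g_i=-1$ otherwise. The linear program $$\max\Big\{\sum_{i\in\mathcal I}p_ix_i \;:\; \sum_{i\in\mathcal I}w_ix_i\le b,\ \ \sum_{i\in\mathcal I}g_ix_i=1,\ \ 0\le x_i\le 1\ (i\in\mathcal I)\Big\}$$ over $x\in\mathbb R^n$ can be solved in $\mathcal O(n)$ time: there are a single algorithm and a constant $C$ such that on every such instance, given as the number $b$ and the list of the triples $(p_i,w_i,g_i)$, the algorithm halts after at most $C\,n$ steps and outputs an optimal solution (a list of $n$ rational numbers) if the linear program is feasible, and reports infeasibility if it is not. (2) The linear relaxation of the colored knapsack problem, $$\max\Big\{\sum_{i\in\mathcal I}p_ix_i \;:\; \sum_{i\in\mathcal I}w_ix_i\le b,\ \ \sum_{i:\kappa_i=c}x_i-\sum_{i:\kappa_i\ne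 c}x_i\le 1\ (c\in\mathcal C),\ \ 0\le x_i\le 1\ (i\in\mathcal I)\Big\},$$ can be solved in $\mathcal O(n)$ time in the same sense: there are a single algorithm and a constant $C$, independent of $n$, $m$ and all data, such that on every instance, given as $b$ and the list of the triples $(p_i,w_i,\kappa_i)$, the algorithm halts after at most $C\,n$ steps with an optimal solution. Here time is counted with unit cost per arithmetic operation or comparison: an algorithm is a fixed first-order recursive program over rational numbers and pairs, and each reading of a variable, constant, field operation ($+,-,\times,\div$) on two numbers, comparison of two numbers, creation or opening of a pair, local binding, and function call takes one step. -/

import Mathlib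

/-! ## The model of computation

Time is measured on first-order recursive programs over rational numbers and pairs (a pure Lisp with
field operations and comparisons of numbers).  A program is a finite text that does not depend on
the input.  Every evaluation of a subexpression costs one step: reading a variable, one arithmetic
operation, one comparison of two numbers, creating or opening one pair, one function call.
Structured values are shared by reference and never copied or compared, and an environment never
holds more values than the binding depth of the program text, so each step is a constant number of
operations of a unit-cost random access machine with arithmetic on rational numbers.  There are no
operations on the digits of a number (no rounding, no remainder) and no other primitives. -/

/-- Values: a number, a pair, or the constant `nil`. -/
inductive Val : Type
  | nil : Val
  | num : ℚ → Val
  | pair : Val → Val → Val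

/-- The arithmetic operations. -/
inductive ArithOp : Type
  | add
  | sub
  | mul
  | div

/-- Expressions.  Variables are de Bruijn indices, `var 0` being the most recently bound one.
`ifLe a b t e` evaluates `t` if `a ≤ b` and `e` otherwise.
`casePair a t e` evaluates `t`, with the first component of `a` bound to `var 0` and the second one
to `var 1`, if `a` is a pair, and `e` if it is not.
`letIn a t` evaluates `t` with the value of `a` bound to `var 0`.
`call f a` calls the `f`-th function of the program with argument `a`. -/
inductive Expr : Type
  | var : ℕ → Expr
  | nil : Expr
  | num : ℚ → Expr
  | arith : ArithOp → Expr → Expr → Expr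
  | ifLe : Expr → Expr → Expr → Expr → Expr
  | pair : Expr → Expr → Expr
  | casePair : Expr → Expr → Expr → Expr
  | letIn : Expr → Expr → Expr
  | call : ℕ → Expr → Expr

/-- A program is a finite list of bodies of (possibly mutually recursive) functions of one argument,
which is `var 0` in the body. -/
abbrev Program : Type := List Expr

/-- The result of an arithmetic operation; division by zero has none. -/
def ArithOp.apply : ArithOp → ℚ → ℚ → Option ℚ
  | .add, a, b => some (a + b)
  | .sub, a, b => some (a - b)
  | .mul, a, b => some (a * b)
  | .div, a, b => if b = 0 then none else some (a / b)

/-- `Eval P env e v t`: in the program `P`, with the values `env` of the variables, the evaluation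
of the expression `e` terminates with the value `v` after exactly `t` steps. -/
inductive Eval (P : Program) : List Val → Expr → Val → ℕ → Prop
  | var {env : List Val} {k : ℕ} {v : Val} (h : env[k]? = some v) :
      Eval P env (.var k) v 1
  | nil {env : List Val} : Eval P env .nil .nil 1
  | num {env : List Val} {q : ℚ} : Eval P env (.num q) (.num q) 1
  | arith {env : List Val} {o : ArithOp} {a b : Expr} {x y z : ℚ} {s t : ℕ}
      (ha : Eval P env a (.num x) s) (hb : Eval P env b (.num y) t) (h : o.apply x y = some z) :
      Eval P env (.arith o a b) (.num z) (s + t + 1)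
  | ifLe_true {env : List Val} {a b c d : Expr} {x y : ℚ} {v : Val} {s t u : ℕ}
      (ha : Eval P env a (.num x) s) (hb : Eval P env b (.num y) t) (h : x ≤ y)
      (hc : Eval P env c v u) :
      Eval P env (.ifLe a b c d) v (s + t + u + 1)
  | ifLe_false {env : List Val} {a b c d : Expr} {x y : ℚ} {v : Val} {s t u : ℕ}
      (ha : Eval P env a (.num x) s) (hb : Eval P env b (.num y) t) (h : ¬ x ≤ y)
      (hd : Eval P env d v u) :
      Eval P env (.ifLe a b c d) v (s + t + u + 1)
  | pair {env : List Val} {a b : Expr} {x y : Val} {s t : ℕ}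
      (ha : Eval P env a x s) (hb : Eval P env b y t) :
      Eval P env (.pair a b) (.pair x y) (s + t + 1)
  | casePair_pair {env : List Val} {a c d : Expr} {x y v : Val} {s t : ℕ}
      (ha : Eval P env a (.pair x y) s) (hc : Eval P (x :: y :: env) c v t) :
      Eval P env (.casePair a c d) v (s + t + 1)
  | casePair_nil {env : List Val} {a c d : Expr} {v : Val} {s t : ℕ}
      (ha : Eval P env a .nil s) (hd : Eval P env d v t) :
      Eval P env (.casePair a c d) v (s + t + 1)
  | casePair_num {env : List Val} {a c d : Expr} {q : ℚ} {v : Val} {s t : ℕ}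
      (ha : Eval P env a (.num q) s) (hd : Eval P env d v t) :
      Eval P env (.casePair a c d) v (s + t + 1)
  | letIn {env : List Val} {a c : Expr} {x v : Val} {s t : ℕ}
      (ha : Eval P env a x s) (hc : Eval P (x :: env) c v t) :
      Eval P env (.letIn a c) v (s + t + 1)
  | call {env : List Val} {f : ℕ} {a body : Expr} {x v : Val} {s t : ℕ}
      (ha : Eval P env a x s) (hf : P[f]? = some body) (hc : Eval P [x] body v t) :
      Eval P env (.call f a) v (s + t + 1)

/-- `P.Run input output t`: started on `input`, the program (that is, its function number `0`)
halts with `output` after exactly `t` steps. -/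
def Program.Run (P : Program) (input output : Val) (t : ℕ) : Prop :=
  ∃ body, P[0]? = some body ∧ Eval P [input] body output t

/-- Evaluation is deterministic: the value and the number of steps are unique. -/
theorem Eval.det {P : Program} {env : List Val} {e : Expr} {v v' : Val} {t t' : ℕ}
    (h : Eval P env e v t) (h' : Eval P env e v' t') : v = v' ∧ t = t' := by
  induction h generalizing v' t' <;> cases h' <;> grind

/-- Linked lists as values. -/
def Val.ofList : List Val → Val
  | [] => .nil
  | a :: l => .pair a (Val.ofList l)

/-! ## The linear programs -/

/-- An instance with `n` items and `m` colors: integral profits of any sign, positive integral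
weights, the colors of the items, and a positive integral capacity. -/
structure CKPInstance (n m : ℕ) : Type where
  p : Fin n → ℤ
  w : Fin n → ℤ
  κ : Fin n → Fin m
  b : ℤ
  w_pos : ∀ i, 0 < w i
  b_pos : 0 < b

namespace CKPInstance

variable {n m : ℕ} (I : CKPInstance n m)

/-- The coefficient `g i` of the color balance constraint of the color `c`: it is `1` if the item
`i` has color `c`, and `-1` otherwise. -/
def g (c : Fin m) (i : Fin n) : ℤ := if I.κ i = c then 1 else -1

/-- The objective function. -/
def profit (x : Fin n → ℝ) : ℝ := ∑ i, (I.p i : ℝ) * x i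

/-- The feasible set of the LP relaxation of the colored knapsack problem. -/
def feasibleCKP : Set (Fin n → ℝ) :=
  {x | ∑ i, (I.w i : ℝ) * x i ≤ I.b ∧
    (∀ c : Fin m, ∑ i with I.κ i = c, x i - ∑ i with I.κ i ≠ c, x i ≤ 1) ∧
    (∀ i, x i ≤ 1) ∧ ∀ i, 0 ≤ x i}

/-- The feasible set of the reduced LP, in which only the constraint of the color `c` is kept, as an
equality. -/
def feasibleReduced (c : Fin m) : Set (Fin n → ℝ) :=
  {x | ∑ i, (I.w i : ℝ) * x i ≤ I.b ∧ ∑ i, (I.g c i : ℝ) * x i = 1 ∧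
    (∀ i, x i ≤ 1) ∧ ∀ i, 0 ≤ x i}

/-- `x` is an optimal solution of the problem of maximizing the profit over `F`. -/
def IsOptimal (F : Set (Fin n → ℝ)) (x : Fin n → ℝ) : Prop :=
  x ∈ F ∧ ∀ y ∈ F, I.profit y ≤ I.profit x

/-- The input of the reduced LP: the capacity, and the list of the triples `(p i, w i, g i)`. -/
def encodeReduced (c : Fin m) : Val :=
  .pair (.num I.b) (Val.ofList (List.ofFn fun i =>
    .pair (.num (I.p i)) (.pair (.num (I.w i)) (.num (I.g c i)))))

/-- The input of the LP relaxation of the colored knapsack problem: the capacity, and the list of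
the triples `(p i, w i, κ i)`, colors being given by their numbers. -/
def encodeCKP : Val :=
  .pair (.num I.b) (Val.ofList (List.ofFn fun i =>
    .pair (.num (I.p i)) (.pair (.num (I.w i)) (.num ((I.κ i : ℕ) : ℚ)))))

end CKPInstance

/-- A vector of rational numbers, given as the list of its entries. -/
def encodeVec {n : ℕ} (x : Fin n → ℚ) : Val :=
  Val.ofList (List.ofFn fun i => .num (x i))

/-! The relaxation reduces to a program with one balance equation, and that program to linear
programs with one or two equality constraints over a box, which yield to weighted selection and to
prune-and-search in the plane of the two multipliers.

Colors. Solve the knapsack relaxation without colors. At most one color can hold a strict majority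
of the solution, and a weighted majority vote finds the only candidate in one pass, without sorting
or grouping (`vote_spec`). If the balance constraint of that color holds, all of them hold and the
solution is optimal. Otherwise, the segment from a feasible point to this solution contains a point
where the violated constraint is tight, with no loss of profit (`exists_tight`); so the constraint
may be made an equality. Once it is one, the constraints of all other colors follow.

Reduced program. Drop the knapsack constraint and solve. If the solution is too heavy, the same
segment argument makes the knapsack constraint tight. Complementing the variables with `g = -1`
turns the balance equation into a prescribed sum of the variables, so two equations `∑ a z = r₁` and
`∑ z = r₂` remain.

One equation. By complementary slackness the multiplier `τ` is a weighted quantile of the ratios `q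
/ c` with weights `|c|`, found in linear time with medians of medians (`wsel_comp`, `dot_zval`,
`solve1_comp`).

Two equations. An optimal solution has multipliers `(x, y)` (`exists_dual`), and the item `(a, p)`
takes the value 1 or 0 according to the side of the line `y = p - x a` on which `(x, y)` lies. A
vertical or horizontal line of the plane is tested by solving a one-equation program and computing
the range of the other linear form over its optimal solutions (`test_comp`): either the right-hand
side lies in the range and the whole program is solved, or the strict side of the multiplier is
known. Shear the lines so that the median slope is zero, pair lines of nonnegative and nonpositive
slope, and test at the median abscissa of their crossings and then at a median ordinate. For a
quarter of the crossings, one line of the pair misses the open quadrant of `(x, y)`, so its variable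
is determined (`pruned_of_crossing`). At least a sixteenth of the items disappears per round
(`length_le_pruned`), and the linear costs of the rounds form a geometric series (`solve2_comp`).

Running times are obtained by symbolic evaluation: call-free code has constant cost, folds have
linear cost, and only the selection and the two-equation program need a recurrence. -/

namespace ColoredKnapsack

/-! ## Evaluation with time bounds -/

/-- The number of nodes of an expression. -/
def size : Expr → ℕ
  | .var _ => 1
  | .nil => 1
  | .num _ => 1
  | .arith _ a b => size a + size b + 1
  | .ifLe a b c d => size a + size b + size c + size d + 1
  | .pair a b => size a + size b + 1
  | .casePair a c d => size a + size c + size d + 1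
  | .letIn a c => size a + size c + 1
  | .call _ a => size a + 1

/-- The value of an expression that makes no calls. -/
def den : List Val → Expr → Option Val
  | env, .var k => env[k]?
  | _, .nil => some .nil
  | _, .num q => some (.num q)
  | env, .arith o a b =>
    match den env a, den env b with
    | some (.num x), some (.num y) => (o.apply x y).map .num
    | _, _ => none
  | env, .ifLe a b c d =>
    match den env a, den env b with
    | some (.num x), some (.num y) => if x ≤ y then den env c else den env d
    | _, _ => none
  | env, .pair a b =>
    match den env a, den env b with
    | some x, some y => some (.pair x y)
    | _, _ => none
  | env, .casePair a c d =>
    match den env a with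
    | some (.pair x y) => den (x :: y :: env) c
    | some _ => den env d
    | none => none
  | env, .letIn a c =>
    match den env a with
    | some x => den (x :: env) c
    | none => none
  | _, .call _ _ => none

/-- In the program `P`, the expression `e` evaluates to `v` within `T` steps. -/
def Runs (P : Program) (env : List Val) (e : Expr) (v : Val) (T : ℕ) : Prop :=
  ∃ t ≤ T, Eval P env e v t

/-- The function `f` of the program `P` maps `x` to `v` within `T` steps. -/
def Comp (P : Program) (f : ℕ) (x v : Val) (T : ℕ) : Prop :=
  ∃ body, P[f]? = some body ∧ Runs P [x] body v T

theorem Runs.mono {P : Program} {env : List Val} {e : Expr} {v : Val} {S T : ℕ}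
    (h : Runs P env e v S) (hST : S ≤ T) : Runs P env e v T := by
  obtain ⟨t, ht, h⟩ := h
  exact ⟨t, ht.trans hST, h⟩

theorem Comp.mono {P : Program} {f : ℕ} {x v : Val} {S T : ℕ}
    (h : Comp P f x v S) (hST : S ≤ T) : Comp P f x v T := by
  obtain ⟨b, hb, h⟩ := h
  exact ⟨b, hb, h.mono hST⟩

/-- Without calls each node of the text is visited at most once, so its size bounds the time
whatever the data are. Only calls need further accounting. -/
theorem Runs.of_den {P : Program} {e : Expr} : ∀ {env : List Val} {v : Val},
    den env e = some v → Runs P env e v (size e) := by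
  induction e with
  | var k => intro env v h; exact ⟨1, le_rfl, .var h⟩
  | nil => intro env v h; cases h; exact ⟨1, le_rfl, .nil⟩
  | num q => intro env v h; cases h; exact ⟨1, le_rfl, .num⟩
  | arith o a b iha ihb =>
    intro env v h
    simp only [den] at h
    split at h
    · next x y hx hy =>
      obtain ⟨s, hs, ha⟩ := iha hx
      obtain ⟨t, ht, hb⟩ := ihb hy
      obtain ⟨z, hz, rfl⟩ := Option.map_eq_some_iff.1 h
      exact ⟨_, by simp only [size]; omega, .arith ha hb hz⟩
    · cases h
  | ifLe a b c d iha ihb ihc ihd =>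
    intro env v h
    simp only [den] at h
    split at h
    · next x y hx hy =>
      obtain ⟨s, hs, ha⟩ := iha hx
      obtain ⟨t, ht, hb⟩ := ihb hy
      split_ifs at h with hxy
      · obtain ⟨u, hu, hc⟩ := ihc h
        exact ⟨_, by simp only [size]; omega, .ifLe_true ha hb hxy hc⟩
      · obtain ⟨u, hu, hd⟩ := ihd h
        exact ⟨_, by simp only [size]; omega, .ifLe_false ha hb hxy hd⟩
    · cases h
  | pair a b iha ihb =>
    intro env v h
    simp only [den] at h
    split at h
    · next x y hx hy =>
      obtain ⟨s, hs, ha⟩ := iha hx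
      obtain ⟨t, ht, hb⟩ := ihb hy
      cases h
      exact ⟨_, by simp only [size]; omega, .pair ha hb⟩
    · cases h
  | casePair a c d iha ihc ihd =>
    intro env v h
    simp only [den] at h
    split at h
    · next x y hx =>
      obtain ⟨s, hs, ha⟩ := iha hx
      obtain ⟨t, ht, hc⟩ := ihc h
      exact ⟨_, by simp only [size]; omega, .casePair_pair ha hc⟩
    · next x hne hx =>
      obtain ⟨s, hs, ha⟩ := iha hx
      obtain ⟨t, ht, hd⟩ := ihd h
      cases x with
      | nil => exact ⟨_, by simp only [size]; omega, .casePair_nil ha hd⟩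
      | num q => exact ⟨_, by simp only [size]; omega, .casePair_num ha hd⟩
      | pair x y => exact absurd rfl (hne x y)
    · cases h
  | letIn a c iha ihc =>
    intro env v h
    simp only [den] at h
    split at h
    · next x hx =>
      obtain ⟨s, hs, ha⟩ := iha hx
      obtain ⟨t, ht, hc⟩ := ihc h
      exact ⟨_, by simp only [size]; omega, .letIn ha hc⟩
    · cases h
  | call f a _ => intro env v h; cases h

/-! ### Cost rules for calls, bindings and branches with call-free arguments. -/

section
variable {P : Program} {env : List Val} {f : ℕ} {a b c d e : Expr} {x y v : Val} {S T : ℕ} {p q : ℚ}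

theorem Runs.call (h : den env e = some x) (hf : Comp P f x v T) :
    Runs P env (.call f e) v (size e + T + 1) := by
  obtain ⟨s, hs, h⟩ := Runs.of_den (P := P) h
  obtain ⟨body, hb, t, ht, hf⟩ := hf
  exact ⟨_, by omega, .call h hb hf⟩

theorem Runs.letCall (h : den env e = some x) (hf : Comp P f x y S) (hc : Runs P (y :: env) c v T) :
    Runs P env (.letIn (.call f e) c) v (size e + S + T + 2) := by
  obtain ⟨s, hs, h⟩ := Runs.call h hf
  obtain ⟨t, ht, hc⟩ := hc
  exact ⟨_, by omega, .letIn h hc⟩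

theorem Runs.letDen (h : den env e = some x) (hc : Runs P (x :: env) c v T) :
    Runs P env (.letIn e c) v (size e + T + 1) := by
  obtain ⟨s, hs, h⟩ := Runs.of_den (P := P) h
  obtain ⟨t, ht, hc⟩ := hc
  exact ⟨_, by omega, .letIn h hc⟩

theorem Runs.ifTrue (ha : den env a = some (.num p)) (hb : den env b = some (.num q)) (h : p ≤ q)
    (hc : Runs P env c v T) : Runs P env (.ifLe a b c d) v (size a + size b + T + 1) := by
  obtain ⟨s, hs, ha⟩ := Runs.of_den (P := P) ha
  obtain ⟨t, ht, hb⟩ := Runs.of_den (P := P) hb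
  obtain ⟨u, hu, hc⟩ := hc
  exact ⟨_, by omega, .ifLe_true ha hb h hc⟩

theorem Runs.ifFalse (ha : den env a = some (.num p)) (hb : den env b = some (.num q)) (h : ¬ p ≤ q)
    (hd : Runs P env d v T) : Runs P env (.ifLe a b c d) v (size a + size b + T + 1) := by
  obtain ⟨s, hs, ha⟩ := Runs.of_den (P := P) ha
  obtain ⟨t, ht, hb⟩ := Runs.of_den (P := P) hb
  obtain ⟨u, hu, hd⟩ := hd
  exact ⟨_, by omega, .ifLe_false ha hb h hd⟩

theorem Runs.casePair (ha : den env a = some (.pair x y)) (hc : Runs P (x :: y :: env) c v T) :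
    Runs P env (.casePair a c d) v (size a + T + 1) := by
  obtain ⟨s, hs, ha⟩ := Runs.of_den (P := P) ha
  obtain ⟨u, hu, hc⟩ := hc
  exact ⟨_, by omega, .casePair_pair ha hc⟩

theorem Runs.caseNil (ha : den env a = some .nil) (hd : Runs P env d v T) :
    Runs P env (.casePair a c d) v (size a + T + 1) := by
  obtain ⟨s, hs, ha⟩ := Runs.of_den (P := P) ha
  obtain ⟨u, hu, hd⟩ := hd
  exact ⟨_, by omega, .casePair_nil ha hd⟩

end

/-! ## Program fragments -/

/-- The first component of a pair. -/
def fstE (e : Expr) : Expr := .casePair e (.var 0) .nil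
/-- The second component of a pair. -/
def sndE (e : Expr) : Expr := .casePair e (.var 1) .nil
/-- Sums. -/
def addE (a b : Expr) : Expr := .arith .add a b
/-- Differences. -/
def subE (a b : Expr) : Expr := .arith .sub a b
/-- Products. -/
def mulE (a b : Expr) : Expr := .arith .mul a b
/-- Quotients. -/
def divE (a b : Expr) : Expr := .arith .div a b

section
variable {env : List Val} {a b : Expr} {x y : Val} {p q : ℚ}

theorem den_fst (h : den env a = some (.pair x y)) : den env (fstE a) = some x := by
  simp [fstE, den, h]

theorem den_snd (h : den env a = some (.pair x y)) : den env (sndE a) = some y := by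
  simp [sndE, den, h]

end

/-- The body of a function with number `k` that maps `(ctx, list)` to the right fold of the list:
`init` sees `ctx` as `var 0`; `step` sees the result for the tail as `var 0`, the head as `var 1`
and `ctx` as `var 3`. -/
def foldBody (k : ℕ) (init step : Expr) : Expr :=
  .casePair (.var 0)
    (.casePair (.var 1)
      (.letIn (.call k (.pair (.var 2) (.var 1))) step)
      init)
    .nil

/-- There is one call per cell with constant work around it, because `init` and `step` make no
calls; 12 covers the rest of `foldBody`. The constant depends on the program text alone. -/
theorem fold_comp {P : Program} {k : ℕ} {init step : Expr}
    (hk : P[k]? = some (foldBody k init step)) {α : Type} (enc : α → Val) (ctx : Val)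
    (res : List α → Val)
    (h0 : ∀ arg, den [ctx, .nil, arg] init = some (res []))
    (hs : ∀ x l tl full arg,
      den [res l, enc x, tl, ctx, full, arg] step = some (res (x :: l))) (l : List α) :
    Comp P k (.pair ctx (Val.ofList (l.map enc))) (res l)
      ((size init + size step + 12) * (l.length + 1)) := by
  refine ⟨_, hk, ?_⟩
  induction l with
  | nil =>
    refine (Runs.casePair (x := ctx) (y := .nil) rfl (Runs.caseNil rfl (Runs.of_den (h0 _)))).mono ?_
    simp only [size, List.length_nil]; omega
  | cons x l ih =>
    refine (Runs.casePair (x := ctx) rfl (Runs.casePair (x := enc x) rfl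
      (Runs.letCall rfl ⟨_, hk, ih⟩ (Runs.of_den (hs _ _ _ _ _))))).mono ?_
    simp only [size, List.length_cons]
    have : ∀ C n : ℕ, C * (n + 1 + 1) = C * (n + 1) + C := by intros; ring
    rw [this]
    omega

/-- Records of two numbers. -/
def enc2 {α : Type} (f g : α → ℚ) (i : α) : Val := .pair (.num (f i)) (.num (g i))
/-- Records of three numbers. -/
def enc3 {α : Type} (f g h : α → ℚ) (i : α) : Val :=
  .pair (.num (f i)) (.pair (.num (g i)) (.num (h i)))
/-- Lists of numbers. -/
def encL {α : Type} (f : α → ℚ) (l : List α) : Val := Val.ofList (l.map fun i => .num (f i))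

/-! ## The program -/

/-- The numbers of the functions of the program. -/
abbrev fPart : ℕ := 1
abbrev fLen : ℕ := 2
abbrev fQsel : ℕ := 3
abbrev fMed : ℕ := 4
abbrev fWsel : ℕ := 5
abbrev fNorm : ℕ := 6
abbrev fSolve1 : ℕ := 7
abbrev fTie : ℕ := 8
abbrev fLex : ℕ := 9
abbrev fNeg : ℕ := 10
abbrev fSums : ℕ := 11
abbrev fComb : ℕ := 12
abbrev fTest : ℕ := 13
abbrev fUnit : ℕ := 14
abbrev fMedian : ℕ := 15
abbrev fShear : ℕ := 16
abbrev fSplit : ℕ := 17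
abbrev fCross : ℕ := 18
abbrev fVert : ℕ := 19
abbrev fBeyond : ℕ := 20
abbrev fHor : ℕ := 21
abbrev fPrune : ℕ := 22
abbrev fMerge : ℕ := 23
abbrev fSolve2 : ℕ := 24
abbrev fTestV : ℕ := 25
abbrev fTestH : ℕ := 26
abbrev fFinish : ℕ := 27
abbrev fReduced : ℕ := 28
abbrev fSwap : ℕ := 29
abbrev fWsum : ℕ := 30
abbrev fZmap : ℕ := 31
abbrev fCompl : ℕ := 32
abbrev fUncompl : ℕ := 33
abbrev fDup : ℕ := 34
abbrev fParams : ℕ := 35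
abbrev fVote : ℕ := 36
abbrev fExcess : ℕ := 37
abbrev fRecolor : ℕ := 38

/-- `(τ, list of (key, weight))` to the weights of the keys `> τ` and `≥ τ` and the lists of the
records with keys `> τ` and `< τ`. -/
def partBody : Expr :=
  foldBody fPart (.pair (.pair (.num 0) (.num 0)) (.pair .nil .nil))
    (.ifLe (fstE (.var 1)) (.var 3)
      (.ifLe (.var 3) (fstE (.var 1))
        (.pair (.pair (fstE (fstE (.var 0))) (addE (sndE (fstE (.var 0))) (sndE (.var 1))))
          (sndE (.var 0)))
        (.pair (fstE (.var 0))
          (.pair (fstE (sndE (.var 0))) (.pair (.var 1) (sndE (sndE (.var 0)))))))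
      (.pair (.pair (addE (fstE (fstE (.var 0))) (sndE (.var 1)))
          (addE (sndE (fstE (.var 0))) (sndE (.var 1))))
        (.pair (.pair (.var 1) (fstE (sndE (.var 0)))) (sndE (sndE (.var 0))))))

/-- The length of a list. -/
def lenBody : Expr := foldBody fLen (.num 0) (addE (.var 0) (.num 1))

/-- One round of selection by the pivot `pivot`, the argument `(r, list)` being `var d`. -/
def selTail (self : ℕ) (pivot : Expr) (d : ℕ) : Expr :=
  .letIn pivot (.letIn (.call fPart (.pair (.var 0) (sndE (.var (d + 1)))))
    (.ifLe (fstE (fstE (.var 0))) (fstE (.var (d + 2)))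
      (.ifLe (fstE (.var (d + 2))) (sndE (fstE (.var 0)))
        (.var 1)
        (.call self (.pair (subE (fstE (.var (d + 2))) (sndE (fstE (.var 0))))
          (sndE (sndE (.var 0))))))
      (.call self (.pair (fstE (.var (d + 2))) (fstE (sndE (.var 0)))))))

/-- Weighted selection with the first key as the pivot. -/
def qselBody : Expr := selTail fQsel (fstE (fstE (sndE (.var 0)))) 0

/-- The medians of consecutive groups of five, with weight one. -/
def medBody : Expr :=
  .casePair (.var 0) (.casePair (.var 1) (.casePair (.var 1) (.casePair (.var 1)
    (.casePair (.var 1)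
      (.letIn (.call fMed (.var 1))
        (.letIn (.call fQsel (.pair (.num (5 / 2))
            (.pair (.pair (fstE (.var 1)) (.num 1)) (.pair (.pair (fstE (.var 3)) (.num 1))
            (.pair (.pair (fstE (.var 5)) (.num 1)) (.pair (.pair (fstE (.var 7)) (.num 1))
            (.pair (.pair (fstE (.var 9)) (.num 1)) .nil)))))))
          (.pair (.pair (.var 0) (.num 1)) (.var 1))))
      .nil) .nil) .nil) .nil) .nil

/-- Weighted selection with the median of the medians of five as the pivot. -/
def wselBody : Expr :=
  .letIn (.call fLen (.pair .nil (sndE (.var 0))))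
    (.ifLe (.num 25) (.var 0)
      (.letIn (.call fMed (sndE (.var 1)))
        (.letIn (.call fLen (.pair .nil (.var 0)))
          (selTail fWsel (.call fWsel (.pair (divE (.var 0) (.num 2)) (.var 1))) 3)))
      (.call fQsel (.var 1)))

/-- From the records `(q, (c, f))` with `c ≠ 0` the list of `(q / c, |c|)`, the sum of all `|c|`, and
the sum of the `|c|` with `c < 0`. -/
def normBody : Expr :=
  foldBody fNorm (.pair .nil (.pair (.num 0) (.num 0)))
    (.ifLe (fstE (sndE (.var 1))) (.num 0)
      (.ifLe (.num 0) (fstE (sndE (.var 1)))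
        (.var 0)
        (.pair
          (.pair (.pair (divE (fstE (.var 1)) (fstE (sndE (.var 1))))
            (subE (.num 0) (fstE (sndE (.var 1))))) (fstE (.var 0)))
          (.pair (subE (fstE (sndE (.var 0))) (fstE (sndE (.var 1))))
            (subE (sndE (sndE (.var 0))) (fstE (sndE (.var 1)))))))
      (.pair
        (.pair (.pair (divE (fstE (.var 1)) (fstE (sndE (.var 1)))) (fstE (sndE (.var 1))))
          (fstE (.var 0)))
        (.pair (addE (fstE (sndE (.var 0))) (fstE (sndE (.var 1)))) (sndE (sndE (.var 0))))))

/-- The linear program with one equality constraint: `(r, list of (q, (c, f)))` to the multiplier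
and the value of the positive ties, or `nil` if it is infeasible. -/
def solve1Body : Expr :=
  .letIn (.call fNorm (.pair .nil (sndE (.var 0))))
    (.letIn (addE (fstE (.var 1)) (sndE (sndE (.var 0))))
      (.ifLe (.num 0) (.var 0)
        (.ifLe (.var 0) (fstE (sndE (.var 1)))
          (.casePair (fstE (.var 1))
            (.letIn (.call fWsel (.pair (.var 2) (fstE (.var 3))))
              (.letIn (.call fPart (.pair (.var 0) (fstE (.var 4))))
                (.pair (.var 1) (divE (subE (.var 4) (fstE (fstE (.var 0))))
                  (subE (sndE (fstE (.var 0))) (fstE (fstE (.var 0))))))))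
            (.pair (.num 0) (.num 0)))
          .nil)
        .nil))

/-- The value of the variable with profit `q` and coefficient `c` in an optimal solution of the
linear program with one equality constraint. -/
def zvalE (τ θ q c : Expr) : Expr :=
  .ifLe (subE q (mulE τ c)) (.num 0)
    (.ifLe (.num 0) (subE q (mulE τ c))
      (.ifLe c (.num 0) (.ifLe (.num 0) c (.num 0) (subE (.num 1) θ)) θ)
      (.num 0))
    (.num 1)

/-- The ties `(f, (c, f))` and the sum of the `c` with `q - τ c > 0`. -/
def tieBody : Expr :=
  foldBody fTie (.pair .nil (.num 0))
    (.ifLe (subE (fstE (.var 1)) (mulE (.var 3) (fstE (sndE (.var 1))))) (.num 0)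
      (.ifLe (.num 0) (subE (fstE (.var 1)) (mulE (.var 3) (fstE (sndE (.var 1)))))
        (.pair (.pair (.pair (sndE (sndE (.var 1)))
          (.pair (fstE (sndE (.var 1))) (sndE (sndE (.var 1))))) (fstE (.var 0))) (sndE (.var 0)))
        (.var 0))
      (.pair (fstE (.var 0)) (addE (sndE (.var 0)) (fstE (sndE (.var 1))))))

/-- As `solve1Body`, with `f` as a secondary objective. -/
def lexBody : Expr :=
  .letIn (.call fSolve1 (.var 0))
    (.casePair (.var 0)
      (.letIn (.call fTie (.pair (.var 0) (sndE (.var 3))))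
        (.letIn (.call fSolve1 (.pair (subE (fstE (.var 4)) (sndE (.var 0))) (fstE (.var 0))))
          (.pair (.var 2) (.var 0))))
      .nil)

/-- The values in the solution with the parameters `A` computed by `lexBody`. -/
def lexvalE (A q c f : Expr) : Expr :=
  .ifLe (subE q (mulE (fstE A) c)) (.num 0)
    (.ifLe (.num 0) (subE q (mulE (fstE A) c))
      (zvalE (fstE (sndE A)) (sndE (sndE A)) f c)
      (.num 0))
    (.num 1)

/-- Negation of the secondary objective. -/
def negBody : Expr :=
  foldBody fNeg .nil
    (.pair (.pair (fstE (.var 1)) (.pair (fstE (sndE (.var 1)))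
      (subE (.num 0) (sndE (sndE (.var 1)))))) (.var 0))

/-- The value of the larger solution in `sumsBody` and `combBody`. -/
def upvalE (A : Expr) : Expr :=
  lexvalE A (fstE (.var 1)) (fstE (sndE (.var 1))) (sndE (sndE (.var 1)))

/-- The value of the smaller solution in `sumsBody` and `combBody`. -/
def dnvalE (B : Expr) : Expr :=
  lexvalE B (fstE (.var 1)) (fstE (sndE (.var 1))) (subE (.num 0) (sndE (sndE (.var 1))))

/-- The largest and the smallest value of the secondary objective. -/
def sumsBody : Expr :=
  foldBody fSums (.pair (.num 0) (.num 0))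
    (.pair (addE (fstE (.var 0)) (mulE (sndE (sndE (.var 1))) (upvalE (fstE (.var 3)))))
      (addE (sndE (.var 0)) (mulE (sndE (sndE (.var 1))) (dnvalE (sndE (.var 3))))))

/-- A convex combination of the two extreme solutions. -/
def combBody : Expr :=
  foldBody fComb .nil
    (.pair (addE (mulE (fstE (.var 3)) (upvalE (fstE (sndE (.var 3)))))
      (mulE (subE (.num 1) (fstE (.var 3))) (dnvalE (sndE (sndE (.var 3)))))) (.var 0))

/-- `((r, s), list of (q, (c, f)))`: solves the linear program with the constraint for `c` alone and
compares the possible values of the sum for `f` with `s`.  The result is `nil` if the program is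
infeasible, `(1, nil)` or `(-1, nil)` if `s` is too large or too small, and otherwise
`(x, (nil, nil))` with an optimal solution `x` that satisfies the second constraint as well. -/
def testBody : Expr :=
  .letIn (.call fLex (.pair (fstE (fstE (.var 0))) (sndE (.var 0))))
    (.casePair (.var 0)
      (.letIn (.call fNeg (.pair .nil (sndE (.var 3))))
        (.letIn (.call fLex (.pair (fstE (fstE (.var 4))) (.var 0)))
          (.letIn (.call fSums (.pair (.pair (.var 4) (.var 0)) (sndE (.var 5))))
            (.ifLe (sndE (fstE (.var 6))) (fstE (.var 0))
              (.ifLe (sndE (.var 0)) (sndE (fstE (.var 6)))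
                (.letIn (.ifLe (fstE (.var 0)) (sndE (.var 0)) (.num 0)
                    (divE (subE (sndE (fstE (.var 6))) (sndE (.var 0)))
                      (subE (fstE (.var 0)) (sndE (.var 0)))))
                  (.letIn (.call fComb (.pair (.pair (.var 0) (.pair (.var 6) (.var 2)))
                      (sndE (.var 7))))
                    (.pair (.var 0) (.pair .nil .nil))))
                (.pair (.num (-1)) .nil))
              (.pair (.num 1) .nil)))))
      .nil)

/-- Replaces all weights by one. -/
def unitBody : Expr := foldBody fUnit .nil (.pair (.pair (fstE (.var 1)) (.num 1)) (.var 0))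

/-- The median of the keys. -/
def medianBody : Expr :=
  .letIn (.call fLen (.pair .nil (.var 0)))
    (.letIn (.call fUnit (.pair .nil (.var 1)))
      (.call fWsel (.pair (divE (.var 1) (.num 2)) (.var 0))))

/-- Subtracts a number from the keys. -/
def shearBody : Expr :=
  foldBody fShear .nil
    (.pair (.pair (subE (fstE (.var 1)) (.var 3)) (sndE (.var 1))) (.var 0))

/-- The lists of the records with keys `≤ 0` and with keys `≥ 0`. -/
def splitBody : Expr :=
  foldBody fSplit (.pair .nil .nil)
    (.pair (.ifLe (fstE (.var 1)) (.num 0) (.pair (.var 1) (fstE (.var 0))) (fstE (.var 0)))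
      (.ifLe (.num 0) (fstE (.var 1)) (.pair (.var 1) (sndE (.var 0))) (sndE (.var 0))))

/-- The abscissa of the crossing of the lines of two records `(a, p)`. -/
def lamE (i j : Expr) : Expr :=
  .ifLe (fstE j) (fstE i) (.num 0) (divE (subE (sndE j) (sndE i)) (subE (fstE j) (fstE i)))

/-- The crossings of the lines of corresponding records of two lists. -/
def crossBody : Expr :=
  .casePair (.var 0)
    (.casePair (.var 0)
      (.casePair (.var 3)
        (.letIn (.call fCross (.pair (.var 3) (.var 1)))
          (.pair
            (.pair (lamE (.var 3) (.var 1))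
              (subE (sndE (.var 3)) (mulE (lamE (.var 3) (.var 1)) (fstE (.var 3)))))
            (.var 0)))
        .nil)
      .nil)
    .nil

/-- The records of the one-constraint program on a vertical line. -/
def vertBody : Expr :=
  foldBody fVert .nil
    (.pair (.pair (subE (sndE (.var 1)) (mulE (.var 3) (fstE (.var 1))))
      (.pair (.num 1) (fstE (.var 1)))) (.var 0))

/-- The ordinates of the crossings that are not strictly on the side `σ` of `λ`. -/
def beyondBody : Expr :=
  foldBody fBeyond .nil
    (.ifLe (mulE (fstE (.var 3)) (fstE (.var 1))) (mulE (fstE (.var 3)) (sndE (.var 3)))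
      (.pair (.pair (sndE (.var 1)) (.num 1)) (.var 0))
      (.var 0))

/-- The records of the one-constraint program on a horizontal line. -/
def horBody : Expr :=
  foldBody fHor .nil
    (.pair (.pair (subE (sndE (.var 1)) (.var 3)) (.pair (fstE (.var 1)) (.num 1))) (.var 0))

/-- Branches on whether the value of the record `h` is determined by the context `X`. -/
def pruneE (X h yes no : Expr) : Expr :=
  .ifLe (.num 0) (mulE (mulE (fstE (sndE X)) (fstE X)) (fstE h))
    (.ifLe (mulE (fstE (sndE X))
        (subE (subE (sndE h) (mulE (fstE (sndE (sndE X))) (fstE h))) (sndE (sndE (sndE X)))))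
      (.num 0) yes no)
    no

/-- The records that are not determined, and the sum of the keys and the number of the other ones. -/
def pruneBody : Expr :=
  foldBody fPrune (.pair .nil (.pair (.num 0) (.num 0)))
    (pruneE (.var 3) (.var 1)
      (.pair (fstE (.var 0)) (.pair (addE (fstE (sndE (.var 0))) (fstE (.var 1)))
        (addE (sndE (sndE (.var 0))) (.num 1))))
      (.pair (.pair (.var 1) (fstE (.var 0))) (sndE (.var 0))))

/-- The common value of the determined variables. -/
def fixedE (X : Expr) : Expr := divE (subE (.num 1) (fstE (sndE X))) (.num 2)

/-- Inserts the values of the determined variables. -/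
def mergeBody : Expr :=
  .casePair (fstE (sndE (.var 0)))
    (pruneE (fstE (.var 2)) (.var 0)
      (.letIn (.call fMerge (.pair (fstE (.var 2)) (.pair (.var 1) (sndE (sndE (.var 2))))))
        (.pair (fixedE (fstE (.var 3))) (.var 0)))
      (.letIn (.call fMerge (.pair (fstE (.var 2)) (.pair (.var 1) (sndE (sndE (sndE (.var 2)))))))
        (.pair (fstE (sndE (sndE (.var 3)))) (.var 0))))
    .nil

/-- `(λ, ((r₂, r₁), list))`: the test of a vertical line. -/
def testVBody : Expr :=
  .letIn (.call fVert (.pair (fstE (.var 0)) (sndE (sndE (.var 0)))))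
    (.call fTest (.pair (fstE (sndE (.var 1))) (.var 0)))

/-- `(ν, ((r₁, r₂), list))`: the test of a horizontal line. -/
def testHBody : Expr :=
  .letIn (.call fHor (.pair (fstE (.var 0)) (sndE (sndE (.var 0)))))
    (.call fTest (.pair (fstE (sndE (.var 1))) (.var 0)))

/-- `(X, ((r₁, r₂), list))`: fixes the variables that are determined by `X` and solves the rest. -/
def finishBody : Expr :=
  .letIn (.call fPrune (.pair (fstE (.var 0)) (sndE (sndE (.var 0)))))
    (.letIn (.call fSolve2 (.pair
        (.pair
          (subE (fstE (fstE (sndE (.var 1)))) (mulE (fixedE (fstE (.var 1))) (fstE (sndE (.var 0)))))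
          (subE (sndE (fstE (sndE (.var 1)))) (mulE (fixedE (fstE (.var 1))) (sndE (sndE (.var 0))))))
        (fstE (.var 0))))
      (.casePair (.var 0)
        (.letIn (.call fMerge (.pair (fstE (.var 4)) (.pair (sndE (sndE (.var 4))) (.var 0))))
          (.pair (.var 0) (.pair .nil .nil)))
        .nil))

/-- `((r₁, r₂), list of (a, p))`: the linear program with the two equality constraints
`∑ a x = r₁` and `∑ x = r₂`.  The result is `nil` or `(x, (nil, nil))`. -/
def solve2Body : Expr :=
  .casePair (sndE (.var 0))
    (.letIn (.call fMedian (sndE (.var 2)))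
      (.letIn (.call fShear (.pair (.var 0) (sndE (.var 3))))
        (.letIn (subE (fstE (fstE (.var 4))) (mulE (.var 1) (sndE (fstE (.var 4)))))
          (.letIn (.call fSplit (.pair .nil (.var 1)))
            (.letIn (.call fCross (.var 0))
              (.letIn (.call fMedian (.var 0))
                (.letIn (.call fTestV (.pair (.var 0)
                    (.pair (.pair (sndE (fstE (.var 8))) (.var 3)) (.var 4))))
                  (.casePair (.var 0)
                    (.casePair (.var 1)
                      (.var 4)
                      (.letIn (subE (.num 0) (.var 0))
                        (.letIn (.call fBeyond (.pair (.pair (.var 0) (.var 4)) (.var 5)))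
                          (.letIn (.call fMedian (.var 0))
                            (.letIn (.call fTestH (.pair (.var 0)
                                (.pair (.pair (.var 9) (sndE (fstE (.var 14)))) (.var 10))))
                              (.casePair (.var 0)
                                (.casePair (.var 1)
                                  (.var 4)
                                  (.call fFinish (.pair
                                    (.pair (.var 5) (.pair (subE (.num 0) (.var 0))
                                      (.pair (.var 9) (.var 3))))
                                    (.pair (.pair (.var 12) (sndE (fstE (.var 17)))) (.var 13)))))
                                .nil))))))
                    .nil))))))))
    (.ifLe (fstE (fstE (.var 0))) (.num 0)
      (.ifLe (.num 0) (fstE (fstE (.var 0)))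
        (.ifLe (sndE (fstE (.var 0))) (.num 0)
          (.ifLe (.num 0) (sndE (fstE (.var 0)))
            (.pair .nil (.pair .nil .nil))
            .nil)
          .nil)
        .nil)
      .nil)

/-- `(p, (w, g))` to `(p, (g, w))`. -/
def swapBody : Expr :=
  foldBody fSwap .nil
    (.pair (.pair (fstE (.var 1)) (.pair (sndE (sndE (.var 1))) (fstE (sndE (.var 1))))) (.var 0))

/-- The value of the variable of the current record. -/
def curE (A : Expr) : Expr :=
  zvalE (fstE A) (sndE A) (fstE (.var 1)) (fstE (sndE (.var 1)))

/-- The value of the third component in the solution of a one-constraint program. -/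
def wsumBody : Expr :=
  foldBody fWsum (.num 0) (addE (.var 0) (mulE (sndE (sndE (.var 1))) (curE (.var 3))))

/-- The solution of a one-constraint program. -/
def zmapBody : Expr := foldBody fZmap .nil (.pair (curE (.var 3)) (.var 0))

/-- Complements the variables with `g = -1` in `(p, (g, w))`; computes the sum of their `w` and their
number. -/
def complBody : Expr :=
  foldBody fCompl (.pair .nil (.pair (.num 0) (.num 0)))
    (.pair
      (.pair (.pair (mulE (fstE (sndE (.var 1))) (sndE (sndE (.var 1))))
        (mulE (fstE (sndE (.var 1))) (fstE (.var 1)))) (fstE (.var 0)))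
      (.ifLe (.num 0) (fstE (sndE (.var 1)))
        (sndE (.var 0))
        (.pair (addE (fstE (sndE (.var 0))) (sndE (sndE (.var 1))))
          (addE (sndE (sndE (.var 0))) (.num 1)))))

/-- Undoes the complementation in a solution. -/
def uncomplBody : Expr :=
  .casePair (fstE (.var 0))
    (.letIn (.call fUncompl (.pair (.var 1) (sndE (sndE (.var 2)))))
      (.pair (addE (divE (subE (.num 1) (fstE (sndE (.var 1)))) (.num 2))
        (mulE (fstE (sndE (.var 1))) (fstE (sndE (.var 3))))) (.var 0)))
    .nil

/-- The reduced linear program. -/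
def reducedBody : Expr :=
  .letIn (.call fSwap (.pair .nil (sndE (.var 0))))
    (.letIn (.call fSolve1 (.pair (.num 1) (.var 0)))
      (.casePair (.var 0)
        (.letIn (.call fWsum (.pair (.var 2) (.var 3)))
          (.ifLe (.var 0) (fstE (.var 5))
            (.call fZmap (.pair (.var 3) (.var 4)))
            (.letIn (.call fCompl (.pair .nil (.var 4)))
              (.letIn (.call fSolve2 (.pair
                  (.pair (subE (fstE (.var 6)) (fstE (sndE (.var 0))))
                    (addE (.num 1) (sndE (sndE (.var 0)))))
                  (fstE (.var 0))))
                (.casePair (.var 0)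
                  (.call fUncompl (.pair (.var 8) (.var 0)))
                  .nil)))))
        .nil))

/-- `(p, (w, κ))` to `(p, (w, w))`. -/
def dupBody : Expr :=
  foldBody fDup .nil
    (.pair (.pair (fstE (.var 1)) (.pair (fstE (sndE (.var 1))) (fstE (sndE (.var 1))))) (.var 0))

/-- The linear relaxation of the knapsack problem without colors. -/
def paramsBody : Expr :=
  .letIn (.call fWsum (.pair (.pair (.num 0) (.num 0)) (sndE (.var 0))))
    (.ifLe (.var 0) (fstE (.var 1))
      (.pair (.num 0) (.num 0))
      (.call fSolve1 (.var 1)))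

/-- Weighted majority vote. -/
def voteBody : Expr :=
  foldBody fVote (.pair (.num 0) (.num 0))
    (.ifLe (sndE (sndE (.var 1))) (fstE (.var 0))
      (.ifLe (fstE (.var 0)) (sndE (sndE (.var 1)))
        (.pair (fstE (.var 0)) (addE (sndE (.var 0)) (curE (.var 3))))
        (.ifLe (curE (.var 3)) (sndE (.var 0))
          (.pair (fstE (.var 0)) (subE (sndE (.var 0)) (curE (.var 3))))
          (.pair (sndE (sndE (.var 1))) (subE (curE (.var 3)) (sndE (.var 0))))))
      (.ifLe (curE (.var 3)) (sndE (.var 0))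
        (.pair (fstE (.var 0)) (subE (sndE (.var 0)) (curE (.var 3))))
        (.pair (sndE (sndE (.var 1))) (subE (curE (.var 3)) (sndE (.var 0))))))

/-- The coefficient of the record `h` in the balance constraint of the color `c`. -/
def signE (c h : Expr) : Expr :=
  .ifLe (sndE (sndE h)) c (.ifLe c (sndE (sndE h)) (.num 1) (.num (-1))) (.num (-1))

/-- The value of the balance constraint of a color. -/
def excessBody : Expr :=
  foldBody fExcess (.num 0)
    (addE (.var 0) (mulE (signE (fstE (.var 3)) (.var 1)) (curE (sndE (.var 3)))))

/-- `(p, (w, κ))` to `(p, (w, g))`. -/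
def recolorBody : Expr :=
  foldBody fRecolor .nil
    (.pair (.pair (fstE (.var 1)) (.pair (fstE (sndE (.var 1))) (signE (.var 3) (.var 1)))) (.var 0))

/-- The linear relaxation of the colored knapsack problem. -/
def relaxationBody : Expr :=
  .letIn (.call fDup (.pair .nil (sndE (.var 0))))
    (.letIn (.call fParams (.pair (fstE (.var 1)) (.var 0)))
      (.letIn (.call fVote (.pair (.var 0) (sndE (.var 2))))
        (.letIn (.call fExcess (.pair (.pair (fstE (.var 0)) (.var 1)) (sndE (.var 3))))
          (.ifLe (.var 0) (.num 1)
            (.call fZmap (.pair (.var 2) (.var 3)))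
            (.letIn (.call fRecolor (.pair (fstE (.var 1)) (sndE (.var 4))))
              (.call fReduced (.pair (fstE (.var 5)) (.var 0))))))))

/-- The program with the main function `e`. -/
def prog (e : Expr) : Program :=
  [e, partBody, lenBody, qselBody, medBody, wselBody, normBody, solve1Body, tieBody, lexBody,
    negBody, sumsBody, combBody, testBody, unitBody, medianBody, shearBody, splitBody, crossBody,
    vertBody, beyondBody, horBody, pruneBody, mergeBody, solve2Body, testVBody, testHBody,
    finishBody, reducedBody, swapBody, wsumBody, zmapBody, complBody, uncomplBody, dupBody,
    paramsBody, voteBody, excessBody, recolorBody]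

/-! ## The folds of the program -/

section
variable {α : Type}

/-- The total weight of the keys above `τ`. -/
def gtSum (k c : α → ℚ) (τ : ℚ) (l : List α) : ℚ := ((l.filter fun i => τ < k i).map c).sum
/-- The total weight of the keys `≥ τ`. -/
def geSum (k c : α → ℚ) (τ : ℚ) (l : List α) : ℚ := ((l.filter fun i => τ ≤ k i).map c).sum

/-- The value of the variable with profit `q` and coefficient `c` in an optimal solution of the
linear program with one equality constraint. -/
def zval (τ θ q c : ℚ) : ℚ :=
  if q - τ * c ≤ 0 then
    if 0 ≤ q - τ * c then (if c ≤ 0 then (if 0 ≤ c then 0 else 1 - θ) else θ) else 0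
  else 1

/-- The value of the variable with profit `q`, coefficient `c` and secondary profit `f`. -/
def lexval (A : ℚ × ℚ × ℚ) (q c f : ℚ) : ℚ :=
  if q - A.1 * c ≤ 0 then (if 0 ≤ q - A.1 * c then zval A.2.1 A.2.2 f c else 0) else 1

/-- The parameters of a solution with a secondary objective. -/
def encA (A : ℚ × ℚ × ℚ) : Val := .pair (.num A.1) (.pair (.num A.2.1) (.num A.2.2))

theorem den_zvalE {env : List Val} {a b c d : Expr} {τ θ q r : ℚ}
    (ha : den env a = some (.num τ)) (hb : den env b = some (.num θ))
    (hc : den env c = some (.num q)) (hd : den env d = some (.num r)) :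
    den env (zvalE a b c d) = some (.num (zval τ θ q r)) := by
  simp only [zvalE, den, subE, mulE, ha, hb, hc, hd, ArithOp.apply, Option.map_some, zval]
  split_ifs <;> rfl

theorem den_lexvalE {env : List Val} {a b c d : Expr} {A : ℚ × ℚ × ℚ} {q r f : ℚ}
    (ha : den env a = some (encA A)) (hb : den env b = some (.num q))
    (hc : den env c = some (.num r)) (hd : den env d = some (.num f)) :
    den env (lexvalE a b c d) = some (.num (lexval A q r f)) := by
  have h1 := den_fst ha
  have h2 := den_fst (den_snd ha)
  have h3 := den_snd (den_snd ha)
  have h4 := den_zvalE h2 h3 hd hc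
  simp only [lexvalE, den, subE, mulE, h1, hb, hc, h4, ArithOp.apply, Option.map_some, lexval]
  split_ifs <;> rfl

/-- Whether the item with coefficient `a` and profit `p` is determined on the quadrant with corner
`(lam, ν)` and signs `σ`, `ρ`. -/
def Pruned (σ ρ lam ν a p : ℚ) : Prop := 0 ≤ ρ * σ * a ∧ ρ * (p - lam * a - ν) ≤ 0

instance (σ ρ lam ν a p : ℚ) : Decidable (Pruned σ ρ lam ν a p) := by
  unfold Pruned; infer_instance

/-- The description of a quadrant. -/
def encX (σ ρ lam ν : ℚ) : Val :=
  .pair (.num σ) (.pair (.num ρ) (.pair (.num lam) (.num ν)))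

theorem den_pruneE {env : List Val} {X h y n : Expr} {σ ρ lam ν a p : ℚ}
    (hX : den env X = some (encX σ ρ lam ν)) (hh : den env h = some (.pair (.num a) (.num p))) :
    den env (pruneE X h y n) = if Pruned σ ρ lam ν a p then den env y else den env n := by
  have h1 := den_fst hX
  have h2 := den_fst (den_snd hX)
  have h3 := den_fst (den_snd (den_snd hX))
  have h4 := den_snd (den_snd (den_snd hX))
  have h5 := den_fst hh
  have h6 := den_snd hh
  simp only [pruneE, den, subE, mulE, h1, h2, h3, h4, h5, h6, ArithOp.apply, Option.map_some,
    Pruned]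
  by_cases h : 0 ≤ ρ * σ * a <;> by_cases h' : ρ * (p - lam * a - ν) ≤ 0 <;> simp [h, h']

/-- The sign of a color relative to another one. -/
def sgn (c k : ℚ) : ℚ := if k = c then 1 else -1

theorem den_signE {env : List Val} {a h : Expr} {c p w k : ℚ}
    (ha : den env a = some (.num c))
    (hh : den env h = some (.pair (.num p) (.pair (.num w) (.num k)))) :
    den env (signE a h) = some (.num (sgn c k)) := by
  have h1 := den_snd (den_snd hh)
  simp only [signE, den, ha, h1, sgn]
  split_ifs <;> first | rfl | (exfalso; grind)

variable (e : Expr)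

/-- Here and below `K` precedes the item type and the data, so a single constant also serves
recursive calls on other item types. The main function `e` stays arbitrary because no function calls
number `0`; both programs share these lemmas. -/
theorem part_comp : ∃ K, ∀ {α : Type} (k c : α → ℚ) (τ : ℚ) (l : List α),
    Comp (prog e) fPart (.pair (.num τ) (Val.ofList (l.map (enc2 k c))))
      (.pair (.pair (.num (gtSum k c τ l)) (.num (geSum k c τ l)))
        (.pair (Val.ofList ((l.filter fun i => τ < k i).map (enc2 k c)))
          (Val.ofList ((l.filter fun i => k i < τ).map (enc2 k c))))) (K * (l.length + 1)) := by
  refine ⟨_, fun k c τ l => fold_comp (k := fPart) rfl (enc2 k c) (.num τ)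
    (fun l => .pair (.pair (.num (gtSum k c τ l)) (.num (geSum k c τ l)))
        (.pair (Val.ofList ((l.filter fun i => τ < k i).map (enc2 k c)))
          (Val.ofList ((l.filter fun i => k i < τ).map (enc2 k c))))) ?_ ?_ l⟩
  · intro arg; rfl
  · intro x l tl full arg
    simp only [den, fstE, sndE, addE, enc2, gtSum, geSum, List.getElem?_cons_succ,
      List.getElem?_cons_zero, ArithOp.apply, Option.map_some, List.filter_cons]
    rcases lt_trichotomy (k x) τ with h | h | h
    · simp [h, h.le, h.not_ge, h.not_gt, Val.ofList, enc2]
    · simp [h, add_comm]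
    · simp [h, h.le, h.not_ge, h.not_gt, Val.ofList, add_comm, enc2]

theorem len_comp : ∃ K, ∀ {α : Type} (enc : α → Val) (l : List α),
    Comp (prog e) fLen (.pair .nil (Val.ofList (l.map enc))) (.num l.length)
      (K * (l.length + 1)) := by
  refine ⟨_, fun enc l => fold_comp (k := fLen) rfl enc .nil (fun l => .num l.length) ?_ ?_ l⟩
  · intro arg; simp [den]
  · intro x l tl full arg; simp [den, addE, ArithOp.apply]

/-- The records that `normBody` makes. -/
def normKeys (q c : α → ℚ) (l : List α) : List (ℚ × ℚ) :=
  (l.filter fun i => c i ≠ 0).map fun i => (q i / c i, |c i|)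

theorem norm_comp : ∃ K, ∀ {α : Type} (q c f : α → ℚ) (l : List α),
    Comp (prog e) fNorm (.pair .nil (Val.ofList (l.map (enc3 q c f))))
      (.pair (Val.ofList ((normKeys q c l).map (enc2 Prod.fst Prod.snd)))
        (.pair (.num ((l.map fun i => |c i|).sum)) (.num ((l.map fun i => max (-c i) 0).sum))))
      (K * (l.length + 1)) := by
  refine ⟨_, fun q c f l => fold_comp (k := fNorm) rfl (enc3 q c f) .nil
    (fun l => .pair (Val.ofList ((normKeys q c l).map (enc2 Prod.fst Prod.snd)))
        (.pair (.num ((l.map fun i => |c i|).sum)) (.num ((l.map fun i => max (-c i) 0).sum))))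
    ?_ ?_ l⟩
  · intro arg; rfl
  · intro x l tl full arg
    simp only [den, fstE, sndE, addE, subE, divE, enc3, normKeys, List.getElem?_cons_succ,
      List.getElem?_cons_zero, ArithOp.apply, Option.map_some, List.filter_cons]
    rcases lt_trichotomy (c x) 0 with h | h | h
    · simp only [h.le, h.not_ge, h.ne, if_true, if_false, Option.map_some, ne_eq, not_false_eq_true,
        decide_true, List.map_cons, Val.ofList, List.sum_cons, abs_of_neg h, enc2,
        max_eq_left (neg_pos.2 h).le]
      congr 4 <;> ring_nf
    · simp [h]
    · simp [h.not_ge, h.ne', Val.ofList, enc2, abs_of_pos h, h.le, add_comm]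

theorem tie_comp : ∃ K, ∀ {α : Type} (q c f : α → ℚ) (τ : ℚ) (l : List α),
    Comp (prog e) fTie (.pair (.num τ) (Val.ofList (l.map (enc3 q c f))))
      (.pair (Val.ofList ((l.filter fun i => q i - τ * c i = 0).map (enc3 f c f)))
        (.num (((l.filter fun i => 0 < q i - τ * c i).map c).sum))) (K * (l.length + 1)) := by
  refine ⟨_, fun q c f τ l => fold_comp (k := fTie) rfl (enc3 q c f) (.num τ)
    (fun l => .pair (Val.ofList ((l.filter fun i => q i - τ * c i = 0).map (enc3 f c f)))
        (.num (((l.filter fun i => 0 < q i - τ * c i).map c).sum))) ?_ ?_ l⟩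
  · intro arg; rfl
  · intro x l tl full arg
    simp only [den, fstE, sndE, addE, subE, mulE, enc3, List.getElem?_cons_succ,
      List.getElem?_cons_zero, ArithOp.apply, Option.map_some, List.filter_cons]
    generalize q x - τ * c x = d
    rcases lt_trichotomy d 0 with h | h | h
    · simp [h.le, h.not_ge, h.not_gt, h.ne]
    · simp [h, Val.ofList, enc3]
    · simp [h.not_ge, h, h.ne', add_comm]

/-- Evaluation of a fold that maps. -/
theorem map_comp {P : Program} {k : ℕ} {step : Expr}
    (hk : P[k]? = some (foldBody k .nil (.pair step (.var 0)))) {α : Type} (enc enc' : α → Val)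
    (ctx : Val) (hs : ∀ x r tl full arg, den [r, enc x, tl, ctx, full, arg] step = some (enc' x))
    (l : List α) :
    Comp P k (.pair ctx (Val.ofList (l.map enc))) (Val.ofList (l.map enc'))
      ((size step + 15) * (l.length + 1)) := by
  refine (fold_comp hk enc ctx (fun l => Val.ofList (l.map enc')) ?_ ?_ l).mono ?_
  · intro arg; rfl
  · intro x l tl full arg
    simp [den, hs, Val.ofList]
  · simp only [size]
    exact Nat.mul_le_mul_right _ (by omega)

theorem neg_comp : ∃ K, ∀ {α : Type} (q c f : α → ℚ) (l : List α),
    Comp (prog e) fNeg (.pair .nil (Val.ofList (l.map (enc3 q c f))))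
      (Val.ofList (l.map (enc3 q c fun i => -f i))) (K * (l.length + 1)) := by
  refine ⟨_, fun q c f l => map_comp (k := fNeg) rfl (enc3 q c f) _ .nil ?_ l⟩
  intro x r tl full arg
  simp [den, fstE, sndE, subE, enc3, ArithOp.apply]

theorem den_upvalE {env : List Val} {X : Expr} {A : ℚ × ℚ × ℚ} {q c f : α → ℚ} {x : α} {r : Val}
    (h : den (r :: enc3 q c f x :: env) X = some (encA A)) :
    den (r :: enc3 q c f x :: env) (upvalE X) = some (.num (lexval A (q x) (c x) (f x))) :=
  den_lexvalE h rfl rfl rfl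

theorem den_dnvalE {env : List Val} {X : Expr} {A : ℚ × ℚ × ℚ} {q c f : α → ℚ} {x : α} {r : Val}
    (h : den (r :: enc3 q c f x :: env) X = some (encA A)) :
    den (r :: enc3 q c f x :: env) (dnvalE X) = some (.num (lexval A (q x) (c x) (-f x))) :=
  den_lexvalE h rfl rfl (by simp [den, sndE, subE, enc3, ArithOp.apply])

theorem sums_comp : ∃ K, ∀ {α : Type} (q c f : α → ℚ) (A B : ℚ × ℚ × ℚ) (l : List α),
    Comp (prog e) fSums (.pair (.pair (encA A) (encA B)) (Val.ofList (l.map (enc3 q c f))))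
      (.pair (.num ((l.map fun i => f i * lexval A (q i) (c i) (f i)).sum))
        (.num ((l.map fun i => f i * lexval B (q i) (c i) (-f i)).sum))) (K * (l.length + 1)) := by
  refine ⟨_, fun q c f A B l => fold_comp (k := fSums) rfl (enc3 q c f) (.pair (encA A) (encA B))
    (fun l => .pair (.num ((l.map fun i => f i * lexval A (q i) (c i) (f i)).sum))
        (.num ((l.map fun i => f i * lexval B (q i) (c i) (-f i)).sum))) ?_ ?_ l⟩
  · intro arg; rfl
  · intro x l tl full arg
    simp only [den, fstE, sndE, addE, mulE, List.getElem?_cons_succ,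
      List.getElem?_cons_zero]
    rw [den_upvalE (A := A) rfl, den_dnvalE (A := B) rfl]
    simp [enc3, ArithOp.apply, add_comm]

theorem comb_comp : ∃ K, ∀ {α : Type} (q c f : α → ℚ) (t : ℚ) (A B : ℚ × ℚ × ℚ) (l : List α),
    Comp (prog e) fComb (.pair (.pair (.num t) (.pair (encA A) (encA B)))
        (Val.ofList (l.map (enc3 q c f))))
      (encL (fun i => t * lexval A (q i) (c i) (f i) + (1 - t) * lexval B (q i) (c i) (-f i)) l)
      (K * (l.length + 1)) := by
  refine ⟨_, fun q c f t A B l => map_comp (k := fComb) rfl (enc3 q c f) _ _ ?_ l⟩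
  intro x r tl full arg
  simp only [den, fstE, sndE, addE, mulE, subE, List.getElem?_cons_succ, List.getElem?_cons_zero]
  rw [den_upvalE (A := A) rfl, den_dnvalE (A := B) rfl]
  simp [ArithOp.apply]

theorem unit_comp : ∃ K, ∀ {α : Type} (k c : α → ℚ) (l : List α),
    Comp (prog e) fUnit (.pair .nil (Val.ofList (l.map (enc2 k c))))
      (Val.ofList (l.map (enc2 k fun _ => 1))) (K * (l.length + 1)) :=
  ⟨_, fun k c l => map_comp (k := fUnit) rfl (enc2 k c) _ .nil (fun _ _ _ _ _ => rfl) l⟩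

theorem shear_comp : ∃ K, ∀ {α : Type} (a p : α → ℚ) (s : ℚ) (l : List α),
    Comp (prog e) fShear (.pair (.num s) (Val.ofList (l.map (enc2 a p))))
      (Val.ofList (l.map (enc2 (fun i => a i - s) p))) (K * (l.length + 1)) :=
  ⟨_, fun a p _ l => map_comp (k := fShear) rfl (enc2 a p) _ _ (fun _ _ _ _ _ => rfl) l⟩

theorem vert_comp : ∃ K, ∀ {α : Type} (a p : α → ℚ) (lam : ℚ) (l : List α),
    Comp (prog e) fVert (.pair (.num lam) (Val.ofList (l.map (enc2 a p))))
      (Val.ofList (l.map (enc3 (fun i => p i - lam * a i) (fun _ => 1) a))) (K * (l.length + 1)) :=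
  ⟨_, fun a p _ l => map_comp (k := fVert) rfl (enc2 a p) _ _ (fun _ _ _ _ _ => rfl) l⟩

theorem hor_comp : ∃ K, ∀ {α : Type} (a p : α → ℚ) (ν : ℚ) (l : List α),
    Comp (prog e) fHor (.pair (.num ν) (Val.ofList (l.map (enc2 a p))))
      (Val.ofList (l.map (enc3 (fun i => p i - ν) a (fun _ => 1)))) (K * (l.length + 1)) :=
  ⟨_, fun a p _ l => map_comp (k := fHor) rfl (enc2 a p) _ _ (fun _ _ _ _ _ => rfl) l⟩

/-- Records with key zero enter both lists. After the shear by a median key, each list therefore has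
at least half of the items. -/
theorem split_comp : ∃ K, ∀ {α : Type} (a p : α → ℚ) (l : List α),
    Comp (prog e) fSplit (.pair .nil (Val.ofList (l.map (enc2 a p))))
      (.pair (Val.ofList ((l.filter fun i => a i ≤ 0).map (enc2 a p)))
        (Val.ofList ((l.filter fun i => 0 ≤ a i).map (enc2 a p)))) (K * (l.length + 1)) := by
  refine ⟨_, fun a p l => fold_comp (k := fSplit) rfl (enc2 a p) .nil
    (fun l => .pair (Val.ofList ((l.filter fun i => a i ≤ 0).map (enc2 a p)))
        (Val.ofList ((l.filter fun i => 0 ≤ a i).map (enc2 a p)))) ?_ ?_ l⟩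
  · intro arg; rfl
  · intro x l tl full arg
    simp only [den, fstE, sndE, enc2, List.getElem?_cons_succ, List.getElem?_cons_zero,
      List.filter_cons]
    by_cases h : a x ≤ 0 <;> by_cases h' : 0 ≤ a x <;> simp [h, h', Val.ofList, enc2]

theorem beyond_comp : ∃ K, ∀ {α : Type} (k v : α → ℚ) (σ lam : ℚ) (l : List α),
    Comp (prog e) fBeyond (.pair (.pair (.num σ) (.num lam)) (Val.ofList (l.map (enc2 k v))))
      (Val.ofList ((l.filter fun i => σ * k i ≤ σ * lam).map (enc2 v fun _ => 1)))
      (K * (l.length + 1)) := by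
  refine ⟨_, fun k v σ lam l => fold_comp (k := fBeyond) rfl (enc2 k v) _
    (fun l => Val.ofList ((l.filter fun i => σ * k i ≤ σ * lam).map (enc2 v fun _ => 1))) ?_ ?_ l⟩
  · intro arg; rfl
  · intro x l tl full arg
    simp only [den, fstE, sndE, mulE, enc2, List.getElem?_cons_succ, List.getElem?_cons_zero,
      List.filter_cons, ArithOp.apply, Option.map_some]
    by_cases h : σ * k x ≤ σ * lam <;> simp [h, Val.ofList, enc2]

theorem prune_comp : ∃ K, ∀ {α : Type} (a p : α → ℚ) (σ ρ lam ν : ℚ) (l : List α),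
    Comp (prog e) fPrune (.pair (encX σ ρ lam ν) (Val.ofList (l.map (enc2 a p))))
      (.pair (Val.ofList ((l.filter fun i => ¬ Pruned σ ρ lam ν (a i) (p i)).map (enc2 a p)))
        (.pair (.num (((l.filter fun i => Pruned σ ρ lam ν (a i) (p i)).map a).sum))
          (.num (((l.filter fun i => Pruned σ ρ lam ν (a i) (p i)).map fun _ => (1 : ℚ)).sum))))
      (K * (l.length + 1)) := by
  refine ⟨_, fun a p σ ρ lam ν l => fold_comp (k := fPrune) rfl (enc2 a p) _
    (fun l => .pair (Val.ofList ((l.filter fun i => ¬ Pruned σ ρ lam ν (a i) (p i)).map (enc2 a p)))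
        (.pair (.num (((l.filter fun i => Pruned σ ρ lam ν (a i) (p i)).map a).sum))
          (.num (((l.filter fun i => Pruned σ ρ lam ν (a i) (p i)).map fun _ => (1 : ℚ)).sum))))
    ?_ ?_ l⟩
  · intro arg; rfl
  · intro x l tl full arg
    rw [den_pruneE (σ := σ) (ρ := ρ) (lam := lam) (ν := ν) (a := a x) (p := p x) rfl rfl]
    by_cases h : Pruned σ ρ lam ν (a x) (p x) <;>
      simp [h, den, fstE, sndE, addE, ArithOp.apply, Val.ofList, enc2, add_comm]

theorem swap_comp : ∃ K, ∀ {α : Type} (p w g : α → ℚ) (l : List α),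
    Comp (prog e) fSwap (.pair .nil (Val.ofList (l.map (enc3 p w g))))
      (Val.ofList (l.map (enc3 p g w))) (K * (l.length + 1)) :=
  ⟨_, fun p w g l => map_comp (k := fSwap) rfl (enc3 p w g) _ .nil (fun _ _ _ _ _ => rfl) l⟩

theorem dup_comp : ∃ K, ∀ {α : Type} (p w g : α → ℚ) (l : List α),
    Comp (prog e) fDup (.pair .nil (Val.ofList (l.map (enc3 p w g))))
      (Val.ofList (l.map (enc3 p w w))) (K * (l.length + 1)) :=
  ⟨_, fun p w g l => map_comp (k := fDup) rfl (enc3 p w g) _ .nil (fun _ _ _ _ _ => rfl) l⟩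

theorem den_curE {env : List Val} {X : Expr} {τ θ : ℚ} {q c f : α → ℚ} {x : α} {r : Val}
    (h : den (r :: enc3 q c f x :: env) X = some (.pair (.num τ) (.num θ))) :
    den (r :: enc3 q c f x :: env) (curE X) = some (.num (zval τ θ (q x) (c x))) :=
  den_zvalE (den_fst h) (den_snd h) rfl rfl

theorem wsum_comp : ∃ K, ∀ {α : Type} (q c f : α → ℚ) (τ θ : ℚ) (l : List α),
    Comp (prog e) fWsum (.pair (.pair (.num τ) (.num θ)) (Val.ofList (l.map (enc3 q c f))))
      (.num ((l.map fun i => f i * zval τ θ (q i) (c i)).sum)) (K * (l.length + 1)) := by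
  refine ⟨_, fun q c f τ θ l => fold_comp (k := fWsum) rfl (enc3 q c f) (.pair (.num τ) (.num θ))
    (fun l => .num ((l.map fun i => f i * zval τ θ (q i) (c i)).sum)) ?_ ?_ l⟩
  · intro arg; rfl
  · intro x l tl full arg
    simp only [den, sndE, addE, mulE, List.getElem?_cons_succ, List.getElem?_cons_zero]
    rw [den_curE (τ := τ) (θ := θ) rfl]
    simp [enc3, ArithOp.apply, add_comm]

theorem zmap_comp : ∃ K, ∀ {α : Type} (q c f : α → ℚ) (τ θ : ℚ) (l : List α),
    Comp (prog e) fZmap (.pair (.pair (.num τ) (.num θ)) (Val.ofList (l.map (enc3 q c f))))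
      (encL (fun i => zval τ θ (q i) (c i)) l) (K * (l.length + 1)) :=
  ⟨_, fun q c f τ θ l => map_comp (k := fZmap) rfl (enc3 q c f) _ _
    (fun _ _ _ _ _ => den_curE (τ := τ) (θ := θ) rfl) l⟩

theorem compl_comp : ∃ K, ∀ {α : Type} (p g w : α → ℚ) (l : List α),
    Comp (prog e) fCompl (.pair .nil (Val.ofList (l.map (enc3 p g w))))
      (.pair (Val.ofList (l.map (enc2 (fun i => g i * w i) (fun i => g i * p i))))
        (.pair (.num (((l.filter fun i => g i < 0).map w).sum))
          (.num (((l.filter fun i => g i < 0).map fun _ => (1 : ℚ)).sum)))) (K * (l.length + 1)) := by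
  refine ⟨_, fun p g w l => fold_comp (k := fCompl) rfl (enc3 p g w) .nil
    (fun l => (.pair (Val.ofList (l.map (enc2 (fun i => g i * w i) (fun i => g i * p i))))
        (.pair (.num (((l.filter fun i => g i < 0).map w).sum))
          (.num (((l.filter fun i => g i < 0).map fun _ => (1 : ℚ)).sum))))) ?_ ?_ l⟩
  · intro arg; rfl
  · intro x l tl full arg
    simp only [den, fstE, sndE, addE, mulE, enc3, List.getElem?_cons_succ, List.getElem?_cons_zero,
      List.filter_cons, ArithOp.apply, Option.map_some]
    by_cases h : 0 ≤ g x
    · simp [h, h.not_gt, Val.ofList, enc2]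
    · simp [h, not_le.1 h, Val.ofList, enc2, add_comm]

/-- The state of the weighted majority vote among the colors `k` with weights `x`. -/
def vote (k x : α → ℚ) : List α → ℚ × ℚ
  | [] => (0, 0)
  | i :: l =>
    if k i = (vote k x l).1 then ((vote k x l).1, (vote k x l).2 + x i)
    else if x i ≤ (vote k x l).2 then ((vote k x l).1, (vote k x l).2 - x i)
    else (k i, x i - (vote k x l).2)

theorem vote_comp : ∃ K, ∀ {α : Type} (q c k : α → ℚ) (τ θ : ℚ) (l : List α),
    Comp (prog e) fVote (.pair (.pair (.num τ) (.num θ)) (Val.ofList (l.map (enc3 q c k))))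
      (.pair (.num (vote k (fun i => zval τ θ (q i) (c i)) l).1)
        (.num (vote k (fun i => zval τ θ (q i) (c i)) l).2)) (K * (l.length + 1)) := by
  refine ⟨_, fun q c k τ θ l => fold_comp (k := fVote) rfl (enc3 q c k) (.pair (.num τ) (.num θ))
    (fun l => .pair (.num (vote k (fun i => zval τ θ (q i) (c i)) l).1)
        (.num (vote k (fun i => zval τ θ (q i) (c i)) l).2)) ?_ ?_ l⟩
  · intro arg; rfl
  · intro x l tl full arg
    simp only [den, fstE, sndE, addE, subE, List.getElem?_cons_succ, List.getElem?_cons_zero]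
    rw [den_curE (τ := τ) (θ := θ) rfl]
    simp only [enc3, ArithOp.apply, Option.map_some, vote]
    split_ifs <;> first | rfl | (exfalso; grind)

theorem excess_comp : ∃ K, ∀ {α : Type} (q c k : α → ℚ) (u τ θ : ℚ) (l : List α),
    Comp (prog e) fExcess (.pair (.pair (.num u) (.pair (.num τ) (.num θ)))
        (Val.ofList (l.map (enc3 q c k))))
      (.num ((l.map fun i => sgn u (k i) * zval τ θ (q i) (c i)).sum)) (K * (l.length + 1)) := by
  refine ⟨_, fun q c k u τ θ l => fold_comp (k := fExcess) rfl (enc3 q c k)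
    (.pair (.num u) (.pair (.num τ) (.num θ)))
    (fun l => .num ((l.map fun i => sgn u (k i) * zval τ θ (q i) (c i)).sum)) ?_ ?_ l⟩
  · intro arg; rfl
  · intro x l tl full arg
    simp only [den, addE, mulE, List.getElem?_cons_zero]
    rw [den_curE (τ := τ) (θ := θ) rfl, den_signE (c := u) (k := k x) (p := q x) (w := c x) rfl rfl]
    simp [ArithOp.apply, add_comm]

theorem recolor_comp : ∃ K, ∀ {α : Type} (p w k : α → ℚ) (u : ℚ) (l : List α),
    Comp (prog e) fRecolor (.pair (.num u) (Val.ofList (l.map (enc3 p w k))))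
      (Val.ofList (l.map (enc3 p w fun i => sgn u (k i)))) (K * (l.length + 1)) := by
  refine ⟨_, fun p w k u l => map_comp (k := fRecolor) rfl (enc3 p w k) _ _ ?_ l⟩
  intro x r tl full arg
  simp only [den, fstE, sndE]
  rw [den_signE (c := u) (k := k x) (p := p x) (w := w x) rfl rfl]
  simp [enc3]

end

/-! ## Weighted selection -/

theorem Runs.letIn {P : Program} {env : List Val} {a c : Expr} {x v : Val} {S T : ℕ}
    (ha : Runs P env a x S) (hc : Runs P (x :: env) c v T) :
    Runs P env (.letIn a c) v (S + T + 1) := by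
  obtain ⟨s, hs, ha⟩ := ha
  obtain ⟨t, ht, hc⟩ := hc
  exact ⟨_, by omega, .letIn ha hc⟩

section
variable {α : Type}

theorem sum_filter_split (c : α → ℚ) (p q : α → Prop) [DecidablePred p] [DecidablePred q]
    (l : List α) (h : ∀ i ∈ l, q i → p i) :
    ((l.filter fun i => p i).map c).sum =
      ((l.filter fun i => q i).map c).sum +
        (((l.filter fun i => ¬ q i).filter fun i => p i).map c).sum := by
  induction l with
  | nil => simp
  | cons x l ih =>
    have ih := ih fun i hi => h i (List.mem_cons_of_mem _ hi)
    have hx := h x List.mem_cons_self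
    simp only [List.filter_cons]
    by_cases hp : p x <;> by_cases hq : q x <;> simp_all <;> ring

/-- `τ` is a key, the keys above `τ` weigh at most `r`, and the keys `≥ τ` weigh at least `r`. -/
def IsSel (k c : α → ℚ) (l : List α) (r τ : ℚ) : Prop :=
  (∃ i ∈ l, k i = τ) ∧ gtSum k c τ l ≤ r ∧ r ≤ geSum k c τ l

/-- Discarding keys `≤ τ` does not affect the weights above a threshold larger than `τ`. -/
theorem IsSel.of_up {k c : α → ℚ} {l : List α} {r τ τ' : ℚ}
    (h : IsSel k c (l.filter fun i => τ < k i) r τ') : IsSel k c l r τ' := by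
  obtain ⟨⟨i, hi, rfl⟩, h1, h2⟩ := h
  have hi' := List.mem_filter.1 hi
  have hlt : τ < k i := by simpa using hi'.2
  refine ⟨⟨i, hi'.1, rfl⟩, ?_, ?_⟩
  · convert h1 using 1
    simp only [gtSum, List.filter_filter]
    congr 2
    refine List.filter_congr fun j _ => ?_
    have : k i < k j → τ < k j := fun h => hlt.trans h
    by_cases hj : k i < k j <;> simp_all
  · convert h2 using 1
    simp only [geSum, List.filter_filter]
    congr 2
    refine List.filter_congr fun j _ => ?_
    have : k i ≤ k j → τ < k j := fun h => hlt.trans_le h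
    by_cases hj : k i ≤ k j <;> simp_all

/-- All discarded keys lie above any threshold smaller than `τ`; their weight has been taken off the
target. -/
theorem IsSel.of_lo {k c : α → ℚ} {l : List α} {r τ τ' : ℚ}
    (h : IsSel k c (l.filter fun i => k i < τ) (r - geSum k c τ l) τ') : IsSel k c l r τ' := by
  obtain ⟨⟨i, hi, rfl⟩, h1, h2⟩ := h
  have hi' := List.mem_filter.1 hi
  have hlt : k i < τ := by simpa using hi'.2
  have e1 := sum_filter_split c (fun j => k i < k j) (fun j => τ ≤ k j) l
    (fun j _ h => hlt.trans_le h)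
  have e2 := sum_filter_split c (fun j => k i ≤ k j) (fun j => τ ≤ k j) l
    (fun j _ h => (hlt.trans_le h).le)
  simp only [not_le] at e1 e2
  simp only [gtSum, geSum] at h1 h2
  refine ⟨⟨i, hi'.1, rfl⟩, ?_, ?_⟩
  · simp only [gtSum]; linarith
  · simp only [geSum]; linarith

variable (e : Expr)

/-- Either the pivot is the answer, or the target falls among the keys strictly above or strictly
below it. The recursive call is assumed only for these two sublists, so the same lemma serves the
quadratic and the linear selection. -/
theorem Runs.selTail {self d : ℕ} {pivot : Expr} {env : List Val} {k c : α → ℚ} {l : List α}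
    {r τ : ℚ} {Tp Kp Ts : ℕ}
    (hpart : Comp (prog e) fPart (.pair (.num τ) (Val.ofList (l.map (enc2 k c))))
      (.pair (.pair (.num (gtSum k c τ l)) (.num (geSum k c τ l)))
        (.pair (Val.ofList ((l.filter fun i => τ < k i).map (enc2 k c)))
          (Val.ofList ((l.filter fun i => k i < τ).map (enc2 k c))))) Kp)
    (henv : env[d]? = some (.pair (.num r) (Val.ofList (l.map (enc2 k c)))))
    (hp : Runs (prog e) env pivot (.num τ) Tp) (hτ : ∃ i ∈ l, k i = τ)
    (h0 : 0 ≤ r) (h1 : r ≤ (l.map c).sum)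
    (ih : ∀ l' r', (l' = (l.filter fun i => τ < k i) ∨ l' = (l.filter fun i => k i < τ)) → l' ≠ [] →
      0 ≤ r' → r' ≤ (l'.map c).sum → ∃ τ', Comp (prog e) self
        (.pair (.num r') (Val.ofList (l'.map (enc2 k c)))) (.num τ') Ts ∧ IsSel k c l' r' τ') :
    ∃ τ', Runs (prog e) env (selTail self pivot d) (.num τ') (Tp + Kp + Ts + 100) ∧
      IsSel k c l r τ' := by
  have hd : ∀ (x : Val) (env : List Val) (j : ℕ), den (x :: env) (.var (j + 1)) = den env (.var j) :=
    fun _ _ _ => rfl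
  have hdd : den env (.var d) = some (.pair (.num r) (Val.ofList (l.map (enc2 k c)))) := henv
  have harg : den (.num τ :: env) (.pair (.var 0) (sndE (.var (d + 1)))) =
      some (.pair (.num τ) (Val.ofList (l.map (enc2 k c)))) := by
    have := den_snd (a := .var (d + 1)) ((hd (.num τ) env d).trans hdd)
    simp [den, this]
  have harg' := fun x y => ((hd x (y :: env) (d + 1)).trans ((hd y env d).trans hdd))
  have hr := fun x y => den_fst (harg' x y)
  rcases lt_or_ge r (gtSum k c τ l) with hlt | hge
  · obtain ⟨τ', hc, hs⟩ := ih _ r (.inl rfl) (by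
      intro h
      rw [gtSum, h] at hlt
      exact absurd hlt (not_lt.2 h0)) h0 hlt.le
    refine ⟨τ', (Runs.letIn hp (Runs.letCall harg hpart (Runs.ifFalse (den_fst (den_fst rfl)) (hr _ _)
      (not_le.2 hlt) (Runs.call ?_ hc)))).mono ?_, hs.of_up⟩
    · have h3 := hr (.pair (.pair (.num (gtSum k c τ l)) (.num (geSum k c τ l)))
          (.pair (Val.ofList ((l.filter fun i => τ < k i).map (enc2 k c)))
            (Val.ofList ((l.filter fun i => k i < τ).map (enc2 k c))))) (.num τ)
      simp only [den, h3]
      rfl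
    · simp only [size, fstE, sndE]; omega
  · rcases le_or_gt r (geSum k c τ l) with hle | hgt
    · refine ⟨τ, (Runs.letIn hp (Runs.letCall harg hpart (Runs.ifTrue (den_fst (den_fst rfl)) (hr _ _)
        hge (Runs.ifTrue (hr _ _) (den_snd (den_fst rfl)) hle (Runs.of_den rfl))))).mono ?_,
        hτ, hge, hle⟩
      simp only [size, fstE, sndE]; omega
    · have hsum := sum_filter_split c (fun _ => True) (fun j => τ ≤ k j) l (fun _ _ _ => trivial)
      simp only [not_le, decide_true, List.filter_true] at hsum
      have h2 : r - geSum k c τ l ≤ ((l.filter fun i => k i < τ).map c).sum := by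
        simp only [geSum]; linarith
      obtain ⟨τ', hc, hs⟩ := ih _ (r - geSum k c τ l) (.inr rfl) (by
        intro h
        rw [h] at h2
        simp at h2
        exact absurd hgt (not_lt.2 h2)) (by linarith) h2
      refine ⟨τ', (Runs.letIn hp (Runs.letCall harg hpart (Runs.ifTrue (den_fst (den_fst rfl))
        (hr _ _) hge (Runs.ifFalse (hr _ _) (den_snd (den_fst rfl)) (not_le.2 hgt)
          (Runs.call ?_ hc))))).mono ?_, hs.of_lo⟩
      · have h3 := hr (.pair (.pair (.num (gtSum k c τ l)) (.num (geSum k c τ l)))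
          (.pair (Val.ofList ((l.filter fun i => τ < k i).map (enc2 k c)))
            (Val.ofList ((l.filter fun i => k i < τ).map (enc2 k c))))) (.num τ)
        simp only [den, subE, h3]
        rfl
      · simp only [size, fstE, sndE, subE]; omega

/-- The pivot is an element and leaves both sublists, so there are at most as many rounds as keys.
The quadratic bound is harmless: this selection is only run on five keys or on fewer than 25. -/
theorem qsel_comp : ∃ K, ∀ {α : Type} (k c : α → ℚ) (n : ℕ) (l : List α), l.length ≤ n → ∀ (r : ℚ),
    l ≠ [] → 0 ≤ r → r ≤ (l.map c).sum → ∃ τ, Comp (prog e) fQsel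
      (.pair (.num r) (Val.ofList (l.map (enc2 k c)))) (.num τ) (K * (n + 1) * (n + 1)) ∧
      IsSel k c l r τ := by
  obtain ⟨Kp, hpart⟩ := part_comp e
  refine ⟨Kp + 110, fun k c n => ?_⟩
  induction n with
  | zero => intro l hl r hne; simp_all
  | succ n ih =>
    intro l hl r hne h0 h1
    obtain ⟨x, l, rfl⟩ := List.exists_cons_of_ne_nil hne
    have hlen : l.length ≤ n := by simpa using hl
    obtain ⟨τ, hτ, hs⟩ := Runs.selTail (self := fQsel) (d := 0)
      (pivot := (fstE (fstE (sndE (.var 0))))) (Tp := 10) e (hpart k c (k x) (x :: l)) (env :=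
      [.pair (.num r) (Val.ofList ((x :: l).map (enc2 k c)))]) rfl
      ((Runs.of_den (den_fst (den_fst (den_snd rfl)))).mono (by simp [size, fstE, sndE]))
      ⟨x, List.mem_cons_self, rfl⟩ h0 h1 (fun l' r' hl' hne h0 h1 => ih l' (by
        rcases hl' with rfl | rfl
        · simp only [lt_self_iff_false, decide_false, Bool.false_eq_true, not_false_eq_true,
            List.filter_cons_of_neg]
          exact (List.length_filter_le _ _).trans hlen
        · simp only [lt_self_iff_false, decide_false, Bool.false_eq_true, not_false_eq_true,
            List.filter_cons_of_neg]
          exact (List.length_filter_le _ _).trans hlen) r' hne h0 h1)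
    refine ⟨τ, ⟨_, rfl, hτ.mono ?_⟩, hs⟩
    have : Kp * ((x :: l).length + 1) ≤ Kp * (n + 1 + 1) := Nat.mul_le_mul_left _ (by simpa using hl)
    nlinarith

/-- Counts as sums of ones. -/
theorem sum_ones (l : List α) : (l.map fun _ => (1 : ℚ)).sum = l.length := by
  simp

theorem count_split (p : α → Prop) [DecidablePred p] (l : List α) :
    (l.filter fun i => p i).length + (l.filter fun i => ¬ p i).length = l.length := by
  simpa using List.length_eq_length_filter_add (l := l) (fun i => decide (p i)) |>.symm

/-- The median of a group has three members of its group on either side, itself included, so a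
median on one side of `τ` brings three items to that side. At most four items at the end are left
without a group. -/
theorem med_comp : ∃ K, ∀ (α : Type) (k c : α → ℚ) (n : ℕ) (l : List α), l.length ≤ n →
    ∃ M : List ℚ, Comp (prog e) fMed (Val.ofList (l.map (enc2 k c)))
      (Val.ofList (M.map (enc2 id fun _ => 1))) (K * (n + 1)) ∧
      (∀ m ∈ M, ∃ i ∈ l, k i = m) ∧ l.length ≤ 5 * M.length + 4 ∧ 5 * M.length ≤ l.length ∧
      ∀ τ, 3 * (M.filter fun m => m ≤ τ).length ≤ (l.filter fun i => k i ≤ τ).length ∧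
        3 * (M.filter fun m => τ ≤ m).length ≤ (l.filter fun i => τ ≤ k i).length := by
  obtain ⟨Kq, hq⟩ := qsel_comp e
  refine ⟨36 * Kq + 100, fun α k c n => ?_⟩
  induction n using Nat.strong_induction_on with
  | _ n ih =>
  intro l hl
  match l, hl with
  | [], _ =>
    refine ⟨[], ⟨_, rfl, (Runs.caseNil rfl (Runs.of_den rfl)).mono ?_⟩, by simp⟩
    simp only [size]; nlinarith
  | [_], _ =>
    refine ⟨[], ⟨_, rfl, (Runs.casePair rfl <| Runs.caseNil rfl (Runs.of_den rfl)).mono ?_⟩, by simp⟩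
    simp only [size]; nlinarith
  | [_, _], _ =>
    refine ⟨[], ⟨_, rfl, (Runs.casePair rfl <| Runs.casePair rfl <|
      Runs.caseNil rfl (Runs.of_den rfl)).mono ?_⟩, by simp⟩
    simp only [size]; nlinarith
  | [_, _, _], _ =>
    refine ⟨[], ⟨_, rfl, (Runs.casePair rfl <| Runs.casePair rfl <| Runs.casePair rfl <|
      Runs.caseNil rfl (Runs.of_den rfl)).mono ?_⟩, by simp⟩
    simp only [size]; nlinarith
  | [_, _, _, _], _ =>
    refine ⟨[], ⟨_, rfl, (Runs.casePair rfl <| Runs.casePair rfl <| Runs.casePair rfl <|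
      Runs.casePair rfl <| Runs.caseNil rfl (Runs.of_den rfl)).mono ?_⟩, by simp⟩
    simp only [size]; nlinarith
  | x₁ :: x₂ :: x₃ :: x₄ :: x₅ :: l, hl =>
    simp only [List.length_cons] at hl
    obtain ⟨M, hM, h0, h1, h2, h3⟩ := ih (n - 5) (by omega) l (by omega)
    -- Target 5/2 among five unit weights: at most two keys lie above `m` and at least three are `≥
    -- m`. The order is the one in which the nested matches bind the heads.
    obtain ⟨m, hm, hmem, hs1, hs2⟩ := hq k (fun _ => 1) 5 [x₅, x₄, x₃, x₂, x₁] (by simp) (5 / 2)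
      (by simp) (by norm_num) (by norm_num)
    refine ⟨m :: M, ⟨_, rfl, (Runs.casePair rfl <| Runs.casePair rfl <| Runs.casePair rfl <|
      Runs.casePair rfl <| Runs.casePair rfl <| Runs.letCall rfl hM <| Runs.letCall rfl hm <|
      Runs.of_den rfl).mono ?_⟩, ?_, by simpa using by omega, by simpa using by omega, ?_⟩
    · obtain ⟨n, rfl⟩ : ∃ n', n = n' + 5 := ⟨n - 5, by omega⟩
      simp only [size, fstE, Nat.add_sub_cancel]
      nlinarith
    · intro m' hm'
      rcases List.mem_cons.1 hm' with rfl | hm'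
      · obtain ⟨i, hi, h⟩ := hmem
        refine ⟨i, ?_, h⟩
        simp only [List.mem_cons, List.not_mem_nil, or_false] at hi ⊢
        tauto
      · obtain ⟨i, hi, h⟩ := h0 m' hm'
        exact ⟨i, by simp [hi], h⟩
    · intro τ
      simp only [gtSum, geSum, sum_ones] at hs1 hs2
      have e1 := count_split (fun i => m < k i) [x₅, x₄, x₃, x₂, x₁]
      have g1 : 3 ≤ ([x₅, x₄, x₃, x₂, x₁].filter fun i => k i ≤ m).length := by
        have : ([x₅, x₄, x₃, x₂, x₁].filter fun i => m < k i).length < 3 := by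
          by_contra h
          have : (3 : ℚ) ≤ ([x₅, x₄, x₃, x₂, x₁].filter fun i => m < k i).length := by
            exact_mod_cast not_lt.1 h
          linarith
        simp only [not_lt, List.length_cons, List.length_nil] at e1
        omega
      have g2 : 3 ≤ ([x₅, x₄, x₃, x₂, x₁].filter fun i => m ≤ k i).length := by
        by_contra h
        have : (([x₅, x₄, x₃, x₂, x₁].filter fun i => m ≤ k i).length : ℚ) ≤ 2 := by
          exact_mod_cast Nat.lt_succ_iff.1 (not_le.1 h)
        linarith
      have perm : (x₁ :: x₂ :: x₃ :: x₄ :: x₅ :: l).Perm ([x₅, x₄, x₃, x₂, x₁] ++ l) := by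
        have : (x₁ :: x₂ :: x₃ :: x₄ :: x₅ :: l) = [x₅, x₄, x₃, x₂, x₁].reverse ++ l := rfl
        rw [this]
        exact (List.reverse_perm _).append_right _
      have mono : ∀ (p q : α → Prop) [DecidablePred p] [DecidablePred q] (s : List α),
          (∀ i, p i → q i) → (s.filter fun i => p i).length ≤ (s.filter fun i => q i).length := by
        intro p q _ _ s h
        exact (List.monotone_filter_right s (fun i => by simpa using h i)).length_le
      rw [(perm.filter _).length_eq, (perm.filter _).length_eq, List.filter_append,
        List.filter_append, List.length_append, List.length_append]
      obtain ⟨h4, h5⟩ := h3 τ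
      refine ⟨?_, ?_⟩
      · by_cases hmt : m ≤ τ
        · have := mono (fun i => k i ≤ m) (fun i => k i ≤ τ) [x₅, x₄, x₃, x₂, x₁]
            fun i h => h.trans hmt
          rw [List.filter_cons_of_pos (by simpa using hmt), List.length_cons]
          omega
        · rw [List.filter_cons_of_neg (by simpa using hmt)]
          omega
      · by_cases hmt : τ ≤ m
        · have := mono (fun i => m ≤ k i) (fun i => τ ≤ k i) [x₅, x₄, x₃, x₂, x₁]
            fun i h => hmt.trans h
          rw [List.filter_cons_of_pos (by simpa using hmt), List.length_cons]
          omega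
        · rw [List.filter_cons_of_neg (by simpa using hmt)]
          omega

/-- Median of medians: at least half of the group medians lie on each side of the pivot, so each
remaining sublist has lost at least `3 * M.length / 2` items. The two recursive calls, on the
medians and on one sublist, together handle at most 19/20 of the length. -/
theorem wsel_comp : ∃ K, ∀ (n : ℕ) {α : Type} (k c : α → ℚ) (l : List α), l.length ≤ n → ∀ (r : ℚ),
    l ≠ [] → 0 ≤ r → r ≤ (l.map c).sum → ∃ τ, Comp (prog e) fWsel
      (.pair (.num r) (Val.ofList (l.map (enc2 k c)))) (.num τ) (K * n) ∧ IsSel k c l r τ := by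
  obtain ⟨Kp, hpart⟩ := part_comp e
  obtain ⟨Kq, hq⟩ := qsel_comp e
  obtain ⟨Km, hm⟩ := med_comp e
  obtain ⟨Kl, hlc⟩ := len_comp e
  -- 625 is 25², for the quadratic selection on at most 24 keys. The other terms pay for one round
  -- out of the twentieth of `K * l.length` that the recursive calls leave over, hence the multiples
  -- of 20.
  refine ⟨625 * Kq + 40 * Km + 80 * Kl + 40 * Kp + 8000, fun n => ?_⟩
  induction n using Nat.strong_induction_on with
  | _ n ih =>
  intro α k c l hl r hne h0 h1
  have hpos : 0 < l.length := List.length_pos_iff.2 hne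
  rcases le_or_gt 25 l.length with h25 | h25
  · obtain ⟨M, hM, hM0, hM1, hM2, hM3⟩ := hm α k c l.length l le_rfl
    have hMne : M ≠ [] := by rintro rfl; simp at hM1; omega
    -- The induction hypothesis is applied with the rationals as items: the medians are their own
    -- keys, with weight one, and the target is half their number.
    obtain ⟨τ, hτ, ⟨⟨m, hmM, rfl⟩, hs1, hs2⟩⟩ := ih M.length (by omega) id (fun _ => 1) M le_rfl
      (M.length / 2) hMne (by positivity) (by rw [sum_ones]; have : (0 : ℚ) ≤ M.length := by positivity
                                              linarith)
    simp only [gtSum, geSum, sum_ones, id] at hs1 hs2 hτ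
    obtain ⟨h3, h4⟩ := hM3 m
    have hτl : ∃ i ∈ l, k i = m := hM0 m hmM
    have hle1 : 2 * (l.filter fun i => m < k i).length + 3 * M.length ≤ 2 * l.length := by
      have e1 := count_split (fun i => m < i) M
      have e2 := count_split (fun i => m < k i) l
      simp only [not_lt] at e1 e2
      have : 2 * (M.filter fun i => m < i).length ≤ M.length := by
        have : (2 : ℚ) * (M.filter fun i => m < i).length ≤ M.length := by linarith
        exact_mod_cast this
      omega
    have hle2 : 2 * (l.filter fun i => k i < m).length + 3 * M.length ≤ 2 * l.length := by
      have e2 := count_split (fun i => k i < m) l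
      simp only [not_lt] at e2
      have : M.length ≤ 2 * (M.filter fun i => m ≤ i).length := by
        have : (M.length : ℚ) ≤ 2 * (M.filter fun i => m ≤ i).length := by linarith
        exact_mod_cast this
      omega
    set s := l.length - (3 * M.length) / 2 with hsdef
    have hlM := hlc (enc2 id fun _ => 1) M
    have hll := hlc (enc2 k c) l
    obtain ⟨τ', hτ', hs'⟩ := Runs.selTail (self := fWsel) (d := 3)
      (pivot := .call fWsel (.pair (divE (.var 0) (.num 2)) (.var 1))) e (hpart k c m l)
      (env := [.num M.length, Val.ofList (M.map (enc2 id fun _ => 1)), .num l.length,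
        .pair (.num r) (Val.ofList (l.map (enc2 k c)))]) rfl
      (Runs.call (by simp [den, divE, ArithOp.apply]) hτ) hτl h0 h1
      (fun l' r' hl' hne h0 h1 => ih s (by omega) k c l' (by
        rcases hl' with rfl | rfl <;> omega) r' hne h0 h1)
    refine ⟨τ', ⟨_, rfl, (Runs.letCall rfl hll <| Runs.ifTrue rfl rfl
      (by exact_mod_cast h25) <| Runs.letCall (den_snd rfl) hM <| Runs.letCall rfl hlM hτ').mono ?_⟩,
      hs'⟩
    simp only [size, sndE, divE]
    set K := 625 * Kq + 40 * Km + 80 * Kl + 40 * Kp + 8000 with hK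
    -- `M.length` is a fifth of the length rounded down, and the length is at least 25.
    have hs1 : 20 * (M.length + s) + l.length ≤ 20 * l.length := by omega
    have hs2 := Nat.mul_le_mul_left K hs1
    have hs3 := Nat.mul_le_mul_left K hl
    have hs4 : Kl * (M.length + 1) ≤ Kl * (l.length + 1) := Nat.mul_le_mul_left _ (by omega)
    have hs5 : K * l.length = 625 * (Kq * l.length) + 40 * (Km * l.length) + 80 * (Kl * l.length) +
      40 * (Kp * l.length) + 8000 * l.length := by rw [hK]; ring
    have hs6 : ∀ C, C ≤ C * l.length := fun C => Nat.le_mul_of_pos_right C hpos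
    have h7 := hs6 Kl
    have h8 := hs6 Km
    have h9 := hs6 Kp
    simp only [mul_add, mul_one, mul_left_comm _ 20] at hs2 hs4 ⊢
    omega
  · obtain ⟨τ, hτ, hs⟩ := hq k c 24 l (by omega) r hne h0 h1
    refine ⟨τ, ⟨_, rfl, (Runs.letCall rfl (hlc (enc2 k c) l) <| Runs.ifFalse rfl rfl
      (by rw [not_le]; exact_mod_cast h25) <| Runs.call rfl hτ).mono ?_⟩, hs⟩
    simp only [size, sndE]
    nlinarith

end

/-! ## Linear programs with one equality constraint -/

section
variable {α : Type}

/-- The value of a linear form. -/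
def dot {R : Type} [Semiring R] (c z : α → R) (l : List α) : R := (l.map fun i => c i * z i).sum

/-- All values lie between zero and one. -/
def Box {R : Type} [Semiring R] [LE R] (z : α → R) : Prop := ∀ i, 0 ≤ z i ∧ z i ≤ 1

/-- Complementary slackness: `z` maximizes the form `d` over the box. -/
def Slack {R S : Type} [Semiring R] [LT R] [Semiring S] (d : α → R) (z : α → S) (l : List α) :
    Prop :=
  ∀ i ∈ l, (0 < d i → z i = 1) ∧ (d i < 0 → z i = 0)

@[simp] theorem dot_nil {R : Type} [Semiring R] (c z : α → R) : dot c z [] = 0 := rfl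

@[simp] theorem dot_cons {R : Type} [Semiring R] (c z : α → R) (i : α) (l : List α) :
    dot c z (i :: l) = c i * z i + dot c z l := by simp [dot]

theorem dot_cast (c z : α → ℚ) (l : List α) :
    ((dot c z l : ℚ) : ℝ) = dot (fun i => (c i : ℝ)) (fun i => (z i : ℝ)) l := by
  induction l with
  | nil => simp
  | cons i l ih => simp [ih]

theorem dot_add {R : Type} [CommRing R] (c c' z : α → R) (l : List α) :
    dot (fun i => c i + c' i) z l = dot c z l + dot c' z l := by
  induction l with
  | nil => simp
  | cons i l ih => simp only [dot_cons, ih]; ring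

theorem dot_sub {R : Type} [CommRing R] (c c' z : α → R) (l : List α) :
    dot (fun i => c i - c' i) z l = dot c z l - dot c' z l := by
  induction l with
  | nil => simp
  | cons i l ih => simp only [dot_cons, ih]; ring

theorem dot_neg {R : Type} [CommRing R] (c z : α → R) (l : List α) :
    dot (fun i => -c i) z l = -dot c z l := by
  induction l with
  | nil => simp
  | cons i l ih => simp only [dot_cons, ih]; ring

theorem dot_smul {R : Type} [CommRing R] (t : R) (c z : α → R) (l : List α) :
    dot (fun i => t * c i) z l = t * dot c z l := by
  induction l with
  | nil => simp
  | cons i l ih => simp only [dot_cons, ih]; ring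

theorem dot_combination {R : Type} [CommRing R] (s t : R) (c z z' : α → R) (l : List α) :
    dot c (fun i => s * z i + t * z' i) l = s * dot c z l + t * dot c z' l := by
  induction l with
  | nil => simp
  | cons i l ih => simp only [dot_cons, ih]; ring

theorem dot_congr {R : Type} [Semiring R] {c c' z z' : α → R} {l : List α}
    (h : ∀ i ∈ l, c i * z i = c' i * z' i) : dot c z l = dot c' z' l := by
  simp only [dot]
  rw [List.map_congr_left h]

theorem Box.cast {z : α → ℚ} (h : Box z) : Box fun i => (z i : ℝ) := fun i =>
  ⟨Rat.cast_nonneg.2 (h i).1, by simpa using (Rat.cast_le (K := ℝ)).2 (h i).2⟩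

theorem Slack.cast {R : Type} [Semiring R] [LT R] {d : α → R} {z : α → ℚ} {l : List α}
    (h : Slack d z l) : Slack d (fun i => (z i : ℝ)) l := fun i hi =>
  ⟨fun h' => by simp [(h i hi).1 h'], fun h' => by simp [(h i hi).2 h']⟩

theorem Slack.cast_left {S : Type} [Semiring S] {d : α → ℚ} {z : α → S} {l : List α} :
    Slack (fun i => (d i : ℝ)) z l ↔ Slack d z l := by
  simp [Slack]

theorem Slack.term_le {d z z' : α → ℝ} {l : List α} (h : Slack d z l) (h' : Box z') {i : α}
    (hi : i ∈ l) : d i * z' i ≤ d i * z i := by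
  obtain ⟨h1, h2⟩ := h i hi
  rcases lt_trichotomy (d i) 0 with h | h | h
  · rw [h2 h]; nlinarith [(h' i).1]
  · simp [h]
  · rw [h1 h]; nlinarith [(h' i).2]

theorem Slack.dot_le {d z z' : α → ℝ} {l : List α} (h : Slack d z l) (h' : Box z') :
    dot d z' l ≤ dot d z l :=
  List.sum_le_sum fun _ hi => h.term_le h' hi

/-- Each term of `z` is maximal over the box, so a point with at least the same total is maximal in
every term. Thus every optimal solution obeys slackness with the same multiplier. -/
theorem Slack.of_dot_le {d z z' : α → ℝ} {l : List α} (h : Slack d z l) (h' : Box z')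
    (hle : dot d z l ≤ dot d z' l) : Slack d z' l := by
  induction l with
  | nil => intro i hi; cases hi
  | cons i l ih =>
    have hl : Slack d z l := fun j hj => h j (List.mem_cons_of_mem _ hj)
    have h1 := h.term_le h' (List.mem_cons_self (a := i) (l := l))
    have h2 := hl.dot_le h'
    simp only [dot_cons] at hle
    have hi : d i * z' i = d i * z i := by linarith
    intro j hj
    rcases List.mem_cons.1 hj with rfl | hj
    · obtain ⟨h3, h4⟩ := h j List.mem_cons_self
      refine ⟨fun hd => ?_, fun hd => ?_⟩
      · rw [← h3 hd]; exact mul_left_cancel₀ hd.ne' hi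
      · rw [← h4 hd]; exact mul_left_cancel₀ hd.ne hi
    · exact ih hl (by linarith) j hj

/-- Only the ties of a solution with complementary slackness are free. -/
theorem Slack.dot_eq {R : Type} [Semiring R] {d : α → ℚ} {z : α → R} {l : List α}
    (h : Slack d z l) (c : α → R) :
    dot c z l = ((l.filter fun i => 0 < d i).map c).sum + dot c z (l.filter fun i => d i = 0) := by
  induction l with
  | nil => simp
  | cons i l ih =>
    have ih := ih fun j hj => h j (List.mem_cons_of_mem _ hj)
    obtain ⟨h1, h2⟩ := h i List.mem_cons_self
    rcases lt_trichotomy (d i) 0 with hd | hd | hd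
    · simp [hd.not_gt, hd.ne, h2 hd, ih]
    · simp [hd, ih, add_left_comm]
    · simp [hd, hd.ne', h1 hd, ih, add_assoc]

theorem zval_mem {τ θ : ℚ} (hθ : 0 ≤ θ ∧ θ ≤ 1) (q c : ℚ) :
    0 ≤ zval τ θ q c ∧ zval τ θ q c ≤ 1 := by
  unfold zval
  split_ifs <;> constructor <;> linarith

theorem zval_slack {τ θ : ℚ} (q c : α → ℚ) (l : List α) :
    Slack (fun i => q i - τ * c i) (fun i => zval τ θ (q i) (c i)) l := by
  intro i _
  unfold zval
  exact ⟨fun h => if_neg (not_le.2 h), fun h => (if_pos (le_of_lt h)).trans (if_neg (not_le.2 h))⟩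

theorem sum_normKeys (q c : α → ℚ) (l : List α) :
    ((normKeys q c l).map Prod.snd).sum = (l.map fun i => |c i|).sum := by
  induction l with
  | nil => rfl
  | cons i l ih =>
    by_cases h : c i = 0
    · simpa [normKeys, h] using ih
    · simpa [normKeys, h] using ih

/-- Replacing `z` by `1 - z` where `c < 0` turns the form into a sum with weights `|c|`, shifted by
the sum of `max (-c) 0`. The new variable is 1, `θ` or 0 according as the key `q / c` is above, at
or below `τ`. This is why `zval` gives a tie with `c < 0` the value `1 - θ`. -/
theorem dot_zval (τ θ : ℚ) (q c : α → ℚ) (l : List α) :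
    dot c (fun i => zval τ θ (q i) (c i)) l + (l.map fun i => max (-c i) 0).sum =
      gtSum Prod.fst Prod.snd τ (normKeys q c l) + θ *
        (geSum Prod.fst Prod.snd τ (normKeys q c l) - gtSum Prod.fst Prod.snd τ (normKeys q c l)) := by
  induction l with
  | nil => simp [normKeys, gtSum, geSum]
  | cons i l ih =>
    have hgt : gtSum Prod.fst Prod.snd τ (normKeys q c (i :: l)) =
        (if c i ≠ 0 ∧ τ < q i / c i then |c i| else 0) +
          gtSum Prod.fst Prod.snd τ (normKeys q c l) := by
      simp only [gtSum, normKeys, List.filter_cons]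
      by_cases h : c i = 0 <;> by_cases h' : τ < q i / c i <;> simp [h, h']
    have hge : geSum Prod.fst Prod.snd τ (normKeys q c (i :: l)) =
        (if c i ≠ 0 ∧ τ ≤ q i / c i then |c i| else 0) +
          geSum Prod.fst Prod.snd τ (normKeys q c l) := by
      simp only [geSum, normKeys, List.filter_cons]
      by_cases h : c i = 0 <;> by_cases h' : τ ≤ q i / c i <;> simp [h, h']
    rw [hgt, hge, dot_cons, List.map_cons, List.sum_cons]
    have key : c i * zval τ θ (q i) (c i) + max (-c i) 0 =
        (if c i ≠ 0 ∧ τ < q i / c i then |c i| else 0) + θ *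
          ((if c i ≠ 0 ∧ τ ≤ q i / c i then |c i| else 0) -
            (if c i ≠ 0 ∧ τ < q i / c i then |c i| else 0)) := by
      rcases lt_trichotomy (c i) 0 with hc | hc | hc
      · have e1 : τ < q i / c i ↔ q i - τ * c i < 0 := by
          rw [lt_div_iff_of_neg hc, sub_neg]
        have e2 : τ ≤ q i / c i ↔ q i - τ * c i ≤ 0 := by
          rw [le_div_iff_of_neg hc, sub_nonpos]
        rw [max_eq_left (neg_pos.2 hc).le, abs_of_neg hc, zval]
        simp only [e1, e2]
        rcases lt_trichotomy (q i - τ * c i) 0 with h | h | h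
        · simp [h, h.le, h.not_ge, hc.ne]
        · simp [h, hc.ne, hc.le, hc.not_ge]; ring
        · simp [h.not_ge, h.not_gt]
      · simp [hc]
      · have e1 : τ < q i / c i ↔ 0 < q i - τ * c i := by
          rw [lt_div_iff₀ hc, sub_pos]
        have e2 : τ ≤ q i / c i ↔ 0 ≤ q i - τ * c i := by
          rw [le_div_iff₀ hc, sub_nonneg]
        rw [max_eq_right (neg_lt_zero.2 hc).le, abs_of_pos hc, zval]
        simp only [e1, e2]
        rcases lt_trichotomy (q i - τ * c i) 0 with h | h | h
        · simp [h.le, h.not_ge, h.not_gt]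
        · simp [h, hc.ne', hc.not_ge]; ring
        · simp [h, h.le, h.not_ge, hc.ne']
    linarith

theorem dot_bounds (c : α → ℚ) {z : α → ℝ} (hz : Box z) (l : List α) :
    -(((l.map fun i => max (-c i) 0).sum : ℚ) : ℝ) ≤ dot (fun i => (c i : ℝ)) z l ∧
      dot (fun i => (c i : ℝ)) z l ≤
        (((l.map fun i => |c i|).sum : ℚ) : ℝ) - (((l.map fun i => max (-c i) 0).sum : ℚ) : ℝ) := by
  induction l with
  | nil => simp
  | cons i l ih =>
    simp only [List.map_cons, List.sum_cons, Rat.cast_add, dot_cons, Rat.cast_max, Rat.cast_neg,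
      Rat.cast_abs, Rat.cast_zero]
    obtain ⟨h0, h1⟩ := hz i
    rcases le_total (c i : ℝ) 0 with h | h
    · rw [max_eq_left (neg_nonneg.2 h), abs_of_nonpos h]
      constructor <;> nlinarith
    · rw [max_eq_right (neg_nonpos.2 h), abs_of_nonneg h]
      constructor <;> nlinarith

/-- The selected key is attained by an item of positive weight, so the divisor in the formula for
`θ` is not zero. -/
theorem IsSel.gtSum_lt {k c : α → ℚ} {l : List α} {r τ : ℚ} (h : IsSel k c l r τ)
    (hc : ∀ i ∈ l, 0 < c i) : gtSum k c τ l < geSum k c τ l := by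
  obtain ⟨⟨i, hi, rfl⟩, -, -⟩ := h
  rw [gtSum, geSum, sum_filter_split c (fun j => k i ≤ k j) (fun j => k i < k j) l fun _ _ h => h.le]
  refine lt_add_of_pos_right _ (List.sum_pos _ ?_ ?_)
  · intro x hx
    obtain ⟨j, hj, rfl⟩ := List.mem_map.1 hx
    exact hc j (List.mem_of_mem_filter (List.mem_of_mem_filter hj))
  · simp only [ne_eq, List.map_eq_nil_iff, List.filter_eq_nil_iff]
    exact fun h => h i (by simp [hi]) (by simp)

variable (e : Expr)

/-- By `zval_slack` every choice of `τ` and `θ` gives a maximizer of the Lagrangian, so it is enough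
to meet the constraint. By `dot_zval` this is weighted selection with the shifted target: `τ` is the
key where the total passes it, and `θ` splits the ties. Infeasibility means that the target is
outside the range of the form on the box. -/
theorem solve1_comp : ∃ K, ∀ {α : Type} (q c f : α → ℚ) (l : List α) (r : ℚ),
    (Comp (prog e) fSolve1 (.pair (.num r) (Val.ofList (l.map (enc3 q c f)))) .nil
        (K * (l.length + 1)) ∧
      ∀ z : α → ℝ, Box z → dot (fun i => (c i : ℝ)) z l ≠ r) ∨
    ∃ τ θ, Comp (prog e) fSolve1 (.pair (.num r) (Val.ofList (l.map (enc3 q c f))))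
        (.pair (.num τ) (.num θ)) (K * (l.length + 1)) ∧ (0 ≤ θ ∧ θ ≤ 1) ∧
      dot c (fun i => zval τ θ (q i) (c i)) l = r := by
  obtain ⟨Kn, hn⟩ := norm_comp e
  obtain ⟨Kw, hw⟩ := wsel_comp e
  obtain ⟨Kp, hp⟩ := part_comp e
  refine ⟨Kn + Kw + Kp + 200, fun {α} q c f l r => ?_⟩
  have hmono : ∀ {T : ℕ}, T ≤ Kn * (l.length + 1) + Kw * (l.length + 1) + Kp * (l.length + 1) + 200 →
      T ≤ (Kn + Kw + Kp + 200) * (l.length + 1) := fun h => by nlinarith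
  have hN := hn q c f l
  set N := normKeys q c l with hNdef
  set tot := (l.map fun i => |c i|).sum with htot
  set neg := (l.map fun i => max (-c i) 0).sum with hneg
  have hNlen : N.length ≤ l.length := by
    simp only [hNdef, normKeys, List.length_map]; exact List.length_filter_le _ _
  rcases lt_or_ge (r + neg) 0 with h | h0
  · refine .inl ⟨⟨_, rfl, (Runs.letCall rfl hN <| Runs.letDen (x := .num (r + neg)) rfl <|
      Runs.ifFalse rfl rfl (not_le.2 h) <| Runs.of_den rfl).mono (hmono ?_)⟩, fun z hz hr => ?_⟩
    · simp only [size, fstE, sndE, addE]; omega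
    · have h1 := (dot_bounds c hz l).1
      rw [hr] at h1
      have : -neg ≤ r := by exact_mod_cast h1
      linarith
  rcases lt_or_ge tot (r + neg) with h | h1
  · refine .inl ⟨⟨_, rfl, (Runs.letCall rfl hN <| Runs.letDen (x := .num (r + neg)) rfl <|
      Runs.ifTrue rfl rfl h0 <| Runs.ifFalse rfl rfl (not_le.2 h) <|
      Runs.of_den rfl).mono (hmono ?_)⟩, fun z hz hr => ?_⟩
    · simp only [size, fstE, sndE, addE]; omega
    · have h1 := (dot_bounds c hz l).2
      rw [hr] at h1
      have : r ≤ tot - neg := by exact_mod_cast h1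
      linarith
  refine .inr ?_
  -- Without nonzero coefficients selection has no key to return; the form is then constant on the
  -- box, and the default parameters `0, 0` will do.
  rcases List.eq_nil_or_concat N with hNe | ⟨N', x, hNe'⟩
  · have ht : tot = 0 := by rw [htot, ← sum_normKeys q c, ← hNdef, hNe]; rfl
    have hz := dot_zval 0 0 q c l
    rw [← hNdef, hNe, ← hneg] at hz
    simp only [gtSum, geSum, List.filter_nil, List.map_nil, List.sum_nil, sub_zero, mul_zero,
      add_zero] at hz
    rw [hNe] at hN
    refine ⟨0, 0, ⟨_, rfl, (Runs.letCall rfl hN <| Runs.letDen (x := .num (r + neg)) rfl <|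
      Runs.ifTrue rfl rfl h0 <| Runs.ifTrue rfl rfl h1 <| Runs.caseNil rfl <|
      Runs.of_den rfl).mono (hmono ?_)⟩, by simp, by linarith⟩
    simp only [size, fstE, sndE, addE]; omega
  · have hNe : N ≠ [] := by rw [hNe']; simp
    obtain ⟨τ, hτ, hs⟩ := hw N.length Prod.fst Prod.snd N le_rfl (r + neg) hNe h0
      (by rw [hNdef, sum_normKeys]; exact h1)
    have hlt := hs.gtSum_lt fun x hx => by
      obtain ⟨i, hi, rfl⟩ := List.mem_map.1 hx
      simpa using (List.mem_filter.1 hi).2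
    have hz := dot_zval τ ((r + neg - gtSum Prod.fst Prod.snd τ N) /
      (geSum Prod.fst Prod.snd τ N - gtSum Prod.fst Prod.snd τ N)) q c l
    rw [← hNdef, ← hneg, div_mul_cancel₀ _ (sub_pos.2 hlt).ne'] at hz
    obtain ⟨x, N', hcons⟩ := List.exists_cons_of_ne_nil hNe
    have hP := hp Prod.fst Prod.snd τ N
    refine ⟨τ, _, ⟨_, rfl, (Runs.letCall rfl hN <| Runs.letDen (x := .num (r + neg)) rfl <|
      Runs.ifTrue rfl rfl h0 <| Runs.ifTrue rfl rfl h1 <|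
      Runs.casePair (x := enc2 Prod.fst Prod.snd x)
        (y := Val.ofList (N'.map (enc2 Prod.fst Prod.snd))) (by rw [hcons]; rfl) <|
      Runs.letCall rfl hτ <| Runs.letCall rfl hP <| Runs.of_den ?_).mono (hmono ?_)⟩, ?_, by linarith⟩
    · simp only [den, fstE, sndE, subE, divE, List.getElem?_cons_succ, List.getElem?_cons_zero,
        ArithOp.apply, (sub_pos.2 hlt).ne', if_false, Option.map_some]
    · have h2 : Kw * N.length ≤ Kw * (l.length + 1) := Nat.mul_le_mul_left _ (by omega)
      have h3 : Kp * (N.length + 1) ≤ Kp * (l.length + 1) := Nat.mul_le_mul_left _ (by omega)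
      simp only [size, fstE, sndE, addE, divE, subE]; omega
    · exact ⟨div_nonneg (sub_nonneg.2 hs.2.1) (sub_pos.2 hlt).le,
        (div_le_one (sub_pos.2 hlt)).2 (sub_le_sub_right hs.2.2 _)⟩

/-! ### Extreme values of a second form over the optimal solutions, and the test of a line. -/

theorem lexval_mem {A : ℚ × ℚ × ℚ} (h : 0 ≤ A.2.2 ∧ A.2.2 ≤ 1) (q c f : ℚ) :
    0 ≤ lexval A q c f ∧ lexval A q c f ≤ 1 := by
  unfold lexval
  split_ifs
  · exact zval_mem h _ _
  · simp
  · simp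

theorem lexval_slack (A : ℚ × ℚ × ℚ) (q c f : α → ℚ) (l : List α) :
    Slack (fun i => q i - A.1 * c i) (fun i => lexval A (q i) (c i) (f i)) l := by
  intro i _
  unfold lexval
  exact ⟨fun h => if_neg (not_le.2 h), fun h => (if_pos (le_of_lt h)).trans (if_neg (not_le.2 h))⟩

theorem lexval_tie {A : ℚ × ℚ × ℚ} {q c : ℚ} (h : q - A.1 * c = 0) (f : ℚ) :
    lexval A q c f = zval A.2.1 A.2.2 f c := by
  simp [lexval, h]

/-- Among the solutions of the program with profits `q` and the constraint for `c` that satisfy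
complementary slackness with the multiplier `τ`, the solution `φ` has the largest value of `f`. -/
def LexMax (q c f : α → ℚ) (τ r : ℚ) (φ : α → ℚ) (l : List α) : Prop :=
  Box φ ∧ dot c φ l = r ∧ Slack (fun i => q i - τ * c i) φ l ∧
    ∀ z : α → ℝ, Box z → Slack (fun i => q i - τ * c i) z l → dot (fun i => (c i : ℝ)) z l = r →
      dot (fun i => (f i : ℝ)) z l ≤ dot (fun i => (f i : ℝ)) (fun i => (φ i : ℝ)) l

theorem LexMax.optimal {q c f φ : α → ℚ} {τ r : ℚ} {l : List α} (h : LexMax q c f τ r φ l)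
    {z : α → ℝ} (hz : Box z) (hc : dot (fun i => (c i : ℝ)) z l = r) :
    dot (fun i => (q i : ℝ)) z l ≤ dot (fun i => (q i : ℝ)) (fun i => (φ i : ℝ)) l := by
  obtain ⟨-, hφc, hφs, -⟩ := h
  have h := (Slack.cast_left.2 hφs.cast : Slack (fun i => ((q i - τ * c i : ℚ) : ℝ)) _ l).dot_le hz
  have hφc' := congrArg (Rat.cast (K := ℝ)) hφc
  rw [dot_cast] at hφc'
  push_cast at h
  rw [dot_sub, dot_sub, dot_smul, dot_smul, hc, hφc'] at h
  linarith

/-- Slackness with `τ` fixes every variable except the ties `q = τ c`. Maximizing `f` among such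
solutions is a one-constraint program on the ties, with the contribution of the variables fixed at 1
subtracted from the target. -/
theorem lex_comp : ∃ K, ∀ {α : Type} (q c f : α → ℚ) (l : List α) (r : ℚ),
    (Comp (prog e) fLex (.pair (.num r) (Val.ofList (l.map (enc3 q c f)))) .nil
        (K * (l.length + 1)) ∧
      ∀ z : α → ℝ, Box z → dot (fun i => (c i : ℝ)) z l ≠ r) ∨
    ∃ A, Comp (prog e) fLex (.pair (.num r) (Val.ofList (l.map (enc3 q c f))))
        (encA A) (K * (l.length + 1)) ∧
      LexMax q c f A.1 r (fun i => lexval A (q i) (c i) (f i)) l := by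
  obtain ⟨Ks, hs⟩ := solve1_comp e
  obtain ⟨Kt, ht⟩ := tie_comp e
  refine ⟨2 * Ks + Kt + 100, fun {α} q c f l r => ?_⟩
  have hmono : ∀ {T : ℕ}, T ≤ Ks * (l.length + 1) + Ks * (l.length + 1) + Kt * (l.length + 1) + 100 →
      T ≤ (2 * Ks + Kt + 100) * (l.length + 1) := fun h => by nlinarith
  rcases hs q c f l r with ⟨h, hinf⟩ | ⟨τ, θ, h, hθ, hdot⟩
  · refine .inl ⟨⟨_, rfl, (Runs.letCall rfl h <| Runs.caseNil rfl <| Runs.of_den rfl).mono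
      (hmono ?_)⟩, hinf⟩
    simp only [size]; omega
  · refine .inr ?_
    have hT := ht q c f τ l
    set T := l.filter fun i => q i - τ * c i = 0 with hTdef
    set S := ((l.filter fun i => 0 < q i - τ * c i).map c).sum with hS
    have hlen : Ks * (T.length + 1) ≤ Ks * (l.length + 1) :=
      Nat.mul_le_mul_left _ (Nat.succ_le_succ (List.length_filter_le _ _))
    have hsplit := (zval_slack (τ := τ) (θ := θ) q c l).dot_eq c
    rw [hdot, ← hTdef, ← hS] at hsplit
    rcases hs f c f T (r - S) with ⟨-, hinf⟩ | ⟨τ', θ', h', hθ', hdot'⟩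
    -- The first solution, restricted to the ties, is feasible for the program on the ties.
    · refine absurd ?_ (hinf _ (Box.cast fun i => zval_mem (τ := τ) hθ (q i) (c i)))
      rw [← dot_cast]
      exact_mod_cast eq_sub_of_add_eq' hsplit.symm
    · refine ⟨(τ, τ', θ'), ⟨_, rfl, (Runs.letCall rfl h <| Runs.casePair rfl <|
        Runs.letCall rfl hT <| Runs.letCall rfl h' <| Runs.of_den rfl).mono (hmono ?_)⟩, ?_⟩
      · simp only [size, fstE, sndE, subE]; omega
      · have htie : ∀ i ∈ T, lexval (τ, τ', θ') (q i) (c i) (f i) = zval τ' θ' (f i) (c i) :=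
          fun i hi => lexval_tie (by simpa using (List.mem_filter.1 hi).2) _
        have hsl := lexval_slack (τ, τ', θ') q c f l
        refine ⟨fun i => lexval_mem hθ' _ _ _, ?_, hsl, fun z hz hzs hzr => ?_⟩
        · rw [hsl.dot_eq c, ← hTdef, ← hS, dot_congr fun i hi => by rw [htie i hi], hdot']
          ring
        · have hc := hzs.dot_eq (fun i => (c i : ℝ))
          have hf := hzs.dot_eq (fun i => (f i : ℝ))
          have hf' := hsl.cast.dot_eq (fun i => (f i : ℝ))
          have hc' := (zval_slack (τ := τ') (θ := θ') f c T).cast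
          rw [← Slack.cast_left] at hc'
          have hle := hc'.dot_le hz
          have hdot'' := congrArg (Rat.cast (K := ℝ)) hdot'
          rw [dot_cast] at hdot''
          have hSc : ((S : ℚ) : ℝ) =
              ((l.filter fun i => 0 < q i - τ * c i).map fun i => (c i : ℝ)).sum := by
            rw [hS, Rat.cast_list_sum, List.map_map]; rfl
          push_cast at hle hdot''
          rw [dot_sub, dot_sub, dot_smul, dot_smul, hdot''] at hle
          have hcT : dot (fun i => (c i : ℝ)) z T = r - S := by
            rw [hSc]; rw [hzr] at hc; linarith
          rw [hcT] at hle
          rw [hf, hf', ← hTdef, dot_congr (l := T) (z := fun i => ((lexval (τ, τ', θ') (q i) (c i) (f i) : ℚ) : ℝ))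
            (z' := fun i => ((zval τ' θ' (f i) (c i) : ℚ) : ℝ)) fun i hi => by rw [htie i hi]]
          linarith

/-- Both `z` and `φ` maximize a Lagrangian over the box. Comparing each with the other and adding
gives `y * (s - f(φ)) ≤ 0`, hence `y ≤ 0`. Strictness is where the lexicographic choice of `φ`
enters; pruning depends on it. -/
theorem LexMax.multiplier_neg {q c f φ : α → ℚ} {τ r : ℚ} {l : List α} (h : LexMax q c f τ r φ l)
    {s : ℝ} (hs : dot (fun i => (f i : ℝ)) (fun i => (φ i : ℝ)) l < s) {z : α → ℝ} {x y : ℝ}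
    (hz : Box z) (hd : Slack (fun i => (q i : ℝ) - x * c i - y * f i) z l)
    (hc : dot (fun i => (c i : ℝ)) z l = r) (hf : dot (fun i => (f i : ℝ)) z l = s) : y < 0 := by
  obtain ⟨hφ, hφc, hφs, hmax⟩ := h
  have h1 := hd.dot_le hφ.cast
  have hφs' : Slack (fun i => ((q i - τ * c i : ℚ) : ℝ)) (fun i => (φ i : ℝ)) l :=
    Slack.cast_left.2 hφs.cast
  have h2 := hφs'.dot_le hz
  have hφc' := congrArg (Rat.cast (K := ℝ)) hφc
  rw [dot_cast] at hφc'
  push_cast at h2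
  rw [dot_sub, dot_sub, dot_smul, dot_smul, hc, hφc'] at h2
  rw [dot_sub, dot_sub, dot_smul, dot_smul, dot_sub, dot_sub, dot_smul, dot_smul, hc, hφc', hf] at h1
  have h3 : y * (s - dot (fun i => (f i : ℝ)) (fun i => (φ i : ℝ)) l) ≤ 0 := by linarith
  have hy : y ≤ 0 := by
    by_contra hy
    nlinarith [not_le.1 hy]
  -- With `y = 0` the point `z` would be optimal for the constraint on `c` alone, hence obey
  -- slackness with `τ`, and its value `s` would exceed the maximum of `f`.
  refine lt_of_le_of_ne hy fun hy0 => ?_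
  subst hy0
  have h4 := hmax z hz (Slack.cast_left.1 (hφs'.of_dot_le hz (by
    push_cast
    rw [dot_sub, dot_sub, dot_smul, dot_smul, hc, hφc']
    linarith))) hc
  linarith

theorem LexMax.multiplier_pos {q c f φ : α → ℚ} {τ r : ℚ} {l : List α}
    (h : LexMax q c (fun i => -f i) τ r φ l) {s : ℝ}
    (hs : s < dot (fun i => (f i : ℝ)) (fun i => (φ i : ℝ)) l) {z : α → ℝ} {x y : ℝ}
    (hz : Box z) (hd : Slack (fun i => (q i : ℝ) - x * c i - y * f i) z l)
    (hc : dot (fun i => (c i : ℝ)) z l = r) (hf : dot (fun i => (f i : ℝ)) z l = s) : 0 < y := by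
  have hneg : ∀ z : α → ℝ, dot (fun i => ((-f i : ℚ) : ℝ)) z l = -dot (fun i => (f i : ℝ)) z l := by
    intro z
    rw [← dot_neg]
    exact dot_congr fun i _ => by push_cast; rfl
  have := h.multiplier_neg (s := -s) (x := x) (y := -y) (by rw [hneg]; linarith) hz
    (by convert hd using 2; push_cast; ring) hc (by rw [hneg, hf])
  linarith

/-- The possible outcomes of the test of a line: the program with the constraint for `c` is
infeasible, or the multiplier of the constraint for `f` in the program with both constraints has
a known strict sign, or a solution of the program with both constraints has been found. -/
def TestOutcome (q c f : α → ℚ) (r s : ℚ) (l : List α) (out : Val) : Prop :=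
  (out = .nil ∧ ∀ z : α → ℝ, Box z → dot (fun i => (c i : ℝ)) z l ≠ r) ∨
  (∃ ε : ℚ, (ε = 1 ∨ ε = -1) ∧ out = .pair (.num ε) .nil ∧
    ∀ (z : α → ℝ) (x y : ℝ), Box z → Slack (fun i => (q i : ℝ) - x * c i - y * f i) z l →
      dot (fun i => (c i : ℝ)) z l = r → dot (fun i => (f i : ℝ)) z l = s → ε * y < 0) ∨
  ∃ φ : α → ℚ, out = .pair (encL φ l) (.pair .nil .nil) ∧ Box φ ∧ dot c φ l = r ∧ dot f φ l = s ∧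
    ∀ z : α → ℝ, Box z → dot (fun i => (c i : ℝ)) z l = r →
      dot (fun i => (q i : ℝ)) z l ≤ dot (fun i => (q i : ℝ)) (fun i => (φ i : ℝ)) l

/-- The two lexicographic runs give the largest value `F` and the smallest value `G` of `f` over
optimal solutions. If `s` lies between them, a convex combination attains it and remains optimal;
otherwise the side on which `s` lies decides the sign of the multiplier. -/
theorem test_comp : ∃ K, ∀ {α : Type} (q c f : α → ℚ) (l : List α) (r s : ℚ),
    ∃ out, Comp (prog e) fTest
        (.pair (.pair (.num r) (.num s)) (Val.ofList (l.map (enc3 q c f)))) out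
        (K * (l.length + 1)) ∧ TestOutcome q c f r s l out := by
  obtain ⟨Kx, hx⟩ := lex_comp e
  obtain ⟨Kn, hn⟩ := neg_comp e
  obtain ⟨Ks, hs⟩ := sums_comp e
  obtain ⟨Kc, hc⟩ := comb_comp e
  refine ⟨2 * Kx + Kn + Ks + Kc + 200, fun {α} q c f l r s => ?_⟩
  have hmono : ∀ {T : ℕ}, T ≤ Kx * (l.length + 1) + Kx * (l.length + 1) + Kn * (l.length + 1) +
      Ks * (l.length + 1) + Kc * (l.length + 1) + 200 →
      T ≤ (2 * Kx + Kn + Ks + Kc + 200) * (l.length + 1) := fun h => by nlinarith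
  rcases hx q c f l r with ⟨h, hinf⟩ | ⟨A, hA, hAm⟩
  · refine ⟨_, ⟨_, rfl, (Runs.letCall rfl h <| Runs.caseNil rfl <| Runs.of_den rfl).mono
      (hmono ?_)⟩, .inl ⟨rfl, hinf⟩⟩
    simp only [size, fstE, sndE]; omega
  rcases hx q c (fun i => -f i) l r with ⟨-, hinf⟩ | ⟨B, hB, hBm⟩
  · refine absurd ?_ (hinf _ hAm.1.cast)
    rw [← dot_cast, hAm.2.1]
  have hN := hn q c f l
  have hS := hs q c f A B l
  set F := (l.map fun i => f i * lexval A (q i) (c i) (f i)).sum with hF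
  set G := (l.map fun i => f i * lexval B (q i) (c i) (-f i)).sum with hG
  rcases lt_or_ge F s with h | h1
  · refine ⟨_, ⟨_, rfl, (Runs.letCall rfl hA <| Runs.casePair rfl <| Runs.letCall rfl hN <|
      Runs.letCall rfl hB <| Runs.letCall rfl hS <| Runs.ifFalse rfl rfl (not_le.2 h) <|
      Runs.of_den rfl).mono (hmono ?_)⟩, .inr (.inl ⟨1, .inl rfl, rfl, ?_⟩)⟩
    · simp only [size, fstE, sndE]; omega
    · intro z x y hz hd hzc hzf
      rw [Rat.cast_one, one_mul]
      refine hAm.multiplier_neg ?_ hz hd hzc hzf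
      rw [← dot_cast]
      exact_mod_cast h
  rcases lt_or_ge s G with h | h2
  · refine ⟨_, ⟨_, rfl, (Runs.letCall rfl hA <| Runs.casePair rfl <| Runs.letCall rfl hN <|
      Runs.letCall rfl hB <| Runs.letCall rfl hS <| Runs.ifTrue rfl rfl h1 <|
      Runs.ifFalse rfl rfl (not_le.2 h) <|
      Runs.of_den rfl).mono (hmono ?_)⟩, .inr (.inl ⟨-1, .inr rfl, rfl, ?_⟩)⟩
    · simp only [size, fstE, sndE]; omega
    · intro z x y hz hd hzc hzf
      rw [Rat.cast_neg, Rat.cast_one, neg_one_mul, neg_lt_zero]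
      refine hBm.multiplier_pos ?_ hz hd hzc hzf
      rw [← dot_cast]
      exact_mod_cast h
  -- If `F ≤ G`, then `F = G = s` and any weight works; the program takes 0 to avoid dividing by
  -- zero.
  · obtain ⟨t, ht0, ht1, hts, htden⟩ : ∃ t : ℚ, 0 ≤ t ∧ t ≤ 1 ∧ t * F + (1 - t) * G = s ∧
        (if F ≤ G then t = 0 else F - G ≠ 0 ∧ t = (s - G) / (F - G)) := by
      rcases le_or_gt F G with hFG | hFG
      · exact ⟨0, le_rfl, zero_le_one, by linarith, by simp [hFG]⟩
      · have hpos := sub_pos.2 hFG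
        refine ⟨(s - G) / (F - G), div_nonneg (sub_nonneg.2 h2) hpos.le,
          (div_le_one hpos).2 (by linarith), ?_, by simp [not_le.2 hFG, hpos.ne']⟩
        have := div_mul_cancel₀ (s - G) hpos.ne'
        linarith
    have hC := hc q c f t A B l
    refine ⟨_, ⟨_, rfl, (Runs.letCall rfl hA <| Runs.casePair rfl <| Runs.letCall rfl hN <|
      Runs.letCall rfl hB <| Runs.letCall rfl hS <| Runs.ifTrue rfl rfl h1 <|
      Runs.ifTrue rfl rfl h2 <| Runs.letDen (x := .num t) ?_ <| Runs.letCall rfl hC <|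
      Runs.of_den rfl).mono (hmono ?_)⟩, .inr (.inr ⟨_, rfl, ?_, ?_, ?_, fun z hz hzc => ?_⟩)⟩
    · simp only [den, fstE, sndE, subE, divE, List.getElem?_cons_succ, List.getElem?_cons_zero,
        ArithOp.apply, Option.map_some]
      by_cases h3 : F ≤ G
      · rw [if_pos h3] at htden ⊢
        rw [htden]
      · rw [if_neg h3] at htden ⊢
        rw [if_neg htden.1, htden.2]
        rfl
    · simp only [size, fstE, sndE, divE, subE]; omega
    · intro i
      obtain ⟨a1, a2⟩ := hAm.1 i
      obtain ⟨b1, b2⟩ := hBm.1 i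
      constructor
      · nlinarith [mul_nonneg ht0 a1, mul_nonneg (sub_nonneg.2 ht1) b1]
      · nlinarith [mul_le_mul_of_nonneg_left a2 ht0, mul_le_mul_of_nonneg_left b2 (sub_nonneg.2 ht1)]
    · rw [dot_combination, hAm.2.1, hBm.2.1]; ring
    · rw [dot_combination]; exact hts
    · have hA' := hAm.optimal hz hzc
      have hB' := hBm.optimal hz hzc
      have ht0' : (0 : ℝ) ≤ t := by exact_mod_cast ht0
      have ht1' : (0 : ℝ) ≤ 1 - t := by
        rw [sub_nonneg]; exact_mod_cast ht1
      push_cast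
      rw [dot_combination]
      nlinarith

end

/-! ## Existence of multipliers -/

open Filter Topology in
theorem eventually_mem_box {z u : ℝ} (h0 : 0 ≤ z) (h1 : z ≤ 1) (hu : 0 < u → z < 1)
    (hu' : u < 0 → 0 < z) : ∀ᶠ ε in 𝓝[>] (0 : ℝ), 0 ≤ z + ε * u ∧ z + ε * u ≤ 1 := by
  have hc : Tendsto (fun ε : ℝ => z + ε * u) (𝓝[>] 0) (𝓝 z) := by
    have : Continuous fun ε : ℝ => z + ε * u := by fun_prop
    simpa using (this.tendsto 0).mono_left nhdsWithin_le_nhds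
  have hpos : ∀ᶠ ε in 𝓝[>] (0 : ℝ), 0 < ε := eventually_mem_nhdsWithin
  refine Eventually.and ?_ ?_
  · rcases le_or_gt 0 u with h | h
    · filter_upwards [hpos] with ε hε
      positivity
    · filter_upwards [hc.eventually (lt_mem_nhds (hu' h))] with ε hε using hε.le
  · rcases le_or_gt u 0 with h | h
    · filter_upwards [hpos] with ε hε
      nlinarith
    · filter_upwards [hc.eventually (gt_mem_nhds (hu h))] with ε hε using hε.le

theorem exists_between_finite {A B : Set ℝ} (hA : A.Finite) (hB : B.Finite)
    (h : ∀ a ∈ A, ∀ b ∈ B, a ≤ b) : ∃ x, (∀ a ∈ A, a ≤ x) ∧ ∀ b ∈ B, x ≤ b := by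
  rcases A.eq_empty_or_nonempty with rfl | hA'
  · rcases B.eq_empty_or_nonempty with rfl | hB'
    · exact ⟨0, by simp, by simp⟩
    · obtain ⟨x, -, hx⟩ := Set.exists_min_image B id hB hB'
      exact ⟨x, by simp, hx⟩
  · obtain ⟨x, hxA, hx⟩ := Set.exists_max_image A id hA hA'
    exact ⟨x, hx, h x hxA⟩

/-- Farkas' lemma for one variable. -/
theorem exists_multiplier {ι : Type} {W : Set ι} (hW : W.Finite) (π a : ι → ℝ)
    (h : ∀ v ∈ W, ∀ w ∈ W, ∀ s t : ℝ, 0 ≤ s → 0 ≤ t → s * a v + t * a w = 0 →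
      s * π v + t * π w ≤ 0) : ∃ x, ∀ w ∈ W, π w ≤ x * a w := by
  obtain ⟨x, hx1, hx2⟩ := exists_between_finite
    (A := (fun w => π w / a w) '' {w ∈ W | 0 < a w}) (B := (fun w => π w / a w) '' {w ∈ W | a w < 0})
    ((hW.subset (Set.sep_subset _ _)).image _) ((hW.subset (Set.sep_subset _ _)).image _) (by
      rintro _ ⟨v, ⟨hv, hav⟩, rfl⟩ _ ⟨w, ⟨hw, haw⟩, rfl⟩
      have := h v hv w hw (-a w) (a v) (neg_pos.2 haw).le hav.le (by ring)
      simp only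
      rw [div_le_iff₀ hav, div_mul_eq_mul_div, le_div_iff_of_neg haw]
      linarith)
  refine ⟨x, fun w hw => ?_⟩
  rcases lt_trichotomy (a w) 0 with haw | haw | haw
  · exact (le_div_iff_of_neg haw).1 (hx2 _ ⟨w, ⟨hw, haw⟩, rfl⟩)
  · have := h w hw w hw 1 0 zero_le_one le_rfl (by simp [haw])
    rw [haw]
    linarith
  · exact (div_le_iff₀ haw).1 (hx1 _ ⟨w, ⟨hw, haw⟩, rfl⟩)

section
variable {α : Type}

theorem dot_single [DecidableEq α] (c : α → ℝ) {l : List α} (hl : l.Nodup) {i : α} (hi : i ∈ l) :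
    dot c (Pi.single i 1) l = c i := by
  induction l with
  | nil => cases hi
  | cons j l ih =>
    obtain ⟨hj, hl⟩ := List.nodup_cons.1 hl
    rw [dot_cons]
    rcases List.mem_cons.1 hi with rfl | hi
    · have : dot c (Pi.single i 1) l = 0 := by
        refine List.sum_eq_zero fun x hx => ?_
        obtain ⟨k, hk, rfl⟩ := List.mem_map.1 hx
        have : k ≠ i := fun h => hj (h ▸ hk)
        simp [this]
      simp [this]
    · have : j ≠ i := fun h => hj (h ▸ hi)
      simp [this, ih hl hi]

theorem continuous_dot (c : α → ℝ) (l : List α) : Continuous fun z : α → ℝ => dot c z l := by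
  induction l with
  | nil => simpa using continuous_const
  | cons i l ih =>
    simp only [dot_cons]
    fun_prop

/-- The feasible set is a closed subset of a product of compact intervals, and the objective is
continuous. -/
theorem exists_optimal (p a : α → ℝ) (l : List α) {r₁ r₂ : ℝ}
    (h : ∃ z : α → ℝ, Box z ∧ dot a z l = r₁ ∧ dot (fun _ => 1) z l = r₂) :
    ∃ z : α → ℝ, (Box z ∧ dot a z l = r₁ ∧ dot (fun _ => 1) z l = r₂) ∧
      ∀ y : α → ℝ, Box y → dot a y l = r₁ → dot (fun _ => 1) y l = r₂ → dot p y l ≤ dot p z l := by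
  have hbox : IsCompact {z : α → ℝ | Box z} := by
    have := isCompact_univ_pi fun _ : α => isCompact_Icc (a := (0 : ℝ)) (b := 1)
    convert this using 1
    ext z
    simp only [Box, Set.mem_pi, Set.mem_univ, true_imp_iff, Set.mem_Icc, Set.mem_ofPred_eq]
  have hK : IsCompact ({z : α → ℝ | Box z} ∩
      ({z | dot a z l = r₁} ∩ {z | dot (fun _ => 1) z l = r₂})) :=
    hbox.inter_right ((isClosed_eq (continuous_dot _ _) continuous_const).inter
      (isClosed_eq (continuous_dot _ _) continuous_const))
  obtain ⟨z, hz, hmax⟩ := hK.exists_isMaxOn h (continuous_dot p l).continuousOn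
  exact ⟨z, hz, fun y h1 h2 h3 => hmax ⟨h1, h2, h3⟩⟩

/-- Exchanging small amounts between two pairs of variables does not improve an optimal solution. -/
theorem exchange_le (p a : α → ℝ) {l : List α} (hl : l.Nodup) {z : α → ℝ} (hz : Box z)
    (hmax : ∀ y : α → ℝ, Box y → dot a y l = dot a z l →
      dot (fun _ => 1) y l = dot (fun _ => 1) z l → dot p y l ≤ dot p z l)
    {i j k m : α} (hi : i ∈ l) (hj : j ∈ l) (hk : k ∈ l) (hm : m ∈ l) (hzi : z i < 1) (hzj : 0 < z j)
    (hzk : z k < 1) (hzm : 0 < z m) {s t : ℝ} (hs : 0 ≤ s) (ht : 0 ≤ t)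
    (h : s * (a i - a j) + t * (a k - a m) = 0) : s * (p i - p j) + t * (p k - p m) ≤ 0 := by
  classical
  -- The direction `u` preserves the sum of the values, and by `h` also the form `a`; it raises only
  -- variables below 1 and lowers only positive ones.
  set u : α → ℝ := fun v => s * ((Pi.single i 1 : α → ℝ) v - (Pi.single j 1 : α → ℝ) v) +
    t * ((Pi.single k 1 : α → ℝ) v - (Pi.single m 1 : α → ℝ) v) with hu
  have hdot : ∀ c : α → ℝ, dot c u l = s * (c i - c j) + t * (c k - c m) := by
    intro c
    have h1 : u = fun v => 1 * (s * (Pi.single i 1 : α → ℝ) v + (-s) * (Pi.single j 1 : α → ℝ) v) +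
        1 * (t * (Pi.single k 1 : α → ℝ) v + (-t) * (Pi.single m 1 : α → ℝ) v) := by
      funext v; simp only [hu]; ring
    rw [h1, dot_combination, dot_combination, dot_combination, dot_single c hl hi,
      dot_single c hl hj, dot_single c hl hk, dot_single c hl hm]
    ring
  have h01 : ∀ v w : α, 0 ≤ (Pi.single v 1 : α → ℝ) w := fun v w => by
    by_cases h : w = v
    · subst h; simp
    · simp [h]
  have hpos : ∀ v, 0 < u v → z v < 1 := by
    intro v hv
    by_cases h1 : v = i
    · rwa [h1]
    by_cases h2 : v = k
    · rwa [h2]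
    simp only [hu, Pi.single_eq_of_ne h1, Pi.single_eq_of_ne h2] at hv
    nlinarith [mul_nonneg hs (h01 j v), mul_nonneg ht (h01 m v)]
  have hneg : ∀ v, u v < 0 → 0 < z v := by
    intro v hv
    by_cases h1 : v = j
    · rwa [h1]
    by_cases h2 : v = m
    · rwa [h2]
    simp only [hu, Pi.single_eq_of_ne h1, Pi.single_eq_of_ne h2] at hv
    nlinarith [mul_nonneg hs (h01 i v), mul_nonneg ht (h01 k v)]
  have hev : ∀ᶠ ε in nhdsWithin (0 : ℝ) (Set.Ioi 0), 0 < ε ∧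
      ∀ v ∈ ({i, j, k, m} : Finset α), 0 ≤ z v + ε * u v ∧ z v + ε * u v ≤ 1 :=
    (eventually_mem_nhdsWithin).and ((Filter.eventually_all_finset _).2 fun v _ =>
      eventually_mem_box (hz v).1 (hz v).2 (hpos v) (hneg v))
  obtain ⟨ε, hε, hbox⟩ := hev.exists
  have hy := hmax (fun v => 1 * z v + ε * u v) (fun v => ?_) (by
    rw [dot_combination, hdot, h]; ring) (by rw [dot_combination, hdot]; ring)
  · rw [dot_combination, hdot] at hy
    by_contra hc
    nlinarith [mul_pos hε (not_le.1 hc)]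
  · simp only [one_mul]
    by_cases hv : v ∈ ({i, j, k, m} : Finset α)
    · exact hbox v hv
    · simp only [Finset.mem_insert, Finset.mem_singleton, not_or] at hv
      have : u v = 0 := by
        simp [hu, hv.1, hv.2.1, hv.2.2.1, hv.2.2.2]
      rw [this, mul_zero, add_zero]
      exact hz v

/-- A feasible linear program with two equality constraints has a solution with multipliers. -/
theorem exists_dual (p a : α → ℝ) {l : List α} (hl : l.Nodup) {r₁ r₂ : ℝ}
    (h : ∃ z : α → ℝ, Box z ∧ dot a z l = r₁ ∧ dot (fun _ => 1) z l = r₂) :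
    ∃ (z : α → ℝ) (x y : ℝ), Box z ∧ dot a z l = r₁ ∧ dot (fun _ => 1) z l = r₂ ∧
      Slack (fun i => p i - x * a i - y) z l := by
  obtain ⟨z, ⟨hz, h1, h2⟩, hmax⟩ := exists_optimal p a l h
  have hfin : {i | i ∈ l}.Finite := l.finite_toSet
  -- `U` collects the variables that can be raised, `L` those that can be lowered. Exchanges between
  -- them preserve the second constraint, so Farkas' lemma in one variable gives `x`; then `y`
  -- separates the reduced profits `p - x * a` on `U` from those on `L`.
  set U := {i | i ∈ l ∧ z i < 1} with hU
  set L := {i | i ∈ l ∧ 0 < z i} with hL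
  have hUf : U.Finite := hfin.subset fun i hi => hi.1
  have hLf : L.Finite := hfin.subset fun i hi => hi.1
  obtain ⟨x, hx⟩ := exists_multiplier (W := U ×ˢ L) (hUf.prod hLf) (fun w => p w.1 - p w.2)
    (fun w => a w.1 - a w.2) (by
      rintro ⟨i, j⟩ ⟨hi, hj⟩ ⟨k, m⟩ ⟨hk, hm⟩ s t hs ht h0
      exact exchange_le p a hl hz (fun y hy e1 e2 => hmax y hy (e1.trans h1) (e2.trans h2))
        hi.1 hj.1 hk.1 hm.1 hi.2 hj.2 hk.2 hm.2 hs ht h0)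
  obtain ⟨y, hy1, hy2⟩ := exists_between_finite (hUf.image fun i => p i - x * a i)
    (hLf.image fun i => p i - x * a i) (by
      rintro _ ⟨i, hi, rfl⟩ _ ⟨j, hj, rfl⟩
      have := hx (i, j) ⟨hi, hj⟩
      simp only at this ⊢
      linarith)
  refine ⟨z, x, y, hz, h1, h2, fun i hi => ⟨fun h => ?_, fun h => ?_⟩⟩
  · by_contra hne
    have := hy1 _ ⟨i, ⟨hi, lt_of_le_of_ne (hz i).2 hne⟩, rfl⟩
    simp only at this h
    linarith
  · by_contra hne
    have := hy2 _ ⟨i, ⟨hi, lt_of_le_of_ne (hz i).1 (Ne.symm hne)⟩, rfl⟩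
    simp only at this h
    linarith

end

/-! ## Linear programs with two equality constraints -/

section
variable {α : Type}

theorem dot_filter {R : Type} [CommRing R] (c z : α → R) (P : α → Prop) [DecidablePred P]
    (l : List α) :
    dot c z l = dot c z (l.filter fun i => P i) + dot c z (l.filter fun i => ¬ P i) := by
  induction l with
  | nil => simp
  | cons i l ih => by_cases h : P i <;> simp [h, ih] <;> ring

theorem dot_const {R : Type} [CommRing R] (c z : α → R) (v : R) {l : List α} (h : ∀ i ∈ l, z i = v) :
    dot c z l = v * (l.map c).sum := by
  induction l with
  | nil => simp
  | cons i l ih =>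
    rw [dot_cons, h i List.mem_cons_self, ih fun j hj => h j (List.mem_cons_of_mem _ hj)]
    simp only [List.map_cons, List.sum_cons]
    ring

/-- The answer to the linear program with the constraints `∑ a z = r₁` and `∑ z = r₂`. -/
def Answer (a p : α → ℚ) (r₁ r₂ : ℚ) (l : List α) (out : Val) : Prop :=
  (out = .nil ∧ ∀ z : α → ℝ, Box z → dot (fun i => (a i : ℝ)) z l = r₁ →
    dot (fun _ => 1) z l = r₂ → False) ∨
  ∃ φ : α → ℚ, out = .pair (encL φ l) (.pair .nil .nil) ∧ Box φ ∧ dot a φ l = r₁ ∧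
    dot (fun _ => 1) φ l = r₂ ∧ ∀ z : α → ℝ, Box z → dot (fun i => (a i : ℝ)) z l = r₁ →
      dot (fun _ => 1) z l = r₂ →
        dot (fun i => (p i : ℝ)) z l ≤ dot (fun i => (p i : ℝ)) (fun i => (φ i : ℝ)) l

theorem Answer.of_shear {a p : α → ℚ} {r₁ r₂ s : ℚ} {l : List α} {out : Val}
    (h : Answer (fun i => a i - s) p (r₁ - s * r₂) r₂ l out) : Answer a p r₁ r₂ l out := by
  have key : ∀ z : α → ℝ, dot (fun i => (a i : ℝ)) z l = r₁ → dot (fun _ => 1) z l = r₂ →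
      dot (fun i => ((a i - s : ℚ) : ℝ)) z l = ((r₁ - s * r₂ : ℚ) : ℝ) := by
    intro z h1 h2
    have := dot_smul (s : ℝ) (fun _ => 1) z l
    simp only [mul_one] at this
    push_cast
    rw [dot_sub, this, h1, h2]
  rcases h with ⟨h, hinf⟩ | ⟨φ, h, hbox, h1, h2, hopt⟩
  · exact .inl ⟨h, fun z hz h1 h2 => hinf z hz (key z h1 h2) h2⟩
  · refine .inr ⟨φ, h, hbox, ?_, h2, fun z hz h1 h2 => hopt z hz (key z h1 h2) h2⟩
    have := dot_smul s (fun _ => 1) φ l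
    simp only [mul_one] at this
    rw [dot_sub, this, h2] at h1
    linarith

/-- The multiplier of the first constraint lies strictly on the side `σ` of `lam`. -/
def SideV (a p : α → ℚ) (r₁ r₂ : ℚ) (l : List α) (σ lam : ℚ) : Prop :=
  ∀ (z : α → ℝ) (x y : ℝ), Box z → dot (fun i => (a i : ℝ)) z l = r₁ → dot (fun _ => 1) z l = r₂ →
    Slack (fun i => (p i : ℝ) - x * a i - y) z l → 0 < σ * (x - lam)

/-- The multiplier of the second constraint lies strictly on the side `ρ` of `ν`. -/
def SideH (a p : α → ℚ) (r₁ r₂ : ℚ) (l : List α) (ρ ν : ℚ) : Prop :=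
  ∀ (z : α → ℝ) (x y : ℝ), Box z → dot (fun i => (a i : ℝ)) z l = r₁ → dot (fun _ => 1) z l = r₂ →
    Slack (fun i => (p i : ℝ) - x * a i - y) z l → 0 < ρ * (y - ν)

/-- The result of the test of a line is passed on if it is not a sign. -/
def Final (v : Val) : Prop := v = .nil ∨ ∃ x y z, v = .pair x (.pair y z)

/-- Moving `lam * a` into the profits replaces the multipliers `(x, y)` by `(x - lam, y)`. A
solution of the relaxation that also meets the constraint on `a` is optimal for `p`, since `lam * a`
contributes a constant. -/
theorem TestOutcome.vertical {a p : α → ℚ} {r₁ r₂ lam : ℚ} {l : List α} {out : Val}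
    (h : TestOutcome (fun i => p i - lam * a i) (fun _ => 1) a r₂ r₁ l out) :
    (Answer a p r₁ r₂ l out ∧ Final out) ∨
      ∃ ε : ℚ, (ε = 1 ∨ ε = -1) ∧ out = .pair (.num ε) .nil ∧ SideV a p r₁ r₂ l (0 - ε) lam := by
  rcases h with ⟨h, hinf⟩ | ⟨ε, hε, h, hs⟩ | ⟨φ, h, hbox, h1, h2, hopt⟩
  · exact .inl ⟨.inl ⟨h, fun z hz _ h2 => hinf z hz (by simpa using h2)⟩, .inl h⟩
  · refine .inr ⟨ε, hε, h, fun z x y hz h1 h2 hsl => ?_⟩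
    have := hs z y (x - lam) hz (by convert hsl using 2; push_cast; ring) (by simpa using h2) h1
    push_cast
    linarith
  · refine .inl ⟨.inr ⟨φ, h, hbox, h2, h1, fun z hz h3 h4 => ?_⟩, .inr ⟨_, _, _, h⟩⟩
    have := hopt z hz (by simpa using h4)
    have h5 := congrArg (Rat.cast (K := ℝ)) h2
    rw [dot_cast] at h5
    push_cast at this
    rw [dot_sub, dot_sub, dot_smul, dot_smul, h3, h5] at this
    linarith

theorem TestOutcome.horizontal {a p : α → ℚ} {r₁ r₂ ν : ℚ} {l : List α} {out : Val}
    (h : TestOutcome (fun i => p i - ν) a (fun _ => 1) r₁ r₂ l out) :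
    (Answer a p r₁ r₂ l out ∧ Final out) ∨
      ∃ ε : ℚ, (ε = 1 ∨ ε = -1) ∧ out = .pair (.num ε) .nil ∧ SideH a p r₁ r₂ l (0 - ε) ν := by
  rcases h with ⟨h, hinf⟩ | ⟨ε, hε, h, hs⟩ | ⟨φ, h, hbox, h1, h2, hopt⟩
  · exact .inl ⟨.inl ⟨h, fun z hz h1 _ => hinf z hz h1⟩, .inl h⟩
  · refine .inr ⟨ε, hε, h, fun z x y hz h1 h2 hsl => ?_⟩
    have := hs z x (y - ν) hz (by convert hsl using 2; push_cast; ring) h1 (by simpa using h2)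
    push_cast
    linarith
  · refine .inl ⟨.inr ⟨φ, h, hbox, h1, h2, fun z hz h3 h4 => ?_⟩, .inr ⟨_, _, _, h⟩⟩
    have := hopt z hz h3
    have h5 := congrArg (Rat.cast (K := ℝ)) h2
    rw [dot_cast] at h5
    have h6 : ∀ z : α → ℝ, dot (fun _ => (ν : ℝ)) z l = ν * dot (fun _ => 1) z l := fun z => by
      simpa using dot_smul (ν : ℝ) (fun _ => 1) z l
    push_cast at this h5
    rw [dot_sub, dot_sub, h6, h6, h4, h5] at this
    linarith

/-- The determined variables have the same value in all solutions. -/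
theorem Pruned.eq {a p : α → ℚ} {l : List α} {σ ρ lam ν : ℚ} (hσ : σ = 1 ∨ σ = -1)
    (hρ : ρ = 1 ∨ ρ = -1) {z : α → ℝ} {x y : ℝ} (hx : (0 : ℝ) < σ * (x - lam))
    (hy : (0 : ℝ) < ρ * (y - ν)) (hs : Slack (fun i => (p i : ℝ) - x * a i - y) z l) {i : α}
    (hi : i ∈ l) (h : Pruned σ ρ lam ν (a i) (p i)) : z i = ((1 - ρ) / 2 : ℚ) := by
  obtain ⟨h1, h2⟩ := h
  have h1' : (0 : ℝ) ≤ ρ * σ * a i := by exact_mod_cast h1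
  have h2' : (ρ : ℝ) * (p i - lam * a i - ν) ≤ 0 := by exact_mod_cast h2
  obtain ⟨h3, h4⟩ := hs i hi
  rcases hσ with rfl | rfl <;> rcases hρ with rfl | rfl <;> push_cast at *
  · rw [h4 (by nlinarith)]; norm_num
  · rw [h3 (by nlinarith)]; norm_num
  · rw [h4 (by nlinarith)]; norm_num
  · rw [h3 (by nlinarith)]; norm_num

/-- A feasible point may not have the determined values, but by `exists_dual` it can be replaced by
one that has multipliers and no smaller profit. Such a point has these values and restricts to a
feasible point of the smaller program, so infeasibility and optimality carry over. -/
theorem Answer.of_pruned {a p : α → ℚ} {r₁ r₂ σ ρ lam ν : ℚ} {l : List α} (hl : l.Nodup)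
    (hσ : σ = 1 ∨ σ = -1) (hρ : ρ = 1 ∨ ρ = -1) (hV : SideV a p r₁ r₂ l σ lam)
    (hH : SideH a p r₁ r₂ l ρ ν) {out : Val}
    (h : Answer a p
      (r₁ - (1 - ρ) / 2 * ((l.filter fun i => Pruned σ ρ lam ν (a i) (p i)).map a).sum)
      (r₂ - (1 - ρ) / 2 * ((l.filter fun i => Pruned σ ρ lam ν (a i) (p i)).map fun _ => (1 : ℚ)).sum)
      (l.filter fun i => ¬ Pruned σ ρ lam ν (a i) (p i)) out) :
    (out = .nil ∧ Answer a p r₁ r₂ l .nil) ∨ ∃ φ : α → ℚ,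
      out = .pair (encL φ (l.filter fun i => ¬ Pruned σ ρ lam ν (a i) (p i))) (.pair .nil .nil) ∧
      Answer a p r₁ r₂ l (.pair (encL (fun i => if Pruned σ ρ lam ν (a i) (p i) then (1 - ρ) / 2
        else φ i) l) (.pair .nil .nil)) := by
  set v : ℚ := (1 - ρ) / 2 with hv
  set D := l.filter fun i => Pruned σ ρ lam ν (a i) (p i) with hD
  set L := l.filter fun i => ¬ Pruned σ ρ lam ν (a i) (p i) with hL
  have hsplit : ∀ (c : α → ℚ) (z : α → ℝ), (∀ i ∈ D, z i = v) →
      dot (fun i => (c i : ℝ)) z l = v * ((D.map c).sum : ℚ) + dot (fun i => (c i : ℝ)) z L := by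
    intro c z hz
    rw [dot_filter _ _ (fun i => Pruned σ ρ lam ν (a i) (p i)), dot_const _ _ _ hz,
      Rat.cast_list_sum, List.map_map]
    rfl
  have hdual : ∀ z : α → ℝ, Box z → dot (fun i => (a i : ℝ)) z l = r₁ → dot (fun _ => 1) z l = r₂ →
      ∃ (z' : α → ℝ), Box z' ∧ (dot (fun i => (p i : ℝ)) z l ≤ dot (fun i => (p i : ℝ)) z' l) ∧
        (∀ i ∈ D, z' i = v) ∧
        dot (fun i => (a i : ℝ)) z' L = ((r₁ - v * (D.map a).sum : ℚ) : ℝ) ∧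
        dot (fun _ => 1) z' L = ((r₂ - v * (D.map fun _ => (1 : ℚ)).sum : ℚ) : ℝ) := by
    intro z hz h1 h2
    obtain ⟨z', x, y, hz', h1', h2', hs⟩ := exists_dual (fun i => (p i : ℝ)) (fun i => (a i : ℝ)) hl
      ⟨z, hz, h1, h2⟩
    have hfix : ∀ i ∈ D, z' i = v := fun i hi => by
      have hi := List.mem_filter.1 hi
      exact Pruned.eq hσ hρ (hV z' x y hz' h1' h2' hs) (hH z' x y hz' h1' h2' hs) hs hi.1
        (by simpa using hi.2)
    refine ⟨z', hz', ?_, hfix, ?_, ?_⟩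
    · have := hs.dot_le hz
      have h6 : ∀ z : α → ℝ, dot (fun _ => y) z l = y * dot (fun _ => 1) z l := fun z => by
        simpa using dot_smul y (fun _ => 1) z l
      rw [dot_sub, dot_sub, dot_sub, dot_sub, dot_smul, dot_smul, h6, h6, h1, h1', h2, h2'] at this
      linarith
    · have := hsplit a z' hfix
      rw [h1'] at this
      push_cast at this ⊢
      linarith
    · have := hsplit (fun _ => 1) z' hfix
      push_cast at this ⊢
      rw [h2'] at this
      linarith
  rcases h with ⟨h, hinf⟩ | ⟨φ, h, hbox, h1, h2, hopt⟩
  · refine .inl ⟨h, .inl ⟨rfl, fun z hz h1 h2 => ?_⟩⟩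
    obtain ⟨z', hz', -, -, h3, h4⟩ := hdual z hz h1 h2
    exact hinf z' hz' h3 h4
  · refine .inr ⟨φ, h, .inr ⟨_, rfl, ?_, ?_, ?_, ?_⟩⟩
    · intro i
      simp only
      split_ifs
      · rcases hρ with rfl | rfl <;> norm_num [hv]
      · exact hbox i
    all_goals
      set ψ : α → ℚ := fun i => if Pruned σ ρ lam ν (a i) (p i) then v else φ i with hψ
      have hψD : ∀ i ∈ D, ψ i = v := fun i hi =>
        if_pos (by simpa using (List.mem_filter.1 hi).2)
      have hψL : ∀ i ∈ L, ψ i = φ i := fun i hi =>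
        if_neg (by simpa using (List.mem_filter.1 hi).2)
      have hψsplit : ∀ c : α → ℚ, dot c ψ l = v * (D.map c).sum + dot c φ L := fun c => by
        rw [dot_filter _ _ (fun i => Pruned σ ρ lam ν (a i) (p i)), dot_const _ _ _ hψD,
          dot_congr fun i hi => by rw [hψL i hi]]
    · rw [hψsplit, h1]; ring
    · rw [hψsplit, h2]; ring
    · intro z hz h3 h4
      obtain ⟨z', hz', hle, hfix, h5, h6⟩ := hdual z hz h3 h4
      refine hle.trans ?_
      have h7 := hopt z' hz' h5 h6
      rw [hsplit p z' hfix, hsplit p (fun i => (ψ i : ℝ)) fun i hi => by rw [hψD i hi]]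
      rw [dot_congr (l := L) (z := fun i => (ψ i : ℝ)) (z' := fun i => (φ i : ℝ))
        fun i hi => by rw [hψL i hi]]
      linarith

/-! ### The number of determined variables -/

/-- The crossing of the lines of the items `i` and `j`. -/
def crossing (a p : α → ℚ) (i j : α) : ℚ × ℚ :=
  (if a j ≤ a i then 0 else (p j - p i) / (a j - a i),
    p i - (if a j ≤ a i then 0 else (p j - p i) / (a j - a i)) * a i)

/-- The crossing lies in the closed quadrant opposite to that of the multipliers. Of the two slopes
of opposite sign, the one with `0 ≤ ρ * σ * a` belongs to a line that, passing through the crossing,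
stays on one side of the corner and avoids the open quadrant. -/
theorem pruned_of_crossing {a p : α → ℚ} {σ ρ lam ν : ℚ} (hσ : σ = 1 ∨ σ = -1)
    (hρ : ρ = 1 ∨ ρ = -1) {i j : α} (hi : a i ≤ 0) (hj : 0 ≤ a j)
    (h1 : σ * (crossing a p i j).1 ≤ σ * lam) (h2 : ρ * (crossing a p i j).2 ≤ ρ * ν) :
    Pruned σ ρ lam ν (a i) (p i) ∨ Pruned σ ρ lam ν (a j) (p j) := by
  simp only [Pruned]
  by_cases h : a j ≤ a i
  -- Both coefficients vanish here. The default abscissa 0 is irrelevant: the line of `i` is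
  -- horizontal, and its ordinate alone determines the variable.
  · have hi0 : a i = 0 := le_antisymm hi (hj.trans h)
    simp only [crossing, if_pos h, zero_mul, sub_zero] at h2
    left
    rw [hi0]
    constructor
    · simp
    · linarith
  · simp only [crossing, if_neg h] at h1 h2
    set t := (p j - p i) / (a j - a i) with ht
    have hpos : 0 < a j - a i := sub_pos.2 (not_le.1 h)
    have he : p i - t * a i = p j - t * a j := by
      have := div_mul_cancel₀ (p j - p i) hpos.ne'
      rw [← ht] at this
      linarith
    rcases hσ with rfl | rfl <;> rcases hρ with rfl | rfl
    · right; constructor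
      · linarith
      · nlinarith
    · left; constructor
      · linarith
      · nlinarith
    · left; constructor
      · linarith
      · nlinarith
    · right; constructor
      · linarith
      · nlinarith

theorem length_filter_zipWith {β : Type} (f : α → α → β) (Q : β → Prop) (R : α → Prop)
    [DecidablePred Q] [DecidablePred R] :
    ∀ A B : List α, (∀ i ∈ A, ∀ j ∈ B, Q (f i j) → R i ∨ R j) →
      ((List.zipWith f A B).filter fun x => Q x).length ≤
        (A.filter fun i => R i).length + (B.filter fun i => R i).length
  | [], _, _ => by simp
  | _ :: _, [], _ => by simp
  | i :: A, j :: B, h => by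
    have ih := length_filter_zipWith f Q R A B fun i hi j hj =>
      h i (List.mem_cons_of_mem _ hi) j (List.mem_cons_of_mem _ hj)
    have hij := h i List.mem_cons_self j List.mem_cons_self
    simp only [List.zipWith_cons_cons, List.filter_cons]
    by_cases hQ : Q (f i j) <;> by_cases hi : R i <;> by_cases hj : R j <;>
      simp [hQ, hi, hj] <;> first | omega | (exfalso; tauto)

/-- At most half of the keys are above `τ`, and at least half are `≥ τ`. -/
def IsMedian (k : α → ℚ) (l : List α) (τ : ℚ) : Prop :=
  2 * (l.filter fun i => τ < k i).length ≤ l.length ∧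
    l.length ≤ 2 * (l.filter fun i => τ ≤ k i).length

theorem IsMedian.length_le {k : α → ℚ} {l : List α} {τ σ : ℚ} (h : IsMedian k l τ)
    (hσ : σ = 1 ∨ σ = -1) : l.length ≤ 2 * (l.filter fun i => σ * k i ≤ σ * τ).length := by
  obtain ⟨h1, h2⟩ := h
  rcases hσ with rfl | rfl
  · have := count_split (fun i => τ < k i) l
    simp only [not_lt] at this
    simp only [one_mul]
    omega
  · simpa using h2

/-- Four factors of two: there are at least half as many pairs as items, half of the crossings lie
on the wrong side of `lam`, half of these on the wrong side of `ν`, and an item may be counted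
twice, as zero keys occur in both lists. -/
theorem length_le_pruned {a p : α → ℚ} {l : List α} {σ ρ lam ν : ℚ} (ha : IsMedian a l 0)
    (hσ : σ = 1 ∨ σ = -1) (hρ : ρ = 1 ∨ ρ = -1) {X : List (ℚ × ℚ)}
    (hX : X = List.zipWith (crossing a p) (l.filter fun i => a i ≤ 0) (l.filter fun i => 0 ≤ a i))
    (hlam : IsMedian Prod.fst X lam)
    (hν : IsMedian Prod.snd (X.filter fun x => σ * x.1 ≤ σ * lam) ν) :
    l.length ≤ 16 * (l.filter fun i => Pruned σ ρ lam ν (a i) (p i)).length := by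
  have h1 := ha.length_le (.inl rfl)
  have h2 := ha.2
  have h3 := hlam.length_le hσ
  have h4 := hν.length_le hρ
  rw [List.filter_filter] at h4
  have h5 := length_filter_zipWith (crossing a p) (fun x => ρ * x.2 ≤ ρ * ν ∧ σ * x.1 ≤ σ * lam)
    (fun i => Pruned σ ρ lam ν (a i) (p i)) (l.filter fun i => a i ≤ 0) (l.filter fun i => 0 ≤ a i)
    fun i hi j hj h => pruned_of_crossing hσ hρ (by simpa using (List.mem_filter.1 hi).2)
      (by simpa using (List.mem_filter.1 hj).2) h.2 h.1
  rw [← hX] at h5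
  simp only [Bool.decide_and] at h5
  have h6 : ∀ q : α → Bool, ((l.filter q).filter fun i => Pruned σ ρ lam ν (a i) (p i)).length ≤
      (l.filter fun i => Pruned σ ρ lam ν (a i) (p i)).length := fun q =>
    (List.filter_sublist.filter _).length_le
  have h7 := h6 fun i => a i ≤ 0
  have h8 := h6 fun i => 0 ≤ a i
  have h9 : X.length = min (l.filter fun i => a i ≤ 0).length (l.filter fun i => 0 ≤ a i).length := by
    rw [hX, List.length_zipWith]
  simp only [one_mul, mul_zero] at h1
  omega

/-! ### Running time of the prune-and-search. -/

variable (e : Expr)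

theorem median_comp : ∃ K, ∀ {α : Type} (k c : α → ℚ) (l : List α), l ≠ [] →
    ∃ τ, Comp (prog e) fMedian (Val.ofList (l.map (enc2 k c))) (.num τ) (K * (l.length + 1)) ∧
      IsMedian k l τ := by
  obtain ⟨Kl, hl⟩ := len_comp e
  obtain ⟨Ku, hu⟩ := unit_comp e
  obtain ⟨Kw, hw⟩ := wsel_comp e
  refine ⟨Kl + Ku + Kw + 50, fun k c l hne => ?_⟩
  obtain ⟨τ, hτ, -, h1, h2⟩ := hw l.length k (fun _ => 1) l le_rfl (l.length / 2) hne
    (by positivity) (by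
      rw [sum_ones]
      have : (0 : ℚ) ≤ l.length := by positivity
      linarith)
  simp only [gtSum, geSum, sum_ones] at h1 h2
  refine ⟨τ, ⟨_, rfl, (Runs.letCall rfl (hl (enc2 k c) l) <| Runs.letCall rfl (hu k c l) <|
    Runs.call ?_ hτ).mono ?_⟩, ?_, ?_⟩
  · simp [den, divE, ArithOp.apply]
  · simp only [size, divE]
    nlinarith
  · have : (2 : ℚ) * (l.filter fun i => τ < k i).length ≤ l.length := by linarith
    exact_mod_cast this
  · have : (l.length : ℚ) ≤ 2 * (l.filter fun i => τ ≤ k i).length := by linarith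
    exact_mod_cast this

theorem cross_comp : ∃ K, ∀ {α : Type} (a p : α → ℚ) (A B : List α), (∀ i ∈ A, a i ≤ 0) →
    (∀ j ∈ B, 0 ≤ a j) → Comp (prog e) fCross
      (.pair (Val.ofList (A.map (enc2 a p))) (Val.ofList (B.map (enc2 a p))))
      (Val.ofList ((List.zipWith (crossing a p) A B).map (enc2 Prod.fst Prod.snd)))
      (K * (A.length + 1)) := by
  refine ⟨200, fun a p A => ?_⟩
  induction A with
  | nil =>
    intro B _ _
    refine ⟨_, rfl, (Runs.casePair rfl <| Runs.caseNil rfl <| Runs.of_den rfl).mono ?_⟩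
    simp only [size]; omega
  | cons i A ih =>
    intro B hA hB
    cases B with
    | nil =>
      refine ⟨_, rfl, (Runs.casePair rfl <| Runs.casePair rfl <| Runs.caseNil rfl <|
        Runs.of_den rfl).mono ?_⟩
      simp only [size]; omega
    | cons j B =>
      have ih := ih B (fun i hi => hA i (List.mem_cons_of_mem _ hi))
        fun i hi => hB i (List.mem_cons_of_mem _ hi)
      refine ⟨_, rfl, (Runs.casePair rfl <| Runs.casePair rfl <| Runs.casePair rfl <|
        Runs.letCall rfl ih <| Runs.of_den ?_).mono ?_⟩
      · simp only [den, lamE, fstE, sndE, subE, divE, mulE, enc2, List.getElem?_cons_succ,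
          List.getElem?_cons_zero, ArithOp.apply, List.zipWith_cons_cons, List.map_cons, Val.ofList,
          crossing]
        by_cases h : a j ≤ a i
        · simp [h]
        · simp [h, (sub_pos.2 (not_le.1 h)).ne']
      · simp only [size, lamE, fstE, sndE, subE, divE, mulE, List.length_cons]; omega

/-- Counterpart of `den_pruneE` for branches that make calls, as in the merging of the determined
values. -/
theorem Runs.pruneE {P : Program} {env : List Val} {X h y n : Expr} {σ ρ lam ν a p : ℚ} {v : Val}
    {T : ℕ} (hX : den env X = some (encX σ ρ lam ν))
    (hh : den env h = some (.pair (.num a) (.num p)))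
    (hy : Pruned σ ρ lam ν a p → Runs P env y v T) (hn : ¬ Pruned σ ρ lam ν a p → Runs P env n v T) :
    Runs P env (pruneE X h y n) v (10 * (size X + size h) + 100 + T) := by
  have h1 := den_fst hX
  have h2 := den_fst (den_snd hX)
  have h3 := den_fst (den_snd (den_snd hX))
  have h4 := den_snd (den_snd (den_snd hX))
  have h5 := den_fst hh
  have h6 := den_snd hh
  have e1 : den env (mulE (mulE (fstE (sndE X)) (fstE X)) (fstE h)) = some (.num (ρ * σ * a)) := by
    simp [den, mulE, h1, h2, h5, ArithOp.apply]
  have e2 : den env (mulE (fstE (sndE X))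
      (subE (subE (sndE h) (mulE (fstE (sndE (sndE X))) (fstE h))) (sndE (sndE (sndE X))))) =
      some (.num (ρ * (p - lam * a - ν))) := by
    simp [den, mulE, subE, h2, h3, h4, h5, h6, ArithOp.apply]
  by_cases c1 : 0 ≤ ρ * σ * a
  · by_cases c2 : ρ * (p - lam * a - ν) ≤ 0
    · refine (Runs.ifTrue rfl e1 c1 (Runs.ifTrue e2 rfl c2 (hy ⟨c1, c2⟩))).mono ?_
      simp only [size, mulE, subE, fstE, sndE]; omega
    · refine (Runs.ifTrue rfl e1 c1 (Runs.ifFalse e2 rfl c2 (hn fun h => c2 h.2))).mono ?_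
      simp only [size, mulE, subE, fstE, sndE]; omega
  · refine (Runs.ifFalse rfl e1 c1 (hn fun h => c1 h.1)).mono ?_
    simp only [size, mulE, fstE, sndE]; omega

theorem merge_comp : ∃ K, ∀ {α : Type} (a p φ : α → ℚ) (σ ρ lam ν : ℚ) (l : List α),
    Comp (prog e) fMerge (.pair (encX σ ρ lam ν) (.pair (Val.ofList (l.map (enc2 a p)))
        (encL φ (l.filter fun i => ¬ Pruned σ ρ lam ν (a i) (p i)))))
      (encL (fun i => if Pruned σ ρ lam ν (a i) (p i) then (1 - ρ) / 2 else φ i) l)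
      (K * (l.length + 1)) := by
  refine ⟨300, fun a p φ σ ρ lam ν l => ?_⟩
  induction l with
  | nil =>
    refine ⟨_, rfl, (Runs.caseNil rfl <| Runs.of_den rfl).mono ?_⟩
    simp only [size, fstE, sndE]; omega
  | cons i l ih =>
    refine ⟨_, rfl, (Runs.casePair (x := enc2 a p i) (y := Val.ofList (l.map (enc2 a p))) rfl <|
      Runs.pruneE (σ := σ) (ρ := ρ) (lam := lam) (ν := ν) (a := a i) (p := p i)
        (T := 300 * (l.length + 1) + 60) rfl rfl (fun h => ?_) (fun h => ?_)).mono ?_⟩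
    · simp only [h, not_true, decide_false, Bool.false_eq_true, not_false_eq_true,
        List.filter_cons_of_neg]
      refine (Runs.letCall rfl ih <| Runs.of_den ?_).mono ?_
      · simp [den, fixedE, divE, subE, fstE, sndE, ArithOp.apply, encX, encL, Val.ofList, h]
      · simp only [size, fixedE, divE, subE, fstE, sndE]; omega
    · simp only [h, not_false_eq_true, decide_true, List.filter_cons_of_pos]
      refine (Runs.letCall rfl ih <| Runs.of_den ?_).mono ?_
      · simp [den, fstE, sndE, encL, Val.ofList, h]
      · simp only [size, fstE, sndE]; omega
    · simp only [size, fstE, sndE, List.length_cons]; omega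

theorem testV_comp : ∃ K, ∀ {α : Type} (a p : α → ℚ) (l : List α) (lam r₁ r₂ : ℚ),
    ∃ out, Comp (prog e) fTestV (.pair (.num lam) (.pair (.pair (.num r₂) (.num r₁))
        (Val.ofList (l.map (enc2 a p))))) out (K * (l.length + 1)) ∧
      TestOutcome (fun i => p i - lam * a i) (fun _ => 1) a r₂ r₁ l out := by
  obtain ⟨Kv, hv⟩ := vert_comp e
  obtain ⟨Kt, ht⟩ := test_comp e
  refine ⟨Kv + Kt + 50, fun a p l lam r₁ r₂ => ?_⟩
  obtain ⟨out, hout, h⟩ := ht (fun i => p i - lam * a i) (fun _ => 1) a l r₂ r₁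
  refine ⟨out, ⟨_, rfl, (Runs.letCall rfl (hv a p lam l) <| Runs.call rfl hout).mono ?_⟩, h⟩
  simp only [size, fstE, sndE]
  nlinarith

theorem testH_comp : ∃ K, ∀ {α : Type} (a p : α → ℚ) (l : List α) (ν r₁ r₂ : ℚ),
    ∃ out, Comp (prog e) fTestH (.pair (.num ν) (.pair (.pair (.num r₁) (.num r₂))
        (Val.ofList (l.map (enc2 a p))))) out (K * (l.length + 1)) ∧
      TestOutcome (fun i => p i - ν) a (fun _ => 1) r₁ r₂ l out := by
  obtain ⟨Kv, hv⟩ := hor_comp e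
  obtain ⟨Kt, ht⟩ := test_comp e
  refine ⟨Kv + Kt + 50, fun a p l ν r₁ r₂ => ?_⟩
  obtain ⟨out, hout, h⟩ := ht (fun i => p i - ν) a (fun _ => 1) l r₁ r₂
  refine ⟨out, ⟨_, rfl, (Runs.letCall rfl (hv a p ν l) <| Runs.call rfl hout).mono ?_⟩, h⟩
  simp only [size, fstE, sndE]
  nlinarith

theorem finish_comp : ∃ K, ∀ {α : Type} (a p : α → ℚ) (l : List α) (r₁ r₂ σ ρ lam ν : ℚ) (T : ℕ),
    l.Nodup → (σ = 1 ∨ σ = -1) → (ρ = 1 ∨ ρ = -1) → SideV a p r₁ r₂ l σ lam →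
    SideH a p r₁ r₂ l ρ ν →
    (∀ s₁ s₂, ∃ out, Comp (prog e) fSolve2 (.pair (.pair (.num s₁) (.num s₂)) (Val.ofList
        ((l.filter fun i => ¬ Pruned σ ρ lam ν (a i) (p i)).map (enc2 a p)))) out T ∧
      Answer a p s₁ s₂ (l.filter fun i => ¬ Pruned σ ρ lam ν (a i) (p i)) out) →
    ∃ out, Comp (prog e) fFinish (.pair (encX σ ρ lam ν) (.pair (.pair (.num r₁) (.num r₂))
        (Val.ofList (l.map (enc2 a p))))) out (K * (l.length + 1) + T) ∧
      Answer a p r₁ r₂ l out := by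
  obtain ⟨Kp, hp⟩ := prune_comp e
  obtain ⟨Km, hm⟩ := merge_comp e
  refine ⟨Kp + Km + 200, fun {α} a p l r₁ r₂ σ ρ lam ν T hl hσ hρ hV hH hrec => ?_⟩
  have hmono : ∀ {S : ℕ}, S ≤ Kp * (l.length + 1) + Km * (l.length + 1) + T + 200 →
      S ≤ (Kp + Km + 200) * (l.length + 1) + T := fun h => by nlinarith
  obtain ⟨out, hout, hans⟩ := hrec
    (r₁ - (1 - ρ) / 2 * ((l.filter fun i => Pruned σ ρ lam ν (a i) (p i)).map a).sum)
    (r₂ - (1 - ρ) / 2 * ((l.filter fun i => Pruned σ ρ lam ν (a i) (p i)).map fun _ => (1 : ℚ)).sum)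
  have hP := hp a p σ ρ lam ν l
  have hden : ∀ S₁ S₂ L : Val, ∀ s₁ s₂ : ℚ, S₁ = .num s₁ → S₂ = .num s₂ →
      den [.pair L (.pair S₁ S₂), .pair (encX σ ρ lam ν) (.pair (.pair (.num r₁) (.num r₂))
        (Val.ofList (l.map (enc2 a p))))] (.pair
        (.pair
          (subE (fstE (fstE (sndE (.var 1)))) (mulE (fixedE (fstE (.var 1))) (fstE (sndE (.var 0)))))
          (subE (sndE (fstE (sndE (.var 1)))) (mulE (fixedE (fstE (.var 1))) (sndE (sndE (.var 0))))))
        (fstE (.var 0))) = some (.pair (.pair (.num (r₁ - (1 - ρ) / 2 * s₁))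
          (.num (r₂ - (1 - ρ) / 2 * s₂))) L) := by
    rintro _ _ L s₁ s₂ rfl rfl
    simp [den, fixedE, divE, subE, mulE, fstE, sndE, ArithOp.apply, encX]
  rcases hans.of_pruned hl hσ hρ hV hH with ⟨rfl, h⟩ | ⟨φ, rfl, h⟩
  · refine ⟨_, ⟨_, rfl, (Runs.letCall rfl hP <| Runs.letCall (hden _ _ _ _ _ rfl rfl) hout <|
      Runs.caseNil rfl <| Runs.of_den rfl).mono (hmono ?_)⟩, h⟩
    simp only [size, fixedE, divE, subE, mulE, fstE, sndE]; omega
  · refine ⟨_, ⟨_, rfl, (Runs.letCall rfl hP <| Runs.letCall (hden _ _ _ _ _ rfl rfl) hout <|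
      Runs.casePair rfl <| Runs.letCall rfl (hm a p φ σ ρ lam ν l) <| Runs.of_den rfl).mono
      (hmono ?_)⟩, h⟩
    simp only [size, fixedE, divE, subE, mulE, fstE, sndE]; omega

theorem neg_sign {ε : ℚ} (h : ε = 1 ∨ ε = -1) : 0 - ε = 1 ∨ 0 - ε = -1 := by
  rcases h with rfl | rfl <;> norm_num

theorem Answer.of_empty (a p : α → ℚ) {r₁ r₂ : ℚ} :
    Answer a p r₁ r₂ []
      (if r₁ = 0 ∧ r₂ = 0 then .pair .nil (.pair .nil .nil) else .nil) := by
  split_ifs with h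
  · exact .inr ⟨fun _ => 0, rfl, fun _ => by simp, by simp [h.1], by simp [h.2], by simp⟩
  · refine .inl ⟨rfl, fun z _ h1 h2 => h ⟨?_, ?_⟩⟩
    · simpa using h1.symm
    · simpa using h2.symm

section
variable {h t vl vL vA vB vX vD V H out : Val} {s r₁ r₂ lam ν ε ε' : ℚ} {T₁ T₂ T₃ T₄ T₅ T₆ T₇ T₈ T₉ T : ℕ}

/-- Execution is separated from the mathematics of a round: with all intermediate values abstract,
the evaluation goes through by `rfl`. -/
theorem solve2_of_final (hl : vl = .pair h t) (hsm : Comp (prog e) fMedian vl (.num s) T₁)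
    (hS : Comp (prog e) fShear (.pair (.num s) vl) vL T₂)
    (hP : Comp (prog e) fSplit (.pair .nil vL) (.pair vA vB) T₃)
    (hC : Comp (prog e) fCross (.pair vA vB) vX T₄)
    (hlam : Comp (prog e) fMedian vX (.num lam) T₅)
    (hV : Comp (prog e) fTestV
      (.pair (.num lam) (.pair (.pair (.num r₂) (.num (r₁ - s * r₂))) vL)) V T₆) (hf : Final V) :
    Comp (prog e) fSolve2 (.pair (.pair (.num r₁) (.num r₂)) vl) V
      (T₁ + T₂ + T₃ + T₄ + T₅ + T₆ + 400) := by
  subst hl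
  refine ⟨_, rfl, ?_⟩
  rcases hf with rfl | ⟨x, y, z, rfl⟩
  · refine (Runs.casePair rfl <| Runs.letCall rfl hsm <| Runs.letCall rfl hS <|
      Runs.letDen (x := .num (r₁ - s * r₂)) rfl <| Runs.letCall rfl hP <| Runs.letCall rfl hC <|
      Runs.letCall rfl hlam <| Runs.letCall rfl hV <| Runs.caseNil rfl <|
      Runs.of_den rfl).mono ?_
    simp only [size, fstE, sndE, subE, mulE]; omega
  · refine (Runs.casePair rfl <| Runs.letCall rfl hsm <| Runs.letCall rfl hS <|
      Runs.letDen (x := .num (r₁ - s * r₂)) rfl <| Runs.letCall rfl hP <| Runs.letCall rfl hC <|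
      Runs.letCall rfl hlam <| Runs.letCall rfl hV <| Runs.casePair rfl <| Runs.casePair rfl <|
      Runs.of_den rfl).mono ?_
    simp only [size, fstE, sndE, subE, mulE]; omega

theorem solve2_of_sign (hl : vl = .pair h t) (hsm : Comp (prog e) fMedian vl (.num s) T₁)
    (hS : Comp (prog e) fShear (.pair (.num s) vl) vL T₂)
    (hP : Comp (prog e) fSplit (.pair .nil vL) (.pair vA vB) T₃)
    (hC : Comp (prog e) fCross (.pair vA vB) vX T₄)
    (hlam : Comp (prog e) fMedian vX (.num lam) T₅)
    (hV : Comp (prog e) fTestV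
      (.pair (.num lam) (.pair (.pair (.num r₂) (.num (r₁ - s * r₂))) vL)) (.pair (.num ε) .nil) T₆)
    (hB : Comp (prog e) fBeyond (.pair (.pair (.num (0 - ε)) (.num lam)) vX) vD T₇)
    (hν : Comp (prog e) fMedian vD (.num ν) T₈)
    (hH : Comp (prog e) fTestH
      (.pair (.num ν) (.pair (.pair (.num (r₁ - s * r₂)) (.num r₂)) vL)) H T₉)
    (hf : (Final H ∧ out = H) ∨ ∃ ε', H = .pair (.num ε') .nil ∧
      Comp (prog e) fFinish (.pair (encX (0 - ε) (0 - ε') lam ν)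
        (.pair (.pair (.num (r₁ - s * r₂)) (.num r₂)) vL)) out T) :
    Comp (prog e) fSolve2 (.pair (.pair (.num r₁) (.num r₂)) vl) out
      (T₁ + T₂ + T₃ + T₄ + T₅ + T₆ + T₇ + T₈ + T₉ + T + 400) := by
  subst hl
  refine ⟨_, rfl, ?_⟩
  rcases hf with ⟨rfl | ⟨x, y, z, rfl⟩, rfl⟩ | ⟨ε', rfl, hF⟩
  · refine (Runs.casePair rfl <| Runs.letCall rfl hsm <| Runs.letCall rfl hS <|
      Runs.letDen (x := .num (r₁ - s * r₂)) rfl <| Runs.letCall rfl hP <| Runs.letCall rfl hC <|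
      Runs.letCall rfl hlam <| Runs.letCall rfl hV <| Runs.casePair rfl <| Runs.caseNil rfl <|
      Runs.letDen (x := .num (0 - ε)) rfl <| Runs.letCall rfl hB <| Runs.letCall rfl hν <|
      Runs.letCall rfl hH <| Runs.caseNil rfl <| Runs.of_den rfl).mono ?_
    simp only [size, fstE, sndE, subE, mulE]; omega
  · refine (Runs.casePair rfl <| Runs.letCall rfl hsm <| Runs.letCall rfl hS <|
      Runs.letDen (x := .num (r₁ - s * r₂)) rfl <| Runs.letCall rfl hP <| Runs.letCall rfl hC <|
      Runs.letCall rfl hlam <| Runs.letCall rfl hV <| Runs.casePair rfl <| Runs.caseNil rfl <|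
      Runs.letDen (x := .num (0 - ε)) rfl <| Runs.letCall rfl hB <| Runs.letCall rfl hν <|
      Runs.letCall rfl hH <| Runs.casePair rfl <| Runs.casePair rfl <| Runs.of_den rfl).mono ?_
    simp only [size, fstE, sndE, subE, mulE]; omega
  · refine (Runs.casePair rfl <| Runs.letCall rfl hsm <| Runs.letCall rfl hS <|
      Runs.letDen (x := .num (r₁ - s * r₂)) rfl <| Runs.letCall rfl hP <| Runs.letCall rfl hC <|
      Runs.letCall rfl hlam <| Runs.letCall rfl hV <| Runs.casePair rfl <| Runs.caseNil rfl <|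
      Runs.letDen (x := .num (0 - ε)) rfl <| Runs.letCall rfl hB <| Runs.letCall rfl hν <|
      Runs.letCall rfl hH <| Runs.casePair rfl <| Runs.caseNil rfl <| Runs.call rfl hF).mono ?_
    simp only [size, fstE, sndE, subE, mulE]; omega

end

/-- Each round either settles the program by a test or drops at least a sixteenth of the items at
linear cost. The recursion continues with the sheared coefficients; `Answer.of_shear` translates
back. -/
theorem solve2_comp : ∃ K, ∀ (n : ℕ) {α : Type} (a p : α → ℚ) (l : List α), l.length ≤ n →
    l.Nodup → ∀ r₁ r₂ : ℚ, ∃ out, Comp (prog e) fSolve2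
      (.pair (.pair (.num r₁) (.num r₂)) (Val.ofList (l.map (enc2 a p)))) out (K * (n + 1)) ∧
      Answer a p r₁ r₂ l out := by
  obtain ⟨Km, hm⟩ := median_comp e
  obtain ⟨Ks, hs⟩ := shear_comp e
  obtain ⟨Kp, hp⟩ := split_comp e
  obtain ⟨Kc, hc⟩ := cross_comp e
  obtain ⟨Kv, hv⟩ := testV_comp e
  obtain ⟨Kb, hb⟩ := beyond_comp e
  obtain ⟨Kh, hh⟩ := testH_comp e
  obtain ⟨Kf, hf⟩ := finish_comp e
  obtain ⟨O, hO⟩ : ∃ O, O = 3 * Km + Ks + Kp + Kc + Kv + Kb + Kh + Kf + 400 := ⟨_, rfl⟩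
  -- `O * (length + 1)` bounds a round. The factor 16 would balance the linear terms; twice that
  -- also absorbs the added ones.
  refine ⟨32 * O, fun n => ?_⟩
  induction n using Nat.strong_induction_on with
  | _ n ih =>
  intro α a p l hln hl r₁ r₂
  rcases eq_or_ne l [] with rfl | hne
  · refine ⟨_, ⟨_, rfl, (Runs.caseNil rfl <| Runs.of_den ?_).mono ?_⟩, Answer.of_empty a p⟩
    · simp only [den, fstE, sndE, List.getElem?_cons_zero]
      by_cases h1 : r₁ ≤ 0 <;> by_cases h2 : 0 ≤ r₁ <;> by_cases h3 : r₂ ≤ 0 <;>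
        by_cases h4 : 0 ≤ r₂ <;> simp [h1, h2, h3, h4, le_antisymm_iff]
    · simp only [size, fstE, sndE]
      nlinarith
  have hpos : 0 < l.length := List.length_pos_iff.2 hne
  obtain ⟨s, hsm, hmed⟩ := hm a p l hne
  have hS := hs a p s l
  set a' : α → ℚ := fun i => a i - s with ha'
  have hmed' : IsMedian a' l 0 := by simpa [IsMedian, ha'] using hmed
  have hP := hp a' p l
  set A := l.filter fun i => a' i ≤ 0 with hA
  set B := l.filter fun i => 0 ≤ a' i with hB
  have hC := hc a' p A B (fun i hi => by simpa using (List.mem_filter.1 hi).2)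
    fun i hi => by simpa using (List.mem_filter.1 hi).2
  set X := List.zipWith (crossing a' p) A B with hX
  have hAlen : A.length ≤ l.length := List.length_filter_le _ _
  have hXlen : X.length ≤ l.length := by
    rw [hX, List.length_zipWith]
    exact (min_le_left _ _).trans hAlen
  -- Each half of the split has at least half of the items, so at least one pair exists and its
  -- crossing can serve as a median.
  have hXne : X ≠ [] := by
    have h1 : l.length ≤ 2 * A.length := by simpa using hmed'.length_le (.inl rfl)
    have h2 : l.length ≤ 2 * B.length := hmed'.2
    rw [← List.length_pos_iff, hX, List.length_zipWith]
    omega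
  obtain ⟨lam, hlam, hlamm⟩ := hm Prod.fst Prod.snd X hXne
  obtain ⟨V, hVr, hVo⟩ := hv a' p l lam (r₁ - s * r₂) r₂
  have m1 : Kc * (A.length + 1) ≤ Kc * (l.length + 1) := Nat.mul_le_mul_left _ (by omega)
  have m2 : Km * (X.length + 1) ≤ Km * (l.length + 1) := Nat.mul_le_mul_left _ (by omega)
  have hmono : ∀ {T U : ℕ}, T ≤ 3 * (Km * (l.length + 1)) + Ks * (l.length + 1) +
      Kp * (l.length + 1) + Kc * (l.length + 1) + Kv * (l.length + 1) + Kb * (l.length + 1) +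
      Kh * (l.length + 1) + Kf * (l.length + 1) + 400 + U → T ≤ O * (l.length + 1) + U :=
    fun h => h.trans (by rw [hO]; nlinarith)
  have hmono' : ∀ {T : ℕ}, T ≤ 3 * (Km * (l.length + 1)) + Ks * (l.length + 1) +
      Kp * (l.length + 1) + Kc * (l.length + 1) + Kv * (l.length + 1) + Kb * (l.length + 1) +
      Kh * (l.length + 1) + Kf * (l.length + 1) + 400 → T ≤ 32 * O * (n + 1) := fun h =>
    (hmono (U := 0) (by linarith)).trans (by
      have := Nat.mul_le_mul_left O hln
      linarith [Nat.zero_le (O * n)])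
  obtain ⟨h, t, hcons⟩ : ∃ h t, Val.ofList (l.map (enc2 a p)) = .pair h t := by
    obtain ⟨x, L, rfl⟩ := List.exists_cons_of_ne_nil hne
    exact ⟨_, _, rfl⟩
  rcases hVo.vertical with ⟨hans, hform⟩ | ⟨ε, hε, rfl, hside⟩
  · refine ⟨V, (solve2_of_final e hcons hsm hS hP hC hlam hVr hform).mono (hmono' ?_),
      hans.of_shear⟩
    omega
  · have hσ := neg_sign hε
    have hB' := hb Prod.fst Prod.snd (0 - ε) lam X
    set D := X.filter fun x => (0 - ε) * x.1 ≤ (0 - ε) * lam with hD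
    have hDlen : D.length ≤ X.length := List.length_filter_le _ _
    have hDne : D ≠ [] := by
      have h1 : X.length ≤ 2 * D.length := hlamm.length_le hσ
      have h2 := List.length_pos_iff.2 hXne
      rw [← List.length_pos_iff]
      omega
    obtain ⟨ν, hν, hνm⟩ := hm Prod.snd (fun _ => 1) D hDne
    obtain ⟨H, hHr, hHo⟩ := hh a' p l ν (r₁ - s * r₂) r₂
    have m3 : Kb * (X.length + 1) ≤ Kb * (l.length + 1) := Nat.mul_le_mul_left _ (by omega)
    have m4 : Km * (D.length + 1) ≤ Km * (l.length + 1) := Nat.mul_le_mul_left _ (by omega)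
    rcases hHo.horizontal with ⟨hans, hform⟩ | ⟨ε', hε', rfl, hside'⟩
    · refine ⟨H, (solve2_of_sign (T := 0) e hcons hsm hS hP hC hlam hVr hB' hν hHr
        (.inl ⟨hform, rfl⟩)).mono (hmono' ?_), hans.of_shear⟩
      omega
    · have hρ := neg_sign hε'
      have hlen := length_le_pruned hmed' hσ hρ hX hlamm hνm
      have hcount := count_split (fun i => Pruned (0 - ε) (0 - ε') lam ν (a' i) (p i)) l
      set S := l.filter fun i => ¬ Pruned (0 - ε) (0 - ε') lam ν (a' i) (p i) with hSdef
      obtain ⟨out, hout, hans⟩ := hf a' p l (r₁ - s * r₂) r₂ (0 - ε) (0 - ε') lam ν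
        (32 * O * (S.length + 1)) hl hσ hρ hside hside' fun s₁ s₂ =>
          ih S.length (by omega) a' p S le_rfl (hl.filter _) s₁ s₂
      have hfinal : O * (l.length + 1) + 32 * O * (S.length + 1) ≤ 32 * O * (n + 1) := by
        have h1 : l.length + 1 + 32 * (S.length + 1) ≤ 32 * (n + 1) := by omega
        have := Nat.mul_le_mul_left O h1
        linarith
      refine ⟨out, ((solve2_of_sign e hcons hsm hS hP hC hlam hVr hB' hν hHr
        (.inr ⟨ε', rfl, hout⟩)).mono (hmono ?_)).mono hfinal, hans.of_shear⟩
      linarith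

end

/-! ## The reduced linear program -/

section
variable {α : Type}

/-- Moving towards a better point until a violated constraint becomes tight. -/
theorem exists_tight (p G : α → ℝ) {l : List α} {β : ℝ} {x y : α → ℝ} (hx : Box x) (hy : Box y)
    (hyG : dot G y l ≤ β) (hxG : β < dot G x l) (hp : dot p y l ≤ dot p x l) :
    ∃ t : ℝ, 0 ≤ t ∧ t ≤ 1 ∧ Box (fun i => (1 - t) * y i + t * x i) ∧
      dot G (fun i => (1 - t) * y i + t * x i) l = β ∧
      dot p y l ≤ dot p (fun i => (1 - t) * y i + t * x i) l := by
  have hpos : 0 < dot G x l - dot G y l := by linarith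
  set t := (β - dot G y l) / (dot G x l - dot G y l) with ht
  have h0 : 0 ≤ t := div_nonneg (by linarith) hpos.le
  have h1 : t ≤ 1 := (div_le_one hpos).2 (by linarith)
  have hmul : t * (dot G x l - dot G y l) = β - dot G y l := div_mul_cancel₀ _ hpos.ne'
  refine ⟨t, h0, h1, fun i => ?_, ?_, ?_⟩
  · obtain ⟨a1, a2⟩ := hx i
    obtain ⟨b1, b2⟩ := hy i
    have h1' := sub_nonneg.2 h1
    constructor
    · have := mul_nonneg h1' b1
      have := mul_nonneg h0 a1
      simp only
      linarith
    · have := mul_le_mul_of_nonneg_left b2 h1'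
      have := mul_le_mul_of_nonneg_left a2 h0
      simp only
      linarith
  · rw [dot_combination]; linarith
  · rw [dot_combination]
    nlinarith [mul_le_mul_of_nonneg_left hp h0]

theorem zval_optimal {τ θ : ℚ} {q c : α → ℚ} {l : List α} {z : α → ℝ} (hz : Box z)
    (hc : dot (fun i => (c i : ℝ)) z l =
      ((dot c (fun i => zval τ θ (q i) (c i)) l : ℚ) : ℝ)) :
    dot (fun i => (q i : ℝ)) z l ≤
      dot (fun i => (q i : ℝ)) (fun i => ((zval τ θ (q i) (c i) : ℚ) : ℝ)) l := by
  have h := (Slack.cast_left.2 (zval_slack (τ := τ) (θ := θ) q c l).cast :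
    Slack (fun i => ((q i - τ * c i : ℚ) : ℝ)) _ l).dot_le hz
  rw [dot_cast] at hc
  push_cast at h
  rw [dot_sub, dot_sub, dot_smul, dot_smul, hc] at h
  linarith

/-- Complementation of the variables with `g = -1`. -/
def compl {R : Type} [Field R] (g z : α → R) (i : α) : R := (1 - g i) / 2 + g i * z i

/-- Stated over any field of characteristic zero because it is used for the computed rational
solution and for arbitrary real competitors. -/
theorem dot_compl {R : Type} [Field R] [CharZero R] {g : α → ℚ} {l : List α}
    (hg : ∀ i ∈ l, g i = 1 ∨ g i = -1) (c : α → ℚ) (z : α → R) :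
    dot (fun i => (c i : R)) (compl (fun i => (g i : R)) z) l =
      (((l.filter fun i => g i < 0).map c).sum : ℚ) +
        dot (fun i => ((g i * c i : ℚ) : R)) z l := by
  induction l with
  | nil => simp
  | cons i l ih =>
    have ih := ih fun j hj => hg j (List.mem_cons_of_mem _ hj)
    rw [dot_cons, dot_cons, ih]
    rcases hg i List.mem_cons_self with h | h
    · simp [h, compl]; ring
    · simp [h, compl]; ring

theorem compl_mem {R : Type} [Field R] [LinearOrder R] [IsStrictOrderedRing R] {g z : α → R} {i : α}
    (hg : g i = 1 ∨ g i = -1) (hz : 0 ≤ z i ∧ z i ≤ 1) : 0 ≤ compl g z i ∧ compl g z i ≤ 1 := by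
  unfold compl
  rcases hg with h | h
  · rw [h]; simpa using hz
  · rw [h]
    norm_num
    exact ⟨hz.2, hz.1⟩

theorem compl_compl {R : Type} [Field R] [CharZero R] {g z : α → R} {i : α}
    (hg : g i = 1 ∨ g i = -1) : compl g (compl g z) i = z i := by
  unfold compl
  rcases hg with h | h
  · rw [h]; ring
  · rw [h]; ring

variable (e : Expr)

theorem uncompl_comp : ∃ K, ∀ {α : Type} (p g w φ : α → ℚ) (l : List α),
    Comp (prog e) fUncompl (.pair (Val.ofList (l.map (enc3 p g w))) (encL φ l))
      (encL (compl g φ) l) (K * (l.length + 1)) := by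
  refine ⟨100, fun p g w φ l => ?_⟩
  induction l with
  | nil =>
    refine ⟨_, rfl, (Runs.caseNil rfl <| Runs.of_den rfl).mono ?_⟩
    simp only [size, fstE]; omega
  | cons i l ih =>
    refine ⟨_, rfl, (Runs.casePair (x := enc3 p g w i) (y := Val.ofList (l.map (enc3 p g w))) rfl <|
      Runs.letCall rfl ih <| Runs.of_den ?_).mono ?_⟩
    · simp [den, addE, divE, subE, mulE, fstE, sndE, ArithOp.apply, encL, Val.ofList, enc3, compl]
    · simp only [size, addE, divE, subE, mulE, fstE, sndE, List.length_cons]; omega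

/-- The answer to the linear program with the constraints `∑ w z ≤ b` and `∑ g z = 1`. -/
def ReducedAnswer (p w g : α → ℚ) (b : ℚ) (l : List α) (out : Val) : Prop :=
  (out = .nil ∧ ∀ z : α → ℝ, Box z → dot (fun i => (w i : ℝ)) z l ≤ b →
    dot (fun i => (g i : ℝ)) z l = 1 → False) ∨
  ∃ φ : α → ℚ, out = encL φ l ∧ Box φ ∧ dot w φ l ≤ b ∧ dot g φ l = 1 ∧
    ∀ z : α → ℝ, Box z → dot (fun i => (w i : ℝ)) z l ≤ b → dot (fun i => (g i : ℝ)) z l = 1 →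
      dot (fun i => (p i : ℝ)) z l ≤ dot (fun i => (p i : ℝ)) (fun i => (φ i : ℝ)) l

/-- If the optimum without the knapsack constraint fits, it is the answer. If not, the constraint
may be taken as an equality by `exists_tight`, and complementation gives the two-equation program
with right-hand sides `b - SN` and `1 + cN`. -/
theorem reduced_comp : ∃ K, ∀ {α : Type} (p w g : α → ℚ) (l : List α) (b : ℚ), l.Nodup →
    (∀ i, g i = 1 ∨ g i = -1) → ∃ out, Comp (prog e) fReduced
      (.pair (.num b) (Val.ofList (l.map (enc3 p w g)))) out (K * (l.length + 1)) ∧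
      ReducedAnswer p w g b l out := by
  obtain ⟨Ks, hs⟩ := swap_comp e
  obtain ⟨K1, h1⟩ := solve1_comp e
  obtain ⟨Kw, hw⟩ := wsum_comp e
  obtain ⟨Kz, hz⟩ := zmap_comp e
  obtain ⟨Kc, hc⟩ := compl_comp e
  obtain ⟨K2, h2⟩ := solve2_comp e
  obtain ⟨Ku, hu⟩ := uncompl_comp e
  refine ⟨Ks + K1 + Kw + Kz + Kc + K2 + Ku + 200, fun {α} p w g l b hl hg => ?_⟩
  have hmono : ∀ {T : ℕ}, T ≤ Ks * (l.length + 1) + K1 * (l.length + 1) + Kw * (l.length + 1) +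
      Kz * (l.length + 1) + Kc * (l.length + 1) + K2 * (l.length + 1) + Ku * (l.length + 1) + 200 →
      T ≤ (Ks + K1 + Kw + Kz + Kc + K2 + Ku + 200) * (l.length + 1) := fun h => by nlinarith
  have hS := hs p w g l
  rcases h1 p g w l 1 with ⟨hr, hinf⟩ | ⟨τ, θ, hr, hθ, hdot⟩
  · refine ⟨_, ⟨_, rfl, (Runs.letCall rfl hS <| Runs.letCall rfl hr <| Runs.caseNil rfl <|
      Runs.of_den rfl).mono (hmono ?_)⟩, .inl ⟨rfl, fun z hz _ h => hinf z hz (by simpa using h)⟩⟩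
    simp only [size, sndE]; omega
  have hW := hw p g w τ θ l
  set φ : α → ℚ := fun i => zval τ θ (p i) (g i) with hφ
  have hbox : Box φ := fun i => zval_mem hθ _ _
  have hopt : ∀ z : α → ℝ, Box z → dot (fun i => (g i : ℝ)) z l = 1 →
      dot (fun i => (p i : ℝ)) z l ≤ dot (fun i => (p i : ℝ)) (fun i => (φ i : ℝ)) l :=
    fun z hz h => zval_optimal hz (by rw [hdot]; simpa using h)
  set W := (l.map fun i => w i * zval τ θ (p i) (g i)).sum with hWdef
  have hWdot : dot w φ l = W := rfl
  rcases le_or_gt W b with hle | hgt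
  · refine ⟨_, ⟨_, rfl, (Runs.letCall rfl hS <| Runs.letCall rfl hr <| Runs.casePair rfl <|
      Runs.letCall rfl hW <| Runs.ifTrue rfl rfl hle <| Runs.call rfl (hz p g w τ θ l)).mono
      (hmono ?_)⟩, .inr ⟨φ, rfl, hbox, hle, hdot, fun z hz _ h => hopt z hz h⟩⟩
    simp only [size, fstE, sndE]; omega
  have hC := hc p g w l
  set SN := ((l.filter fun i => g i < 0).map w).sum with hSN
  set cN := ((l.filter fun i => g i < 0).map fun _ => (1 : ℚ)).sum with hcN
  obtain ⟨out, hout, hans⟩ := h2 l.length (fun i => g i * w i) (fun i => g i * p i) l le_rfl hl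
    (b - SN) (1 + cN)
  have hgg : ∀ i, g i * g i = 1 := fun i => by rcases hg i with h | h <;> simp [h]
  have hgneg : ((l.filter fun i => g i < 0).map g).sum = -cN := by
    have : (l.filter fun i => g i < 0).map g = (l.filter fun i => g i < 0).map fun _ => -1 := by
      refine List.map_congr_left fun i hi => ?_
      rcases hg i with h | h
      · have := (List.mem_filter.1 hi).2
        norm_num [h] at this
      · exact h
    rw [this, hcN]
    simp
  have hgR : ∀ i, (g i : ℝ) = 1 ∨ (g i : ℝ) = -1 := fun i => by
    rcases hg i with h | h <;> simp [h]
  have htr : ∀ z : α → ℝ, Box z → dot (fun i => (w i : ℝ)) z l = b →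
      dot (fun i => (g i : ℝ)) z l = 1 → Box (compl (fun i => (g i : ℝ)) z) ∧
      dot (fun i => ((g i * w i : ℚ) : ℝ)) (compl (fun i => (g i : ℝ)) z) l = ((b - SN : ℚ) : ℝ) ∧
      dot (fun _ => 1) (compl (fun i => (g i : ℝ)) z) l = ((1 + cN : ℚ) : ℝ) ∧
      dot (fun i => (p i : ℝ)) z l = (((l.filter fun i => g i < 0).map p).sum : ℚ) +
        dot (fun i => ((g i * p i : ℚ) : ℝ)) (compl (fun i => (g i : ℝ)) z) l := by
    intro z hz h3 h4
    have hid : ∀ c : α → ℚ, dot (fun i => (c i : ℝ)) z l =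
        (((l.filter fun i => g i < 0).map c).sum : ℚ) +
          dot (fun i => ((g i * c i : ℚ) : ℝ)) (compl (fun i => (g i : ℝ)) z) l := fun c => by
      rw [← dot_compl (fun i _ => hg i)]
      exact dot_congr fun i _ => by
        rw [compl_compl (g := fun i => (g i : ℝ)) (hgR i)]
    refine ⟨fun i => compl_mem (hgR i) (hz i), ?_, ?_, hid p⟩
    · have := hid w
      rw [h3, ← hSN] at this
      push_cast at this ⊢
      linarith
    · have := hid g
      simp only [hgg] at this
      rw [h4, hgneg] at this
      push_cast at this ⊢
      linarith
  -- Both ends of the segment satisfy the balance equation, so the tight point does too.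
  have htight : ∀ z : α → ℝ, Box z → dot (fun i => (w i : ℝ)) z l ≤ b →
      dot (fun i => (g i : ℝ)) z l = 1 → ∃ z' : α → ℝ, Box z' ∧
        dot (fun i => (w i : ℝ)) z' l = b ∧ dot (fun i => (g i : ℝ)) z' l = 1 ∧
        dot (fun i => (p i : ℝ)) z l ≤ dot (fun i => (p i : ℝ)) z' l := by
    intro z hz h3 h4
    obtain ⟨t, ht0, ht1, hb, hG, hp⟩ := exists_tight (fun i => (p i : ℝ)) (fun i => (w i : ℝ))
      hbox.cast hz h3 (by rw [← dot_cast, hWdot]; exact_mod_cast hgt) (hopt z hz h4)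
    refine ⟨_, hb, hG, ?_, hp⟩
    rw [dot_combination, h4, ← dot_cast, hdot]
    push_cast
    ring
  have hden : ∀ x₁ x₂ x₃ x₄ L : Val, den [.pair L (.pair (.num SN) (.num cN)), .num W, x₁, x₂, x₃,
      x₄, .pair (.num b) (Val.ofList (l.map (enc3 p w g)))] (.pair
        (.pair (subE (fstE (.var 6)) (fstE (sndE (.var 0)))) (addE (.num 1) (sndE (sndE (.var 0)))))
        (fstE (.var 0))) = some (.pair (.pair (.num (b - SN)) (.num (1 + cN))) L) :=
    fun _ _ _ _ _ => rfl
  rcases hans with ⟨rfl, hinf⟩ | ⟨ψ, rfl, hψ, h3, h4, h5⟩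
  · refine ⟨_, ⟨_, rfl, (Runs.letCall rfl hS <| Runs.letCall rfl hr <| Runs.casePair rfl <|
      Runs.letCall rfl hW <| Runs.ifFalse rfl rfl (not_le.2 hgt) <| Runs.letCall rfl hC <|
      Runs.letCall (hden _ _ _ _ _) hout <| Runs.caseNil rfl <| Runs.of_den rfl).mono (hmono ?_)⟩,
      .inl ⟨rfl, fun z hz h3 h4 => ?_⟩⟩
    · simp only [size, fstE, sndE, subE, addE]; omega
    · obtain ⟨z', hz', h5, h6, -⟩ := htight z hz h3 h4
      obtain ⟨h7, h8, h9, -⟩ := htr z' hz' h5 h6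
      exact hinf _ h7 h8 h9
  · refine ⟨_, ⟨_, rfl, (Runs.letCall rfl hS <| Runs.letCall rfl hr <| Runs.casePair rfl <|
      Runs.letCall rfl hW <| Runs.ifFalse rfl rfl (not_le.2 hgt) <| Runs.letCall rfl hC <|
      Runs.letCall (hden _ _ _ _ _) hout <| Runs.casePair rfl <|
      Runs.call rfl (hu p g w ψ l)).mono (hmono ?_)⟩,
      .inr ⟨compl g ψ, rfl, fun i => compl_mem (hg i) (hψ i), ?_, ?_, fun z hz h6 h7 => ?_⟩⟩
    · simp only [size, fstE, sndE, subE, addE]; omega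
    · have := dot_compl (R := ℚ) (fun i _ => hg i) w ψ (l := l)
      simp only [Rat.cast_id] at this
      rw [this, h3]
      linarith
    · have := dot_compl (R := ℚ) (fun i _ => hg i) g ψ (l := l)
      simp only [Rat.cast_id, hgg] at this
      rw [this, h4, hgneg]
      linarith
    · obtain ⟨z', hz', h8, h9, h10⟩ := htight z hz h6 h7
      obtain ⟨h11, h12, h13, h14⟩ := htr z' hz' h8 h9
      have h15 := h5 _ h11 h12 h13
      have h16 := dot_compl (R := ℝ) (fun i _ => hg i) p (fun i => (ψ i : ℝ)) (l := l)
      have h17 : (fun i => ((compl g ψ i : ℚ) : ℝ)) = compl (fun i => (g i : ℝ)) fun i => (ψ i : ℝ) := by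
        funext i
        simp [compl]
      rw [h17, h16]
      linarith

/-! ## The relaxation of the colored knapsack problem -/

theorem dot_nonneg {c z : α → ℚ} {l : List α} (hc : ∀ i ∈ l, 0 ≤ c i) (hz : Box z) :
    0 ≤ dot c z l := by
  refine List.sum_nonneg fun x hx => ?_
  obtain ⟨i, hi, rfl⟩ := List.mem_map.1 hx
  exact mul_nonneg (hc i hi) (hz i).1

theorem dot_zero (c : α → ℝ) (l : List α) : dot c (fun _ => 0) l = 0 := by
  simp [dot]

/-- With `τ = θ = 0` exactly the items of positive profit are taken, which is optimal over the whole
box. If they are too heavy, the capacity may be taken as an equality and one multiplier suffices. -/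
theorem params_comp : ∃ K, ∀ {α : Type} (p w : α → ℚ) (l : List α) (b : ℚ), 0 ≤ b →
    ∃ τ θ, Comp (prog e) fParams (.pair (.num b) (Val.ofList (l.map (enc3 p w w))))
      (.pair (.num τ) (.num θ)) (K * (l.length + 1)) ∧ (0 ≤ θ ∧ θ ≤ 1) ∧
      dot w (fun i => zval τ θ (p i) (w i)) l ≤ b ∧
      ∀ z : α → ℝ, Box z → dot (fun i => (w i : ℝ)) z l ≤ b → dot (fun i => (p i : ℝ)) z l ≤
        dot (fun i => (p i : ℝ)) (fun i => ((zval τ θ (p i) (w i) : ℚ) : ℝ)) l := by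
  obtain ⟨Kw, hw⟩ := wsum_comp e
  obtain ⟨K1, h1⟩ := solve1_comp e
  refine ⟨Kw + K1 + 100, fun {α} p w l b hb => ?_⟩
  have hmono : ∀ {T : ℕ}, T ≤ Kw * (l.length + 1) + K1 * (l.length + 1) + 100 →
      T ≤ (Kw + K1 + 100) * (l.length + 1) := fun h => by nlinarith
  have hW := hw p w w 0 0 l
  set W := (l.map fun i => w i * zval 0 0 (p i) (w i)).sum with hWdef
  have hopt0 : ∀ z : α → ℝ, Box z → dot (fun i => (p i : ℝ)) z l ≤
      dot (fun i => (p i : ℝ)) (fun i => ((zval 0 0 (p i) (w i) : ℚ) : ℝ)) l := fun z hz => by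
    have h := (Slack.cast_left.2 (zval_slack (τ := 0) (θ := 0) p w l).cast :
      Slack (fun i => ((p i - 0 * w i : ℚ) : ℝ)) _ l).dot_le hz
    simpa using h
  rcases le_or_gt W b with hle | hgt
  · refine ⟨0, 0, ⟨_, rfl, (Runs.letCall rfl hW <| Runs.ifTrue rfl rfl hle <|
      Runs.of_den rfl).mono (hmono ?_)⟩, by simp, hle, fun z hz _ => hopt0 z hz⟩
    simp only [size, fstE, sndE]; omega
  have htight : ∀ z : α → ℝ, Box z → dot (fun i => (w i : ℝ)) z l ≤ b →
      ∃ z' : α → ℝ, Box z' ∧ dot (fun i => (w i : ℝ)) z' l = b ∧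
        dot (fun i => (p i : ℝ)) z l ≤ dot (fun i => (p i : ℝ)) z' l := by
    intro z hz h3
    have hWc : ((W : ℚ) : ℝ) = dot (fun i => (w i : ℝ))
      (fun i => ((zval 0 0 (p i) (w i) : ℚ) : ℝ)) l := dot_cast w _ l
    obtain ⟨t, ht0, ht1, hb, hG, hp⟩ := exists_tight (fun i => (p i : ℝ)) (fun i => (w i : ℝ))
      (Box.cast fun i => zval_mem (by simp) (p i) (w i)) hz h3
      (by rw [← hWc]; exact_mod_cast hgt) (hopt0 z hz)
    exact ⟨_, hb, hG, hp⟩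
  -- Infeasibility of the equality is excluded: the zero vector is feasible for the inequality, and
  -- `htight` moves it to a tight point.
  rcases h1 p w w l b with ⟨-, hinf⟩ | ⟨τ, θ, hr, hθ, hdot⟩
  · obtain ⟨z, hz, h, -⟩ := htight (fun _ => 0) (fun _ => by simp) (by
      rw [dot_zero]; exact_mod_cast hb)
    exact absurd h (hinf z hz)
  · refine ⟨τ, θ, ⟨_, rfl, (Runs.letCall rfl hW <| Runs.ifFalse rfl rfl (not_le.2 hgt) <|
      Runs.call rfl hr).mono (hmono ?_)⟩, hθ, hdot.le, fun z hz h => ?_⟩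
    · simp only [size, fstE, sndE]; omega
    · obtain ⟨z', hz', h1, h2⟩ := htight z hz h
      exact h2.trans (zval_optimal hz' (by rw [hdot]; exact h1))

/-- Only the winner of the vote can have a strict majority. -/
theorem vote_spec (k : α → ℚ) {x : α → ℚ} (hx : ∀ i, 0 ≤ x i) (l : List α) :
    0 ≤ (vote k x l).2 ∧ dot (fun i => sgn (vote k x l).1 (k i)) x l ≤ (vote k x l).2 ∧
      ∀ c, c ≠ (vote k x l).1 → dot (fun i => sgn c (k i)) x l ≤ -(vote k x l).2 := by
  induction l with
  | nil => simp [vote]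
  | cons i l ih =>
    obtain ⟨h0, h1, h2⟩ := ih
    set v := vote k x l with hv
    have hxi := hx i
    simp only [vote, ← hv, dot_cons]
    -- The stored weight bounds the excess of the candidate from above, and its negative bounds the
    -- excess of every other color. An item of another color uses up stored weight; if it outweighs
    -- what is stored, its color becomes the candidate with the difference.
    split_ifs with h3 h4
    · refine ⟨by linarith, ?_, fun c hc => ?_⟩
      · simp only [sgn] at h1 ⊢
        rw [if_pos h3]
        linarith
      · have := h2 c hc
        simp only [sgn] at this ⊢
        rw [if_neg (by rw [h3]; exact Ne.symm hc)]
        linarith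
    · refine ⟨by linarith, ?_, fun c hc => ?_⟩
      · simp only [sgn] at h1 ⊢
        rw [if_neg h3]
        linarith
      · have := h2 c hc
        simp only [sgn] at this ⊢
        split_ifs <;> linarith
    · have h4 := not_le.1 h4
      refine ⟨by linarith, ?_, fun c hc => ?_⟩
      · have := h2 (k i) h3
        simp only [sgn] at this ⊢
        rw [if_pos trivial]
        linarith
      · simp only at hc
        by_cases hcv : c = v.1
        · subst hcv
          simp only [sgn] at h1 ⊢
          rw [if_neg h3]
          linarith
        · have := h2 c hcv
          simp only [sgn] at this ⊢
          rw [if_neg (Ne.symm hc)]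
          linarith

theorem sgn_eq (c k : ℚ) : sgn c k = 1 ∨ sgn c k = -1 := by
  unfold sgn
  split_ifs <;> simp

/-- The vote starts from the number 0, which need not be the color of an item. A positive excess
shows that the winner is one, so that its constraint is among those imposed on competitors. -/
theorem exists_of_dot_pos {k : α → ℚ} {u : ℚ} {x : α → ℚ} (hx : Box x) {l : List α}
    (h : 0 < dot (fun i => sgn u (k i)) x l) : ∃ i ∈ l, k i = u := by
  by_contra hne
  push Not at hne
  have h1 : dot (fun i => sgn u (k i)) x l = -dot (fun _ => 1) x l := by
    rw [← dot_neg]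
    exact dot_congr fun i hi => by rw [sgn, if_neg (hne i hi)]
  have h2 : 0 ≤ dot (fun _ => 1) x l := dot_nonneg (fun _ _ => zero_le_one) hx
  linarith

/-- Only the winner of the vote can violate its constraint. If it does, this constraint may be taken
as an equality, and the reduced program for that color solves the whole relaxation. -/
theorem relaxation_comp : ∃ K, ∀ {α : Type} (p w k : α → ℚ) (l : List α) (b : ℚ), 0 ≤ b → l.Nodup →
    ∃ φ : α → ℚ, Comp (prog relaxationBody) 0
      (.pair (.num b) (Val.ofList (l.map (enc3 p w k)))) (encL φ l) (K * (l.length + 1)) ∧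
      Box φ ∧ dot w φ l ≤ b ∧ (∀ c, dot (fun i => sgn c (k i)) φ l ≤ 1) ∧
      ∀ z : α → ℝ, Box z → dot (fun i => (w i : ℝ)) z l ≤ b →
        (∀ i ∈ l, dot (fun j => (sgn (k i) (k j) : ℝ)) z l ≤ 1) →
        dot (fun i => (p i : ℝ)) z l ≤ dot (fun i => (p i : ℝ)) (fun i => (φ i : ℝ)) l := by
  obtain ⟨Kd, hd⟩ := dup_comp relaxationBody
  obtain ⟨Kp, hp⟩ := params_comp relaxationBody
  obtain ⟨Kv, hv⟩ := vote_comp relaxationBody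
  obtain ⟨Ke, he⟩ := excess_comp relaxationBody
  obtain ⟨Kz, hz⟩ := zmap_comp relaxationBody
  obtain ⟨Kc, hc⟩ := recolor_comp relaxationBody
  obtain ⟨Kr, hr⟩ := reduced_comp relaxationBody
  refine ⟨Kd + Kp + Kv + Ke + Kz + Kc + Kr + 200, fun {α} p w k l b hb hl => ?_⟩
  have hmono : ∀ {T : ℕ}, T ≤ Kd * (l.length + 1) + Kp * (l.length + 1) + Kv * (l.length + 1) +
      Ke * (l.length + 1) + Kz * (l.length + 1) + Kc * (l.length + 1) + Kr * (l.length + 1) + 200 →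
      T ≤ (Kd + Kp + Kv + Ke + Kz + Kc + Kr + 200) * (l.length + 1) := fun h => by nlinarith
  have hD := hd p w k l
  obtain ⟨τ, θ, hP, hθ, hle, hopt⟩ := hp p w l b hb
  have hV := hv p w k τ θ l
  set φ : α → ℚ := fun i => zval τ θ (p i) (w i) with hφ
  have hbox : Box φ := fun i => zval_mem hθ _ _
  obtain ⟨hv0, hv1, hv2⟩ := vote_spec k (fun i => (hbox i).1) l
  set v := vote k φ l with hvdef
  have hE := he p w k v.1 τ θ l
  set E := (l.map fun i => sgn v.1 (k i) * zval τ θ (p i) (w i)).sum with hEdef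
  have hEdot : dot (fun i => sgn v.1 (k i)) φ l = E := rfl
  rcases le_or_gt E 1 with hE1 | hE1
  · refine ⟨φ, ⟨_, rfl, (Runs.letCall rfl hD <| Runs.letCall rfl hP <| Runs.letCall rfl hV <|
      Runs.letCall rfl hE <| Runs.ifTrue rfl rfl hE1 <| Runs.call rfl (hz p w w τ θ l)).mono
      (hmono ?_)⟩, hbox, hle, fun c => ?_, fun z hz hzw _ => hopt z hz hzw⟩
    · simp only [size, fstE, sndE]; omega
    · by_cases h : c = v.1
      · rw [h, hEdot]; exact hE1
      · linarith [hv2 c h]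
  · have hC := hc p w k v.1 l
    obtain ⟨out, hout, hans⟩ := hr p w (fun i => sgn v.1 (k i)) l b hl fun i => sgn_eq _ _
    have hrun : Comp (prog relaxationBody) 0
        (.pair (.num b) (Val.ofList (l.map (enc3 p w k)))) out
        ((Kd + Kp + Kv + Ke + Kz + Kc + Kr + 200) * (l.length + 1)) := by
      refine ⟨_, rfl, (Runs.letCall rfl hD <| Runs.letCall rfl hP <| Runs.letCall rfl hV <|
        Runs.letCall rfl hE <| Runs.ifFalse rfl rfl (not_le.2 hE1) <| Runs.letCall rfl hC <|
        Runs.call rfl hout).mono (hmono ?_)⟩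
      simp only [size, fstE, sndE]; omega
    have htight : ∀ z : α → ℝ, Box z → dot (fun i => (w i : ℝ)) z l ≤ b →
        dot (fun j => (sgn v.1 (k j) : ℝ)) z l ≤ 1 → ∃ z' : α → ℝ, Box z' ∧
          dot (fun i => (w i : ℝ)) z' l ≤ b ∧ dot (fun j => (sgn v.1 (k j) : ℝ)) z' l = 1 ∧
          dot (fun i => (p i : ℝ)) z l ≤ dot (fun i => (p i : ℝ)) z' l := by
      intro z hz h1 h2
      obtain ⟨t, ht0, ht1, hb, hG, hp⟩ := exists_tight (fun i => (p i : ℝ))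
        (fun j => (sgn v.1 (k j) : ℝ)) hbox.cast hz h2
        (by rw [← dot_cast, hEdot]; exact_mod_cast hE1) (hopt z hz h1)
      refine ⟨_, hb, ?_, hG, hp⟩
      have h3 : dot (fun i => (w i : ℝ)) (fun i => (φ i : ℝ)) l ≤ b := by
        rw [← dot_cast]; exact_mod_cast hle
      rw [dot_combination]
      nlinarith
    rcases hans with ⟨-, hinf⟩ | ⟨ψ, rfl, hψ, h1, h2, h3⟩
    -- The reduced program is feasible, because the zero vector can be moved to a tight point.
    · obtain ⟨z, hz, h1, h2, -⟩ := htight (fun _ => 0) (fun _ => by simp)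
        (by rw [dot_zero]; exact_mod_cast hb) (by rw [dot_zero]; exact zero_le_one)
      exact (hinf z hz h1 h2).elim
    · refine ⟨ψ, hrun, hψ, h1, fun c => ?_, fun z hz h4 h5 => ?_⟩
      · by_cases h : c = v.1
        · rw [h, h2]
        -- For two different colors the signs add up to 0 or -2 at every item, so an excess of 1 for
        -- the winner leaves at most -1 for any other color.
        · have : 0 ≤ dot (fun i => -(sgn c (k i) + sgn v.1 (k i))) ψ l := by
            refine dot_nonneg (fun i _ => ?_) hψ
            unfold sgn
            split_ifs with h6 h7
            · exact absurd (h6.symm.trans h7) h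
            · norm_num
            · norm_num
            · norm_num
          rw [dot_neg, dot_add, h2] at this
          linarith
      · obtain ⟨i, hi, hiv⟩ := exists_of_dot_pos hbox (zero_lt_one.trans (hE1.trans_eq hEdot.symm))
        obtain ⟨z', hz', h6, h7, h8⟩ := htight z hz h4 (hiv ▸ h5 i hi)
        exact h8.trans (h3 z' hz' h6 h7)

end

/-! ## Instances -/

section
variable {n m : ℕ}

theorem dot_finRange {R : Type} [Semiring R] (c z : Fin n → R) :
    dot c z (List.finRange n) = ∑ i, c i * z i := by
  rw [dot, ← List.ofFn_eq_map, List.sum_ofFn]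

theorem encL_finRange (φ : Fin n → ℚ) : encL φ (List.finRange n) = encodeVec φ := by
  rw [encL, encodeVec, List.ofFn_eq_map]

theorem encodeReduced_eq (I : CKPInstance n m) (c : Fin m) :
    I.encodeReduced c = .pair (.num I.b) (Val.ofList ((List.finRange n).map
      (enc3 (fun i => (I.p i : ℚ)) (fun i => (I.w i : ℚ)) fun i => (I.g c i : ℚ)))) := by
  rw [CKPInstance.encodeReduced, List.ofFn_eq_map]
  rfl

theorem encodeCKP_eq (I : CKPInstance n m) :
    I.encodeCKP = .pair (.num I.b) (Val.ofList ((List.finRange n).map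
      (enc3 (fun i => (I.p i : ℚ)) (fun i => (I.w i : ℚ)) fun i => ((I.κ i : ℕ) : ℚ)))) := by
  rw [CKPInstance.encodeCKP, List.ofFn_eq_map]
  rfl

theorem mem_feasibleReduced (I : CKPInstance n m) (c : Fin m) (z : Fin n → ℝ) :
    z ∈ I.feasibleReduced c ↔ Box z ∧
      dot (fun i => ((I.w i : ℚ) : ℝ)) z (List.finRange n) ≤ ((I.b : ℚ) : ℝ) ∧
      dot (fun i => ((I.g c i : ℚ) : ℝ)) z (List.finRange n) = 1 := by
  simp only [CKPInstance.feasibleReduced, Set.mem_ofPred_eq, Box, dot_finRange, Rat.cast_intCast]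
  constructor
  · rintro ⟨h1, h2, h3, h4⟩
    exact ⟨fun i => ⟨h4 i, h3 i⟩, h1, h2⟩
  · rintro ⟨h1, h2, h3⟩
    exact ⟨h2, h3, fun i => (h1 i).2, fun i => (h1 i).1⟩

theorem dot_sgn (I : CKPInstance n m) (c : Fin m) (z : Fin n → ℝ) :
    dot (fun i => (sgn ((c : ℕ) : ℚ) ((I.κ i : ℕ) : ℚ) : ℝ)) z (List.finRange n) =
      ∑ i with I.κ i = c, z i - ∑ i with I.κ i ≠ c, z i := by
  rw [dot_finRange, Finset.sum_filter, Finset.sum_filter, ← Finset.sum_sub_distrib]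
  refine Finset.sum_congr rfl fun i _ => ?_
  by_cases h : I.κ i = c
  · simp [sgn, h]
  · have : ((I.κ i : ℕ) : ℚ) ≠ ((c : ℕ) : ℚ) := by
      simpa [Fin.val_inj] using h
    simp [sgn, h, this]

theorem mem_feasibleCKP (I : CKPInstance n m) (z : Fin n → ℝ) :
    z ∈ I.feasibleCKP ↔ Box z ∧
      dot (fun i => ((I.w i : ℚ) : ℝ)) z (List.finRange n) ≤ ((I.b : ℚ) : ℝ) ∧
      ∀ c : Fin m, dot (fun i => (sgn ((c : ℕ) : ℚ) ((I.κ i : ℕ) : ℚ) : ℝ)) z (List.finRange n) ≤ 1 := by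
  simp only [CKPInstance.feasibleCKP, Set.mem_ofPred_eq, Box, dot_sgn]
  rw [dot_finRange]
  simp only [Rat.cast_intCast]
  constructor
  · rintro ⟨h1, h2, h3, h4⟩
    exact ⟨fun i => ⟨h4 i, h3 i⟩, h1, h2⟩
  · rintro ⟨h1, h2, h3⟩
    exact ⟨h2, h3, fun i => (h1 i).2, fun i => (h1 i).1⟩

theorem profit_eq (I : CKPInstance n m) (z : Fin n → ℝ) :
    I.profit z = dot (fun i => ((I.p i : ℚ) : ℝ)) z (List.finRange n) := by
  simp [CKPInstance.profit, dot_finRange]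

theorem Comp.run {P : Program} {x v : Val} {T : ℕ} (h : Comp P 0 x v T) :
    ∃ t, P.Run x v t ∧ t ≤ T := by
  obtain ⟨body, hb, t, ht, h⟩ := h
  exact ⟨t, ⟨body, hb, h⟩, ht⟩

/-- The overhead that remains for an empty list is absorbed because there is at least one item. -/
theorem mul_succ_le {K n : ℕ} (hn : 1 ≤ n) : K * (n + 1) ≤ 2 * K * n := by
  nlinarith [Nat.mul_le_mul_left K hn]

theorem solve_reduced : ∃ (P : Program) (C : ℕ), ∀ (n m : ℕ) (I : CKPInstance n m) (c : Fin m),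
    1 ≤ n → ∃ (out : Val) (t : ℕ), P.Run (I.encodeReduced c) out t ∧ t ≤ C * n ∧
      ((I.feasibleReduced c).Nonempty →
        ∃ x : Fin n → ℚ, out = encodeVec x ∧
          I.IsOptimal (I.feasibleReduced c) (fun i => (x i : ℝ))) ∧
      (I.feasibleReduced c = ∅ → out = Val.nil) := by
  obtain ⟨K, hK⟩ := reduced_comp (.call fReduced (.var 0))
  refine ⟨prog (.call fReduced (.var 0)), 2 * (K + 2), fun n m I c hn => ?_⟩
  obtain ⟨out, hout, hans⟩ := hK (fun i => (I.p i : ℚ)) (fun i => (I.w i : ℚ))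
    (fun i => (I.g c i : ℚ)) (List.finRange n) I.b (List.nodup_finRange n) fun i => by
      unfold CKPInstance.g
      split_ifs <;> simp
  rw [← encodeReduced_eq] at hout
  have hmain : Comp (prog (.call fReduced (.var 0))) 0 (I.encodeReduced c) out ((K + 2) * (n + 1)) := by
    refine ⟨_, rfl, (Runs.call rfl hout).mono ?_⟩
    simp only [size, List.length_finRange]
    nlinarith
  obtain ⟨t, ht, htle⟩ := hmain.run
  refine ⟨out, t, ht, htle.trans (mul_succ_le hn), ?_⟩
  rcases hans with ⟨rfl, hinf⟩ | ⟨φ, rfl, hbox, h1, h2, hopt⟩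
  · refine ⟨fun ⟨z, hz⟩ => ?_, fun _ => rfl⟩
    obtain ⟨hz1, hz2, hz3⟩ := (mem_feasibleReduced I c z).1 hz
    exact (hinf z hz1 hz2 hz3).elim
  · have hmem : (fun i => (φ i : ℝ)) ∈ I.feasibleReduced c :=
      (mem_feasibleReduced I c _).2 ⟨hbox.cast, by rw [← dot_cast]; exact_mod_cast h1,
        by rw [← dot_cast]; exact_mod_cast h2⟩
    refine ⟨fun _ => ⟨φ, encL_finRange φ, hmem, fun z hz => ?_⟩, fun h => ?_⟩
    · obtain ⟨hz1, hz2, hz3⟩ := (mem_feasibleReduced I c z).1 hz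
      rw [profit_eq, profit_eq]
      exact hopt z hz1 hz2 hz3
    · rw [h] at hmem
      exact hmem.elim

theorem solve_relaxation : ∃ (P : Program) (C : ℕ), ∀ (n m : ℕ) (I : CKPInstance n m), 1 ≤ n →
    ∃ (out : Val) (t : ℕ), P.Run I.encodeCKP out t ∧ t ≤ C * n ∧
      ∃ x : Fin n → ℚ, out = encodeVec x ∧
        I.IsOptimal I.feasibleCKP (fun i => (x i : ℝ)) := by
  obtain ⟨K, hK⟩ := relaxation_comp
  refine ⟨prog relaxationBody, 2 * K, fun n m I hn => ?_⟩
  obtain ⟨φ, hrun, hbox, h1, h2, hopt⟩ := hK (fun i => (I.p i : ℚ)) (fun i => (I.w i : ℚ))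
    (fun i => ((I.κ i : ℕ) : ℚ)) (List.finRange n) I.b (by exact_mod_cast I.b_pos.le)
    (List.nodup_finRange n)
  rw [← encodeCKP_eq, List.length_finRange] at hrun
  obtain ⟨t, ht, htle⟩ := hrun.run
  refine ⟨_, t, ht, htle.trans (mul_succ_le hn), φ, encL_finRange φ,
    (mem_feasibleCKP I _).2 ⟨hbox.cast, by rw [← dot_cast]; exact_mod_cast h1, fun c => ?_⟩,
    fun z hz => ?_⟩
  · rw [← dot_cast]
    exact_mod_cast h2 c
  · obtain ⟨hz1, hz2, hz3⟩ := (mem_feasibleCKP I z).1 hz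
    rw [profit_eq, profit_eq]
    exact hopt z hz1 hz2 fun i _ => hz3 (I.κ i)

end

end ColoredKnapsack

theorem proposition1 :
    -- the reduced LP
    (∃ (P : Program) (C : ℕ), ∀ (n m : ℕ) (I : CKPInstance n m) (c : Fin m), 1 ≤ n →
      ∃ (out : Val) (t : ℕ), P.Run (I.encodeReduced c) out t ∧ t ≤ C * n ∧
        ((I.feasibleReduced c).Nonempty →
          ∃ x : Fin n → ℚ, out = encodeVec x ∧
            I.IsOptimal (I.feasibleReduced c) (fun i => (x i : ℝ))) ∧
        (I.feasibleReduced c = ∅ → out = Val.nil)) ∧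
    -- the LP relaxation of the colored knapsack problem
    (∃ (P : Program) (C : ℕ), ∀ (n m : ℕ) (I : CKPInstance n m), 1 ≤ n →
      ∃ (out : Val) (t : ℕ), P.Run I.encodeCKP out t ∧ t ≤ C * n ∧
        ∃ x : Fin n → ℚ, out = encodeVec x ∧
          I.IsOptimal I.feasibleCKP (fun i => (x i : ℝ))) :=
  ⟨ColoredKnapsack.solve_reduced, ColoredKnapsack.solve_relaxation⟩
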